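/- **Setting.** Let $V$ be a set of $n$ vertices. A directed acyclic graph (the *starting graph*) with edge set $E_0$ and a topological order $T:V\to\{1,\dots,n\}$ of it (a bijection with $T(x)<T(y)$ for every edge $x\to y$) are given. Then edges $e_1,\dots,e_m$ are inserted one after the other; they are pairwise distinct, not in $E_0$, and $E_0\cup\{e_1,\dots,e_m\}$ is acyclic. Write $u<v$ for $T(u)<T(v)$ and $d(u,v)=|T(u)-T(v)|$ (with the current $T$). Let $p\ge 0$ be an integer with $p=O(\log n)$ and let $t_0,\dots,t_{p+1}$ be real parameters with $n^{0.5}<t_0<t_1<\dots<t_p<t_{p+1}=n$. **Algorithm.** Let $\hat A_i=\{w: u\to w,\ d(u,w)\le t_i,\ w<v\}$ and $\hat B_i=\{w: w\to v,\ d(w,v)\le t_i,\ w>u\}$ for the current graph and order. - $\mathrm{Insert}(u,v)$: if $v\le u$, call $\mathrm{Reorder}(v,u,0,0)$; then insert the edge $u\to v$ into the graph. - $\mathrm{Reorder}(u,v,f_1,f_2)$: if $v\le u$, exit. If $d(u,v)\le t_0$, put $A=\hat A_0$ and $B=\hat B_0$. If $t_i<d(u,v)\le t_{i+1}$ with $0\le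 i\le p$, compute $\hat A_i$ and $\hat B_i$; put $A=\hat A_i$ if $\hat A_i\ne\emptyset$ or $f_1=1$, and otherwise compute $\hat A_{i+1}$ and put $A=\hat A_{i+1}$; likewise put $B=\hat B_i$ if $\hat B_i\neq\emptyset$ or $f_2=1$, and otherwise compute $\hat B_{i+1}$ and put $B=\hat B_{i+1}$. If $A=B=\emptyset$, exchange the positions of $u$ and $v$ in $T$. Otherwise, with respect to the order at the start of this call, for every $u'\in A\cup\{u\}$ in decreasing order, and for every $v'\in B\cup\{v\}$ with $v'>u'$ in increasing order, call $\mathrm{Reorder}(u',v',f_1',f_2')$, where $f_1'=1$ iff $u'=u$ and $A=\emptyset$, and $f_2'=1$ iff $v'=v$ and $B=\emptyset$. **Data structures and cost.** Time is the number of steps of a unit-cost RAM. $T$ and $T^{-1}$ are arrays; for each vertex the in- and out-neighbours are stored in $n$-bit arrays. For each vertex $u$ and each $0\le i\le p+1$ there are two *pails*, holding the $w$ with $u\to w$ and $0<d(u,w)\le t_i$, respectively the $w$ with $w\to u$ and $0<d(w,u)\le t_i$; pails are balanced binary search trees (AVL trees) keyed by the vertex index. Inserting an edge updates the bit arrays and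 the pails of its two ends. The sets $\hat A_i,\hat B_i$ are obtained by reading out a pail and sorting its content by $T$, by a comparison sort (insertion into a balanced search tree) if $d(u,v)>t_i$ and by counting sort with $O(t_i)$ buckets if $d(u,v)\le t_i$. Exchanging $u<v$ updates $T$, $T^{-1}$ and, for each $i$, the pails affected: it runs through the ranges of positions $T(u)-t_i\le T(w)<\min\{T(u),T(u)-t_i+d\}$ and $\max\{T(v)+t_i-d,T(v)\}<T(w)\le T(v)+t_i$ and deletes, then through $\max\{T(v),T(u)+t_i\}<T(w)\le T(u)+t_i+d$ and $T(v)-t_i-d\le T(w)<\min\{T(u),T(v)-t_i+d\}$ and inserts the neighbours found there, where $d=d(u,v)$. **Theorem.** The algorithm terminates, and the total time required for inserting the sequence of edges is $$\tilde O\!\left(\sum_{i=1}^{p+1}\frac{n^2t_i^{3/2}}{t_{i-1}}+n^2t_0\right).$$ That is, there is an integer $\kappa\ge 0$ such that for every real $c$ there is a constant $C$ for which, for all $n$, all $p\le c\log n$, all parameters $t_0,\dots,t_{p+1}$, all starting graphs with a topological order, and all sequences of edges as above, the total number of steps is at most $$C\,(\log n)^{\kappa}\left(\sum_{i=1}^{p+1}\frac{n^2t_i^{3/2}}{t_{i-1}}+n^2t_0\right).$$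 -/

import Mathlib

/-!
Online topological ordering: the insertion algorithm with auxiliary pails, as an executable
program whose elementary steps are counted on a clock.

Cost model: a unit-cost RAM.  One unit pays for a constant number of array accesses, comparisons
and arithmetic operations on indices; loops and recursions pay at least one unit per round.
-/

namespace OnlineTopo

/-! ### Computations with a step count -/

/-- A value together with the number of steps spent on computing it. -/
structure Timed (α : Type) where
  ret : α
  time : ℕ

namespace Timed

instance : Monad Timed where
  pure a := ⟨a, 0⟩
  bind x f := ⟨(f x.ret).ret, x.time + (f x.ret).time⟩

/-- Spend `k` steps. -/
def tick (k : ℕ) : Timed Unit := ⟨(), k⟩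

end Timed

/-! ### Balanced binary search trees (AVL trees) -/

/-- Binary search trees; every node stores its height. -/
inductive SearchTree (α : Type) where
  | nil : SearchTree α
  | node (h : ℕ) (l : SearchTree α) (k : α) (r : SearchTree α) : SearchTree α

namespace SearchTree

variable {α : Type}

def height : SearchTree α → ℕ
  | nil => 0
  | node h _ _ _ => h

/-- The node with key `k` and the given subtrees, with its height filled in. -/
def mk (l : SearchTree α) (k : α) (r : SearchTree α) : SearchTree α :=
  node (max l.height r.height + 1) l k r

/-- As `mk`, but restores the AVL condition by a single or double rotation
when the heights of `l` and `r` differ by two. -/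
def balance (l : SearchTree α) (k : α) (r : SearchTree α) : SearchTree α :=
  if r.height + 1 < l.height then
    match l with
    | nil => mk l k r
    | node _ ll lk lr =>
      if lr.height ≤ ll.height then mk ll lk (mk lr k r)
      else
        match lr with
        | nil => mk l k r
        | node _ lrl lrk lrr => mk (mk ll lk lrl) lrk (mk lrr k r)
  else if l.height + 1 < r.height then
    match r with
    | nil => mk l k r
    | node _ rl rk rr =>
      if rl.height ≤ rr.height then mk (mk l k rl) rk rr
      else
        match rl with
        | nil => mk l k r
        | node _ rll rlk rlr => mk (mk l k rll) rlk (mk rlr rk rr)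
  else mk l k r

variable [LinearOrder α]

/-- Insert a key (nothing changes if it is present). -/
def insert (x : α) : SearchTree α → Timed (SearchTree α)
  | nil => do
    Timed.tick 1
    return mk nil x nil
  | node h l k r => do
    Timed.tick 1
    if x < k then
      let l' ← insert x l
      return balance l' k r
    else if k < x then
      let r' ← insert x r
      return balance l k r'
    else
      return node h l k r

/-- Remove the least key of the nonempty tree with subtrees `l`, `r` and root key `k`;
returns that key and the remaining tree. -/
def popMin : SearchTree α → α → SearchTree α → Timed (α × SearchTree α)
  | nil, k, r => do
    Timed.tick 1
    return (k, r)
  | node _ ll lk lr, k, r => do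
    Timed.tick 1
    let q ← popMin ll lk lr
    return (q.1, balance q.2 k r)

/-- Delete a key (nothing changes if it is absent). -/
def delete (x : α) : SearchTree α → Timed (SearchTree α)
  | nil => do
    Timed.tick 1
    return nil
  | node _ l k r => do
    Timed.tick 1
    if x < k then
      let l' ← delete x l
      return balance l' k r
    else if k < x then
      let r' ← delete x r
      return balance l k r'
    else
      match r with
      | nil => return l
      | node _ rl rk rr =>
        let q ← popMin rl rk rr
        return balance l q.1 q.2

/-- Put the keys of a tree, in decreasing order, in front of `acc`. -/
def collectOnto : SearchTree α → List α → Timed (List α)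
  | nil, acc => do
    Timed.tick 1
    return acc
  | node _ l k r, acc => do
    Timed.tick 1
    let acc' ← collectOnto l acc
    collectOnto r (k :: acc')

/-- All keys of a tree, in decreasing order. -/
def collectAll (t : SearchTree α) : Timed (List α) := collectOnto t []

end SearchTree

/-! ### The two sorting routines -/

section Sorting

variable {n : ℕ}

/-- Insert the positions of the listed vertices into a search tree. -/
def plant (T : Fin n ≃ Fin n) : List (Fin n) → SearchTree (Fin n) → Timed (SearchTree (Fin n))
  | [], t => return t
  | w :: ws, t => do
    Timed.tick 1
    let t' ← t.insert (T w)
    plant T ws t'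

/-- Sort vertices by decreasing position, by means of a search tree. -/
def treeSort (T : Fin n ≃ Fin n) (ws : List (Fin n)) : Timed (List (Fin n)) := do
  let t ← plant T ws SearchTree.nil
  let qs ← t.collectAll
  Timed.tick qs.length
  return qs.map T.symm

/-- Distribute vertices to buckets according to `key`. -/
def scatter (key : Fin n → ℕ) :
    List (Fin n) → (ℕ → List (Fin n)) → Timed (ℕ → List (Fin n))
  | [], b => return b
  | w :: ws, b => do
    Timed.tick 1
    scatter key ws (Function.update b (key w) (w :: b (key w)))

/-- Concatenate the buckets `0, …, k - 1` in front of `acc`. -/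
def gather (b : ℕ → List (Fin n)) : ℕ → List (Fin n) → Timed (List (Fin n))
  | 0, acc => return acc
  | k + 1, acc => do
    Timed.tick (1 + (b k).length)
    gather b k (b k ++ acc)

/-- Counting sort of vertices by increasing `key`, for keys in `{0, …, m}`;
the first line pays for the allocation of the `m + 1` empty buckets. -/
def countingSort (m : ℕ) (key : Fin n → ℕ) (ws : List (Fin n)) : Timed (List (Fin n)) := do
  Timed.tick (m + 1)
  let b ← scatter key ws (fun _ => [])
  gather b (m + 1) []

end Sorting

/-! ### Memory and programs -/

/-- The memory for vertices `Fin n`.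
* `pos` is the current order `T` together with its inverse (two arrays);
* `outAdj u v` and `inAdj v u` are the bit arrays for the edges `u → v`;
* `outPail u i` holds the `w` with `u → w` and `0 < d(u, w) ≤ t i`, and
  `inPail u i` holds the `w` with `w → u` and `0 < d(w, u) ≤ t i`;
* `clock` is the number of steps made so far. -/
structure Mem (n : ℕ) where
  pos : Fin n ≃ Fin n
  outAdj : Fin n → Fin n → Bool
  inAdj : Fin n → Fin n → Bool
  outPail : Fin n → ℕ → SearchTree (Fin n)
  inPail : Fin n → ℕ → SearchTree (Fin n)
  clock : ℕ

/-- Programs acting on the memory; `none` means that a program does not return. -/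
abbrev Prog (n : ℕ) (α : Type) : Type := StateT (Mem n) Option α

section Programs

variable {n : ℕ}

/-- Run a step-counted computation and let the clock advance accordingly. -/
def timed {α : Type} (x : Timed α) : Prog n α := do
  modify fun s => { s with clock := s.clock + x.time }
  return x.ret

def tick (k : ℕ) : Prog n Unit := timed (Timed.tick k)

def outPailInsert (u : Fin n) (i : ℕ) (w : Fin n) : Prog n Unit := do
  let s ← get
  let t ← timed ((s.outPail u i).insert w)
  modify fun s =>
    { s with outPail := Function.update s.outPail u (Function.update (s.outPail u) i t) }

def outPailDelete (u : Fin n) (i : ℕ) (w : Fin n) : Prog n Unit := do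
  let s ← get
  let t ← timed ((s.outPail u i).delete w)
  modify fun s =>
    { s with outPail := Function.update s.outPail u (Function.update (s.outPail u) i t) }

def inPailInsert (u : Fin n) (i : ℕ) (w : Fin n) : Prog n Unit := do
  let s ← get
  let t ← timed ((s.inPail u i).insert w)
  modify fun s =>
    { s with inPail := Function.update s.inPail u (Function.update (s.inPail u) i t) }

def inPailDelete (u : Fin n) (i : ℕ) (w : Fin n) : Prog n Unit := do
  let s ← get
  let t ← timed ((s.inPail u i).delete w)
  modify fun s =>
    { s with inPail := Function.update s.inPail u (Function.update (s.inPail u) i t) }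

/-- Run `f` on the vertices at the positions `q` with `a ≤ q < b` (and `q < n`), one after
the other. -/
def forPositions (a b : ℕ) (f : Fin n → Prog n Unit) : Prog n Unit :=
  (List.Ico a (min b n)).forM fun q => do
    tick 1
    let s ← get
    if h : q < n then f (s.pos.symm ⟨q, h⟩) else pure ()

/-! In the sequel `p` and `t : ℕ → ℕ` are the parameters of the algorithm: the thresholds are
`t 0, …, t (p + 1)`.  As `d(u, v)` is an integer, `d(u, v) ≤ t i` may be tested with the integer
part of a real threshold, and only integer thresholds are used here. -/

/-- Insert the edge `u → v` into the adjacency arrays and into the pails. -/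
def insertEdge (p : ℕ) (t : ℕ → ℕ) (u v : Fin n) : Prog n Unit := do
  tick 2
  modify fun s => { s with
    outAdj := Function.update s.outAdj u (Function.update (s.outAdj u) v true)
    inAdj := Function.update s.inAdj v (Function.update (s.inAdj v) u true) }
  (List.range (p + 2)).forM fun i => do
    tick 1
    let s ← get
    let a : ℕ := s.pos u
    let b : ℕ := s.pos v
    if a < b ∧ b - a ≤ t i then
      outPailInsert u i v
      inPailInsert v i u

/-- Update the pails of level `i` for a swap of `u` and `v`, where `u` is before `v`.
Writing `T` for the current order and `d = T v - T u`, the four loops run over the `w` with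
* `T u - t i ≤ T w < min (T u) (T u - t i + d)`,
* `max (T v + t i - d) (T v) < T w ≤ T v + t i`,
* `max (T v) (T u + t i) < T w ≤ T u + t i + d`,
* `T v - t i - d ≤ T w < min (T u) (T v - t i + d)`. -/
def swapPails (t : ℕ → ℕ) (u v : Fin n) (i : ℕ) : Prog n Unit := do
  tick 1
  let s ← get
  let a : ℕ := s.pos u
  let b : ℕ := s.pos v
  let d : ℕ := b - a
  forPositions (a - t i) (min a (a + d - t i)) fun w => do
    inPailDelete u i w
    outPailDelete w i u
  forPositions (max (b + t i - d) b + 1) (b + t i + 1) fun w => do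
    outPailDelete v i w
    inPailDelete w i v
  forPositions (max b (a + t i) + 1) (a + t i + d + 1) fun w => do
    if s.outAdj u w then
      outPailInsert u i w
      inPailInsert w i u
  forPositions (b - d - t i) (min a (b + d - t i)) fun w => do
    if s.inAdj v w then
      inPailInsert v i w
      outPailInsert w i v

/-- Exchange the positions of `u` and `v`, where `u` is before `v`. -/
def swapVertices (p : ℕ) (t : ℕ → ℕ) (u v : Fin n) : Prog n Unit := do
  (List.range (p + 2)).forM fun i => swapPails t u v i
  tick 4
  modify fun s => { s with pos := (Equiv.swap u v).trans s.pos }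

/-- The set `{w | u → w, d(u, w) ≤ t i, w < v}`, in decreasing order, by counting sort. -/
def outNearCount (t : ℕ → ℕ) (i : ℕ) (u v : Fin n) : Prog n (List (Fin n)) := do
  let s ← get
  let ws ← timed (s.outPail u i).collectAll
  let ws' ← timed (countingSort (t i) (fun w => (s.pos u : ℕ) + t i - s.pos w) ws)
  tick ws'.length
  return ws'.filter fun w => s.pos w < s.pos v

/-- The set `{w | w → v, d(w, v) ≤ t i, u < w}`, in decreasing order, by counting sort. -/
def inNearCount (t : ℕ → ℕ) (i : ℕ) (u v : Fin n) : Prog n (List (Fin n)) := do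
  let s ← get
  let ws ← timed (s.inPail v i).collectAll
  let ws' ← timed (countingSort (t i) (fun w => (s.pos v : ℕ) - s.pos w) ws)
  tick ws'.length
  return ws'.filter fun w => s.pos u < s.pos w

/-- The set `{w | u → w, d(u, w) ≤ t i, w < v}`, in decreasing order, by comparison sort. -/
def outNearTree (i : ℕ) (u v : Fin n) : Prog n (List (Fin n)) := do
  let s ← get
  let ws ← timed (s.outPail u i).collectAll
  let ws' ← timed (treeSort s.pos ws)
  tick ws'.length
  return ws'.filter fun w => s.pos w < s.pos v

/-- The set `{w | w → v, d(w, v) ≤ t i, u < w}`, in decreasing order, by comparison sort. -/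
def inNearTree (i : ℕ) (u v : Fin n) : Prog n (List (Fin n)) := do
  let s ← get
  let ws ← timed (s.inPail v i).collectAll
  let ws' ← timed (treeSort s.pos ws)
  tick ws'.length
  return ws'.filter fun w => s.pos u < s.pos w

/-- The least `j` in `{k, …, k + m}` with `d ≤ t j` (and `k + m` if there is none), by linear
search. -/
def findLevel (t : ℕ → ℕ) (d : ℕ) : ℕ → ℕ → Timed ℕ
  | k, 0 => do
    Timed.tick 1
    return k
  | k, m + 1 => do
    Timed.tick 1
    if d ≤ t k then return k else findLevel t d (k + 1) m

/-- The sets `A` and `B` of a call of `reorder`, in decreasing order. -/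
def nearSets (p : ℕ) (t : ℕ → ℕ) (u v : Fin n) (f₁ f₂ : Bool) :
    Prog n (List (Fin n) × List (Fin n)) := do
  let s ← get
  let j ← timed (findLevel t ((s.pos v : ℕ) - s.pos u) 0 (p + 1))
  match j with
  | 0 =>
    let A ← outNearCount t 0 u v
    let B ← inNearCount t 0 u v
    return (A, B)
  | i + 1 =>
    let A₀ ← outNearTree i u v
    let B₀ ← inNearTree i u v
    let A ← if A₀ ≠ [] ∨ f₁ = true then pure A₀ else outNearCount t (i + 1) u v
    let B ← if B₀ ≠ [] ∨ f₂ = true then pure B₀ else inNearCount t (i + 1) u v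
    return (A, B)

/-- The pairs `(u', v')` with `v'` in the given decreasing list and `u' < v'`, in increasing order
of `v'`, put in front of `acc`. -/
def callsFrom (T : Fin n ≃ Fin n) (u' : Fin n) :
    List (Fin n) → List (Fin n × Fin n) → Timed (List (Fin n × Fin n))
  | [], acc => do
    Timed.tick 1
    return acc
  | v' :: vs, acc => do
    Timed.tick 1
    if T u' < T v' then callsFrom T u' vs ((u', v') :: acc) else return acc

/-- All pairs `(u', v')` with `u'` in `us`, `v'` in `vs` and `u' < v'` (both lists are decreasing),
for decreasing `u'` and, for the same `u'`, for increasing `v'`. -/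
def schedule (T : Fin n ≃ Fin n) (vs : List (Fin n)) :
    List (Fin n) → Timed (List (Fin n × Fin n))
  | [] => return []
  | u' :: us => do
    Timed.tick 1
    let c ← callsFrom T u' vs []
    let cs ← schedule T vs us
    return c ++ cs

/-- Change the order, so that `v` comes before `u`.  The pairs for the recursive calls are
determined by the order at the start of the execution.

The recursion is unbounded; `fuel` bounds its depth only to make it a total function, and the result
is `none` (for the whole program) when the depth is exceeded.  A result different from `none` does
not depend on `fuel`, and no steps are charged for it. -/
def reorder (p : ℕ) (t : ℕ → ℕ) :
    (fuel : ℕ) → (u v : Fin n) → (f₁ f₂ : Bool) → Prog n Unit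
  | 0, _, _, _, _ => failure
  | fuel + 1, u, v, f₁, f₂ => do
    tick 1
    let s ← get
    if s.pos v ≤ s.pos u then
      pure ()
    else
      let AB ← nearSets p t u v f₁ f₂
      if AB.1 = [] ∧ AB.2 = [] then
        swapVertices p t u v
      else
        let cs ← timed (schedule s.pos (v :: AB.2) (AB.1 ++ [u]))
        tick (AB.1.length + cs.length)
        cs.forM fun c =>
          reorder p t fuel c.1 c.2
            (decide (c.1 = u ∧ AB.1 = [])) (decide (c.2 = v ∧ AB.2 = []))

/-- Process the insertion of the edge `u → v`. -/
def insert (p : ℕ) (t : ℕ → ℕ) (fuel : ℕ) (u v : Fin n) : Prog n Unit := do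
  tick 1
  let s ← get
  if s.pos v ≤ s.pos u then reorder p t fuel v u false false
  insertEdge p t u v

/-- The memory for the graph without edges and the order `T`. -/
def emptyMem (T : Fin n ≃ Fin n) : Mem n where
  pos := T
  outAdj := fun _ _ => false
  inAdj := fun _ _ => false
  outPail := fun _ _ => SearchTree.nil
  inPail := fun _ _ => SearchTree.nil
  clock := 0

/-- Set up the data structures for the starting graph with edges `E₀`, start the clock, and insert
the edges `es` one after the other. -/
def session (p : ℕ) (t : ℕ → ℕ) (fuel : ℕ) (E₀ es : List (Fin n × Fin n)) : Prog n Unit := do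
  E₀.forM fun e => insertEdge p t e.1 e.2
  modify fun s => { s with clock := 0 }
  es.forM fun e => insert p t fuel e.1 e.2

end Programs

/-- The order `T` is a topological order of the graph with edges `E`. -/
def IsTopologicalOrder {n : ℕ} (E : List (Fin n × Fin n)) (T : Fin n ≃ Fin n) : Prop :=
  ∀ e ∈ E, T e.1 < T e.2

/-- The directed graph with edges `E` has no directed cycle. -/
def IsAcyclic {n : ℕ} (E : List (Fin n × Fin n)) : Prop :=
  ∀ x : Fin n, ¬ Relation.TransGen (fun a b => (a, b) ∈ E) x x

end OnlineTopo

/-!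
Fix a topological order `S` of the final graph, and call a pair of vertices settled by the order `T`
if the second is reachable from the first and comes after it in `T`.  The algorithm never unsettles
a pair.  For a distance `t`, consider the potential
`t * #{settled pairs at distance at most n / √t in S} + √t / n * ∑ x, S x * T x`,
which is at most `2 n² √t`.  An exchange over a distance of at most `t` raises it by at least that
distance: either a pair which is close in `S` becomes settled, or `∑ x, S x * T x` grows by at least
`n / √t` times the distance.

* Apart from logarithmic factors, an exchange takes time proportional to its distance, so the
  potential with `t = n` bounds the time of the exchanges by `n² √n ≤ n² t₀`.
* A call of `Reorder` which is not a single exchange makes at least two recursive calls, and every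
  exchange settles a new pair, so there are fewer than `2 n²` calls.  A call costs `O(t₀)`, apart
  from logarithmic factors, the work shared among its recursive calls, and the counting sorts at
  levels above `0`.
* A counting sort with `O(t_{i+1})` buckets happens after the set of radius `t_i` was found empty
  and the flag of its side was `0`.  The call then moves its end `u` (or `v`) by more than `t_i`,
  because the exchanges of `u` do not end within `t_i`.  A displacement is charged at most twice:
  if the set `A` read out by the sort is empty, the nested calls for `u` have the flag `1`, and
  otherwise they start when `u` has no out-neighbour left below the target, so that the flag is `1`
  one level further down.  Hence the potential with `t = t_{i+1}`, scaled by `t_{i+1} / t_i`, bounds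
  the time of these sorts by `n² t_{i+1}^{3/2} / t_i`.
-/

namespace OnlineTopo

open Relation

namespace Timed

variable {α β : Type}

@[simp] theorem ret_bind (x : Timed α) (f : α → Timed β) : (x >>= f).ret = (f x.ret).ret := rfl

@[simp] theorem time_bind (x : Timed α) (f : α → Timed β) :
    (x >>= f).time = x.time + (f x.ret).time := rfl

@[simp] theorem ret_pure (a : α) : (pure a : Timed α).ret = a := rfl

@[simp] theorem time_pure (a : α) : (pure a : Timed α).time = 0 := rfl

@[simp] theorem time_tick (k : ℕ) : (tick k).time = k := rfl

end Timed

theorem pairwise_lt_append_cons {α : Type*} [Preorder α] {l r : List α} {k : α} :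
    (l ++ k :: r).Pairwise (· < ·) ↔
      l.Pairwise (· < ·) ∧ r.Pairwise (· < ·) ∧ (∀ a ∈ l, a < k) ∧ ∀ b ∈ r, k < b := by
  simp only [List.pairwise_append, List.pairwise_cons, List.mem_cons]
  refine ⟨fun ⟨hl, ⟨hkr, hr⟩, hlr⟩ => ⟨hl, hr, fun a ha => hlr a ha k (.inl rfl), hkr⟩,
    fun ⟨hl, hr, hlk, hkr⟩ => ⟨hl, ⟨hkr, hr⟩, ?_⟩⟩
  rintro a ha b (rfl | hb)
  exacts [hlk a ha, (hlk a ha).trans (hkr b hb)]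

theorem filter_ne_eq_self {α : Type*} [DecidableEq α] {l : List α} {x : α} (h : x ∉ l) :
    l.filter (· ≠ x) = l :=
  List.filter_eq_self.mpr fun a ha => by simpa using ne_of_mem_of_not_mem ha h

namespace SearchTree

variable {α : Type}

/-- The keys of a search tree in symmetric order. -/
def toList : SearchTree α → List α
  | nil => []
  | node _ l k r => l.toList ++ k :: r.toList

/-- The AVL condition: the stored heights are correct, and the heights of siblings differ by at
most one. The order of the keys is a separate matter. -/
def IsAVL : SearchTree α → Prop
  | nil => True
  | node h l _ r => l.IsAVL ∧ r.IsAVL ∧ h = max l.height r.height + 1 ∧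
      l.height ≤ r.height + 1 ∧ r.height ≤ l.height + 1

@[simp] theorem toList_nil : (nil : SearchTree α).toList = [] := rfl

@[simp] theorem toList_node (h : ℕ) (l : SearchTree α) (k : α) (r : SearchTree α) :
    (node h l k r).toList = l.toList ++ k :: r.toList := rfl

@[simp] theorem toList_mk (l : SearchTree α) (k : α) (r : SearchTree α) :
    (mk l k r).toList = l.toList ++ k :: r.toList := rfl

@[simp] theorem height_nil : (nil : SearchTree α).height = 0 := rfl

@[simp] theorem height_node (h : ℕ) (l : SearchTree α) (k : α) (r : SearchTree α) :
    (node h l k r).height = h := rfl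

@[simp] theorem toList_balance (l : SearchTree α) (k : α) (r : SearchTree α) :
    (balance l k r).toList = l.toList ++ k :: r.toList := by
  fun_cases balance l k r <;> simp_all

theorem isAVL_balance {l r : SearchTree α} (k : α) (hl : l.IsAVL) (hr : r.IsAVL)
    (hlr : l.height ≤ r.height + 2) (hrl : r.height ≤ l.height + 2) :
    (balance l k r).IsAVL ∧ max l.height r.height ≤ (balance l k r).height ∧
      (balance l k r).height ≤ max l.height r.height + 1 ∧
      (l.height ≤ r.height + 1 → r.height ≤ l.height + 1 →
        (balance l k r).height = max l.height r.height + 1) := by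
  fun_cases balance l k r <;>
    simp only [mk, IsAVL, height_node, height_nil] at * <;> grind

theorem IsAVL.two_pow_le_length {m : ℕ} {t : SearchTree α} (ht : t.IsAVL) (hm : m ≤ t.height) :
    2 ^ (m / 2) ≤ t.toList.length + 1 := by
  induction m using Nat.strong_induction_on generalizing t with
  | _ m ih =>
    rcases Nat.lt_or_ge m 2 with hm2 | hm2
    · simp [Nat.div_eq_of_lt hm2]
    rcases t with _ | ⟨h, l, k, r⟩
    · simp only [height_nil] at hm; omega
    obtain ⟨hl, hr, hh, hlr, hrl⟩ := ht
    simp only [height_node] at hm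
    have hleft := ih (m - 2) (by omega) hl (by omega)
    have hright := ih (m - 2) (by omega) hr (by omega)
    have hdiv : m / 2 = (m - 2) / 2 + 1 := by omega
    rw [hdiv, pow_succ, toList_node, List.length_append, List.length_cons]
    omega

/-- An upper bound for the height of an AVL tree with at most `n` keys. -/
def maxHeight (n : ℕ) : ℕ := 2 * Nat.log 2 (n + 1) + 1

theorem IsAVL.height_le_maxHeight {n : ℕ} {t : SearchTree α} (ht : t.IsAVL)
    (hn : t.toList.length ≤ n) : t.height ≤ maxHeight n := by
  have hpow := ht.two_pow_le_length le_rfl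
  have hlog : t.height / 2 ≤ Nat.log 2 (n + 1) := Nat.le_log_of_pow_le one_lt_two (by omega)
  unfold maxHeight
  omega

theorem toList_popMin (l : SearchTree α) (k : α) (r : SearchTree α) :
    (popMin l k r).ret.1 :: (popMin l k r).ret.2.toList = l.toList ++ k :: r.toList := by
  induction l generalizing k r with
  | nil => simp [popMin]
  | node h ll lk lr ihl _ => simp [popMin, ← ihl lk lr]

theorem isAVL_popMin {h : ℕ} {l : SearchTree α} {k : α} {r : SearchTree α}
    (ht : (node h l k r).IsAVL) :
    (popMin l k r).ret.2.IsAVL ∧ h ≤ (popMin l k r).ret.2.height + 1 ∧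
      (popMin l k r).ret.2.height ≤ h ∧ (popMin l k r).time ≤ h := by
  induction l generalizing h k r with
  | nil =>
    obtain ⟨-, hr, hh, -, -⟩ := ht
    simp only [popMin, Timed.ret_bind, Timed.ret_pure, Timed.time_bind, Timed.time_tick,
      Timed.time_pure, height_nil] at *
    refine ⟨hr, ?_, ?_, ?_⟩ <;> omega
  | node lh ll lk lr ihl _ =>
    obtain ⟨hl, hr, hh, hlr, hrl⟩ := ht
    obtain ⟨hpop, hpop_ge, hpop_le, htime⟩ := ihl hl
    simp only [height_node] at *
    obtain ⟨hbal, hge, hle, heq⟩ := isAVL_balance k hpop hr (by omega) (by omega)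
    simp only [popMin, Timed.ret_bind, Timed.ret_pure, Timed.time_bind, Timed.time_tick,
      Timed.time_pure]
    refine ⟨hbal, ?_, ?_, ?_⟩ <;> omega

section LinearOrder

variable [LinearOrder α]

theorem mem_insert (x : α) (t : SearchTree α) (z : α) :
    z ∈ (insert x t).ret.toList ↔ z ∈ t.toList ∨ z = x := by
  induction t with
  | nil => simp [insert]
  | node h l k r ihl ihr =>
    simp only [insert, Timed.ret_bind]
    split_ifs with hxk hkx
    · simp [ihl]; tauto
    · simp [ihr]; tauto
    · obtain rfl : x = k := le_antisymm (not_lt.mp hkx) (not_lt.mp hxk)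
      simp; tauto

theorem pairwise_insert (x : α) {t : SearchTree α} (ht : t.toList.Pairwise (· < ·)) :
    (insert x t).ret.toList.Pairwise (· < ·) := by
  induction t with
  | nil => simp [insert]
  | node h l k r ihl ihr =>
    rw [toList_node, pairwise_lt_append_cons] at ht
    obtain ⟨hl, hr, hlk, hkr⟩ := ht
    simp only [insert, Timed.ret_bind]
    split_ifs with hxk hkx
    all_goals
      simp only [Timed.ret_bind, Timed.ret_pure, toList_balance, toList_node,
        pairwise_lt_append_cons, mem_insert]
      grind

theorem isAVL_insert (x : α) {t : SearchTree α} (ht : t.IsAVL) :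
    (insert x t).ret.IsAVL ∧ t.height ≤ (insert x t).ret.height ∧
      (insert x t).ret.height ≤ t.height + 1 ∧ (insert x t).time ≤ t.height + 1 := by
  induction t with
  | nil => simp [insert, mk, IsAVL]
  | node h l k r ihl ihr =>
    have hnode := ht
    obtain ⟨hl, hr, hh, hlr, hrl⟩ := ht
    simp only [insert, Timed.ret_bind, Timed.time_bind, Timed.time_tick, height_node]
    split_ifs with hxk hkx
    · obtain ⟨hins, hge, hle, htime⟩ := ihl hl
      obtain ⟨hbal, hbal_ge, hbal_le, hbal_eq⟩ := isAVL_balance k hins hr (by omega) (by omega)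
      simp only [Timed.ret_bind, Timed.ret_pure, Timed.time_bind, Timed.time_pure]
      refine ⟨hbal, ?_, ?_, ?_⟩ <;> omega
    · obtain ⟨hins, hge, hle, htime⟩ := ihr hr
      obtain ⟨hbal, hbal_ge, hbal_le, hbal_eq⟩ := isAVL_balance k hl hins (by omega) (by omega)
      simp only [Timed.ret_bind, Timed.ret_pure, Timed.time_bind, Timed.time_pure]
      refine ⟨hbal, ?_, ?_, ?_⟩ <;> omega
    · exact ⟨hnode, le_rfl, by simp, by simp⟩

theorem toList_delete (x : α) {t : SearchTree α} (ht : t.toList.Pairwise (· < ·)) :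
    (delete x t).ret.toList = t.toList.filter (· ≠ x) := by
  induction t with
  | nil => simp [delete]
  | node h l k r ihl ihr =>
    rw [toList_node, pairwise_lt_append_cons] at ht
    obtain ⟨hl, hr, hlk, hkr⟩ := ht
    have filter_left : k ≤ x → l.toList.filter (· ≠ x) = l.toList := fun hkx =>
      filter_ne_eq_self fun hx => (hlk x hx).not_ge hkx
    have filter_right : x ≤ k → r.toList.filter (· ≠ x) = r.toList := fun hxk =>
      filter_ne_eq_self fun hx => (hkr x hx).not_ge hxk
    simp only [delete, Timed.ret_bind, toList_node, List.filter_append]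
    split_ifs with hxk hkx
    · rw [List.filter_cons_of_pos (by simpa using hxk.ne'), filter_right hxk.le]
      simp [ihl hl]
    · rw [List.filter_cons_of_pos (by simpa using hkx.ne), filter_left hkx.le]
      simp [ihr hr]
    · obtain rfl : x = k := le_antisymm (not_lt.mp hkx) (not_lt.mp hxk)
      rw [List.filter_cons_of_neg (by simp), filter_left le_rfl, filter_right le_rfl]
      rcases r with _ | ⟨_, rl, rk, rr⟩ <;> simp [toList_popMin]

theorem isAVL_delete (x : α) {t : SearchTree α} (ht : t.IsAVL) :
    (delete x t).ret.IsAVL ∧ t.height ≤ (delete x t).ret.height + 1 ∧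
      (delete x t).ret.height ≤ t.height ∧ (delete x t).time ≤ t.height + 1 := by
  induction t with
  | nil => simp [delete, IsAVL]
  | node h l k r ihl ihr =>
    obtain ⟨hl, hr, hh, hlr, hrl⟩ := ht
    simp only [delete, Timed.ret_bind, Timed.time_bind, Timed.time_tick, height_node]
    split_ifs with hxk hkx
    · obtain ⟨hdel, hge, hle, htime⟩ := ihl hl
      obtain ⟨hbal, hbal_ge, hbal_le, hbal_eq⟩ := isAVL_balance k hdel hr (by omega) (by omega)
      simp only [Timed.ret_bind, Timed.ret_pure, Timed.time_bind, Timed.time_pure]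
      refine ⟨hbal, ?_, ?_, ?_⟩ <;> omega
    · obtain ⟨hdel, hge, hle, htime⟩ := ihr hr
      obtain ⟨hbal, hbal_ge, hbal_le, hbal_eq⟩ := isAVL_balance k hl hdel (by omega) (by omega)
      simp only [Timed.ret_bind, Timed.ret_pure, Timed.time_bind, Timed.time_pure]
      refine ⟨hbal, ?_, ?_, ?_⟩ <;> omega
    · rcases r with _ | ⟨rh, rl, rk, rr⟩
      · simp only [height_nil, Timed.ret_pure, Timed.time_pure] at *
        refine ⟨hl, ?_, ?_, ?_⟩ <;> omega
      · obtain ⟨hpop, hge, hle, htime⟩ := isAVL_popMin hr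
        simp only [height_node] at *
        obtain ⟨hbal, hbal_ge, hbal_le, hbal_eq⟩ := isAVL_balance (popMin rl rk rr).ret.1 hl hpop
          (by omega) (by omega)
        simp only [Timed.ret_bind, Timed.ret_pure, Timed.time_bind, Timed.time_pure]
        refine ⟨hbal, ?_, ?_, ?_⟩ <;> omega

/-- The invariant of the pails and of the trees used for sorting: AVL trees with increasing
keys. -/
structure IsBalanced (t : SearchTree α) : Prop where
  isAVL : t.IsAVL
  pairwise : t.toList.Pairwise (· < ·)

theorem isBalanced_nil : (nil : SearchTree α).IsBalanced := ⟨trivial, by simp⟩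

namespace IsBalanced

variable {t : SearchTree α}

theorem nodup (ht : t.IsBalanced) : t.toList.Nodup := ht.pairwise.imp fun h => h.ne

theorem mem_delete (ht : t.IsBalanced) (x z : α) :
    z ∈ (delete x t).ret.toList ↔ z ∈ t.toList ∧ z ≠ x := by
  simp [toList_delete x ht.pairwise]

protected theorem insert (ht : t.IsBalanced) (x : α) : (insert x t).ret.IsBalanced :=
  ⟨(isAVL_insert x ht.isAVL).1, pairwise_insert x ht.pairwise⟩

protected theorem delete (ht : t.IsBalanced) (x : α) : (delete x t).ret.IsBalanced :=
  ⟨(isAVL_delete x ht.isAVL).1, by rw [toList_delete x ht.pairwise]; exact ht.pairwise.filter _⟩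

variable [Fintype α]

theorem height_le (ht : t.IsBalanced) : t.height ≤ maxHeight (Fintype.card α) :=
  ht.isAVL.height_le_maxHeight ht.nodup.length_le_card

theorem time_insert_le (ht : t.IsBalanced) (x : α) :
    (insert x t).time ≤ maxHeight (Fintype.card α) + 1 :=
  (isAVL_insert x ht.isAVL).2.2.2.trans (Nat.succ_le_succ ht.height_le)

theorem time_delete_le (ht : t.IsBalanced) (x : α) :
    (delete x t).time ≤ maxHeight (Fintype.card α) + 1 :=
  (isAVL_delete x ht.isAVL).2.2.2.trans (Nat.succ_le_succ ht.height_le)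

end IsBalanced

end LinearOrder

theorem collectOnto_eq (t : SearchTree α) (acc : List α) :
    collectOnto t acc = ⟨t.toList.reverse ++ acc, 2 * t.toList.length + 1⟩ := by
  induction t generalizing acc with
  | nil => rfl
  | node h l k r ihl ihr =>
    change (⟨_, _⟩ : Timed _) = _
    simp [ihl, ihr]
    omega

theorem collectAll_eq (t : SearchTree α) :
    collectAll t = ⟨t.toList.reverse, 2 * t.toList.length + 1⟩ := by
  rw [collectAll, collectOnto_eq, List.append_nil]

end SearchTree

section Sorting

variable {n : ℕ}

/-- The vertices of the list `l` are listed by decreasing position in the order `T`; this is how the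
algorithm passes the sets `A` and `B` around. -/
def Decreasing (T : Fin n ≃ Fin n) (l : List (Fin n)) : Prop := l.Pairwise fun x y => T y < T x

theorem Decreasing.nodup {T : Fin n ≃ Fin n} {l : List (Fin n)} (h : Decreasing T l) : l.Nodup :=
  h.imp fun hlt heq => hlt.ne (congrArg T heq.symm)

theorem isBalanced_plant (T : Fin n ≃ Fin n) (ws : List (Fin n)) {t : SearchTree (Fin n)}
    (ht : t.IsBalanced) : (plant T ws t).ret.IsBalanced := by
  induction ws generalizing t with
  | nil => exact ht
  | cons w _ ih => exact ih (ht.insert (T w))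

theorem mem_plant (T : Fin n ≃ Fin n) (ws : List (Fin n)) (t : SearchTree (Fin n)) (q : Fin n) :
    q ∈ (plant T ws t).ret.toList ↔ q ∈ t.toList ∨ T.symm q ∈ ws := by
  induction ws generalizing t with
  | nil => simp [plant]
  | cons w ws ih =>
    simp only [plant, Timed.ret_bind, ih, SearchTree.mem_insert, List.mem_cons,
      Equiv.symm_apply_eq]
    tauto

theorem time_plant_le (T : Fin n ≃ Fin n) (ws : List (Fin n)) {t : SearchTree (Fin n)}
    (ht : t.IsBalanced) :
    (plant T ws t).time ≤ ws.length * (SearchTree.maxHeight n + 2) := by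
  induction ws generalizing t with
  | nil => simp [plant]
  | cons w ws ih =>
    have hinsert := ht.time_insert_le (T w)
    have hrest := ih (ht.insert (T w))
    simp only [plant, Timed.time_bind, Timed.time_tick, List.length_cons, Fintype.card_fin] at *
    linarith

theorem decreasing_treeSort (T : Fin n ≃ Fin n) (ws : List (Fin n)) :
    Decreasing T (treeSort T ws).ret := by
  have hsorted := (isBalanced_plant T ws SearchTree.isBalanced_nil).pairwise
  simpa [Decreasing, treeSort, SearchTree.collectAll_eq, ← List.map_reverse, List.pairwise_map,
    List.pairwise_reverse] using hsorted

theorem mem_treeSort (T : Fin n ≃ Fin n) (ws : List (Fin n)) (z : Fin n) :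
    z ∈ (treeSort T ws).ret ↔ z ∈ ws := by
  simp [treeSort, SearchTree.collectAll_eq, mem_plant, Equiv.symm_apply_eq]

theorem treeSort_perm_dedup (T : Fin n ≃ Fin n) (ws : List (Fin n)) :
    (treeSort T ws).ret.Perm ws.dedup :=
  (List.perm_ext_iff_of_nodup (decreasing_treeSort T ws).nodup ws.nodup_dedup).mpr fun z => by
    rw [mem_treeSort, List.mem_dedup]

theorem length_treeSort_le (T : Fin n ≃ Fin n) (ws : List (Fin n)) :
    (treeSort T ws).ret.length ≤ ws.length :=
  (treeSort_perm_dedup T ws).length_eq.trans_le ws.dedup_sublist.length_le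

theorem time_treeSort_le (T : Fin n ≃ Fin n) (ws : List (Fin n)) :
    (treeSort T ws).time ≤ ws.length * (SearchTree.maxHeight n + 5) + 1 := by
  have hlength := length_treeSort_le T ws
  have hplant := time_plant_le T ws SearchTree.isBalanced_nil
  simp only [treeSort, Timed.ret_bind, Timed.ret_pure, Timed.time_bind, Timed.time_pure,
    Timed.time_tick, SearchTree.collectAll_eq, List.length_reverse, List.length_map] at *
  linarith

theorem ret_scatter (key : Fin n → ℕ) (ws : List (Fin n)) (b : ℕ → List (Fin n)) (k : ℕ) :
    (scatter key ws b).ret k = (ws.filter (key · = k)).reverse ++ b k := by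
  induction ws generalizing b with
  | nil => rfl
  | cons w ws ih =>
    simp only [scatter, Timed.ret_bind, ih]
    rcases eq_or_ne k (key w) with rfl | hk
    · simp
    · simp [hk, hk.symm]

theorem time_scatter (key : Fin n → ℕ) (ws : List (Fin n)) (b : ℕ → List (Fin n)) :
    (scatter key ws b).time = ws.length := by
  induction ws generalizing b with
  | nil => rfl
  | cons w ws ih => simp [scatter, ih, add_comm]

theorem gather_eq (b : ℕ → List (Fin n)) (k : ℕ) (acc : List (Fin n)) :
    gather b k acc = ⟨(List.range k).flatMap b ++ acc, k + ((List.range k).flatMap b).length⟩ := by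
  induction k generalizing acc with
  | zero => simp [gather, pure]
  | succ k ih =>
    change (⟨_, _⟩ : Timed _) = _
    simp [ih, List.range_succ]
    omega

theorem flatMap_range_filter_perm {α : Type*} (key : α → ℕ) (ws : List α) (k : ℕ) :
    ((List.range k).flatMap fun j => (ws.filter (key · = j)).reverse).Perm
      (ws.filter (key · < k)) := by
  induction k with
  | zero => simp
  | succ k ih =>
    have hsplit := List.filter_append_perm (key · < k) (ws.filter (key · < k + 1))
    have hlt : (ws.filter (key · < k + 1)).filter (key · < k) = ws.filter (key · < k) := by
      rw [List.filter_filter]; grind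
    have heq : (ws.filter (key · < k + 1)).filter (fun w => !decide (key w < k)) =
        ws.filter (key · = k) := by
      rw [List.filter_filter]; grind
    rw [hlt, heq] at hsplit
    rw [List.range_succ, List.flatMap_append, List.flatMap_singleton]
    exact (ih.append (List.reverse_perm _)).trans hsplit

theorem ret_countingSort (m : ℕ) (key : Fin n → ℕ) (ws : List (Fin n)) :
    (countingSort m key ws).ret =
      (List.range (m + 1)).flatMap fun j => (ws.filter (key · = j)).reverse := by
  simp only [countingSort, Timed.ret_bind, gather_eq, List.append_nil]
  exact List.flatMap_congr fun k _ => by rw [ret_scatter, List.append_nil]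

theorem countingSort_perm (m : ℕ) (key : Fin n → ℕ) (ws : List (Fin n)) :
    (countingSort m key ws).ret.Perm (ws.filter (key · < m + 1)) := by
  rw [ret_countingSort]
  exact flatMap_range_filter_perm key ws (m + 1)

theorem length_countingSort_le (m : ℕ) (key : Fin n → ℕ) (ws : List (Fin n)) :
    (countingSort m key ws).ret.length ≤ ws.length :=
  (countingSort_perm m key ws).length_eq.trans_le (List.length_filter_le _ _)

theorem time_countingSort_le (m : ℕ) (key : Fin n → ℕ) (ws : List (Fin n)) :
    (countingSort m key ws).time ≤ 2 * (m + 1) + 2 * ws.length := by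
  have hlength := length_countingSort_le m key ws
  simp only [countingSort, gather_eq, Timed.ret_bind, Timed.time_bind, Timed.time_tick,
    time_scatter, List.append_nil] at *
  omega

theorem pairwise_countingSort (m : ℕ) {key : Fin n → ℕ} {ws : List (Fin n)} (hws : ws.Nodup)
    (hkey : ∀ x ∈ ws, ∀ y ∈ ws, key x = key y → x = y) :
    (countingSort m key ws).ret.Pairwise (fun x y => key x < key y) := by
  rw [ret_countingSort, List.pairwise_flatMap]
  simp only [List.mem_reverse, List.mem_filter, decide_eq_true_eq]
  refine ⟨fun k _ => ?_, List.pairwise_lt_range.imp ?_⟩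
  · refine (List.nodup_reverse.mpr (hws.filter _)).imp_of_mem fun hx hy hne => ?_
    simp only [List.mem_reverse, List.mem_filter, decide_eq_true_eq] at hx hy
    exact absurd (hkey _ hx.1 _ hy.1 (hx.2.trans hy.2.symm)) hne
  · rintro a b hab x ⟨-, rfl⟩ y ⟨-, rfl⟩
    exact hab

end Sorting

section Exchanges

variable {V P : Type*}

theorem swap_trans_apply [DecidableEq V] (x y z : V) (T : V ≃ P) :
    (Equiv.swap x y).trans T z = if z = x then T y else if z = y then T x else T z := by
  simp only [Equiv.trans_apply, Equiv.swap_apply_def, apply_ite T]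

variable [LinearOrder P]

/-- The bijection `T` from vertices to positions is a topological order of the edge relation `E`. -/
def IsTopological (E : V → V → Prop) (T : V ≃ P) : Prop := ∀ x y, E x y → T x < T y

theorem IsTopological.le {E : V → V → Prop} {T : V ≃ P} (hT : IsTopological E T) {x y : V}
    (hxy : ReflTransGen E x y) : T x ≤ T y := by
  induction hxy with
  | refl => exact le_rfl
  | tail _ hyz ih => exact ih.trans (hT _ _ hyz).le

/-- No out-neighbour of `u` lies between `u` and `v`. -/
def ClearOut (E : V → V → Prop) (T : V ≃ P) (u v : V) : Prop := ∀ w, E u w → T v < T w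

/-- No in-neighbour of `v` lies between `u` and `v`. -/
def ClearIn (E : V → V → Prop) (T : V ≃ P) (u v : V) : Prop := ∀ w, E w v → T w < T u

variable [DecidableEq V]

/-- The relation between an order and the one obtained from it by exchanging a descendant `x` of
`u` with a later ancestor `y` of `v`, both at positions in `[lo, hi]`, where no neighbour gets in
the way. -/
def Exchange (E : V → V → Prop) (u v : V) (lo hi : P) (T T' : V ≃ P) : Prop :=
  ∃ x y, ReflTransGen E u x ∧ ReflTransGen E y v ∧ lo ≤ T x ∧ T x < T y ∧ T y ≤ hi ∧
    ClearOut E T x y ∧ ClearIn E T x y ∧ T' = (Equiv.swap x y).trans T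

/-- Sequences of exchanges: a call `reorder u v` between the positions `lo` and `hi` acts on the
order in this way. -/
def Exchanges (E : V → V → Prop) (u v : V) (lo hi : P) : (V ≃ P) → (V ≃ P) → Prop :=
  ReflTransGen (Exchange E u v lo hi)

variable {E : V → V → Prop} {u v : V} {lo hi : P} {T T' : V ≃ P}

theorem Exchange.isTopological (h : Exchange E u v lo hi T T') (hT : IsTopological E T) :
    IsTopological E T' := by
  obtain ⟨x, y, -, -, -, hxy, -, hout, hin, rfl⟩ := h
  intro a b hab
  have hTab := hT a b hab
  rw [swap_trans_apply, swap_trans_apply]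
  grind [ClearOut, ClearIn]

theorem Exchanges.isTopological (h : Exchanges E u v lo hi T T') (hT : IsTopological E T) :
    IsTopological E T' := by
  induction h with
  | refl => exact hT
  | tail _ h ih => exact h.isTopological ih

theorem Exchange.mono {u' v' : V} {lo' hi' : P} (h : Exchange E u' v' lo' hi' T T')
    (hu : ReflTransGen E u u') (hv : ReflTransGen E v' v) (hlo : lo ≤ lo') (hhi : hi' ≤ hi) :
    Exchange E u v lo hi T T' := by
  obtain ⟨x, y, hux, hyv, hlox, hxy, hyhi, hswap⟩ := h
  exact ⟨x, y, hu.trans hux, hyv.trans hv, hlo.trans hlox, hxy, hyhi.trans hhi, hswap⟩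

theorem Exchanges.mono {u' v' : V} {lo' hi' : P} (h : Exchanges E u' v' lo' hi' T T')
    (hu : ReflTransGen E u u') (hv : ReflTransGen E v' v) (hlo : lo ≤ lo') (hhi : hi' ≤ hi) :
    Exchanges E u v lo hi T T' :=
  ReflTransGen.mono (fun _ _ hstep => Exchange.mono hstep hu hv hlo hhi) _ _ h

theorem Exchange.dual (h : Exchange E u v lo hi T T') :
    Exchange (Function.swap E) v u (OrderDual.toDual hi) (OrderDual.toDual lo)
      (T.trans OrderDual.toDual) (T'.trans OrderDual.toDual) := by
  obtain ⟨x, y, hux, hyv, hlo, hxy, hhi, hout, hin, rfl⟩ := h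
  refine ⟨y, x, reflTransGen_swap.2 hyv, reflTransGen_swap.2 hux, hhi, hxy, hlo, hin, hout, ?_⟩
  rw [Equiv.swap_comm, Equiv.trans_assoc]

theorem Exchanges.dual (h : Exchanges E u v lo hi T T') :
    Exchanges (Function.swap E) v u (OrderDual.toDual hi) (OrderDual.toDual lo)
      (T.trans OrderDual.toDual) (T'.trans OrderDual.toDual) := by
  induction h with
  | refl => exact .refl
  | tail _ h ih => exact ih.tail h.dual

theorem Exchanges.le_apply_of_not_ancestor (h : Exchanges E u v lo hi T T') {x : V}
    (hxv : ¬ ReflTransGen E x v) : T x ≤ T' x := by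
  induction h with
  | refl => exact le_rfl
  | tail _ h ih =>
    refine ih.trans ?_
    obtain ⟨a, b, -, hb, -, hab, -, -, -, rfl⟩ := h
    rw [swap_trans_apply]
    split_ifs with hxa hxb
    · exact hxa ▸ hab.le
    · exact absurd (hxb ▸ hb) hxv
    · exact le_rfl

theorem Exchanges.apply_le_of_not_descendant (h : Exchanges E u v lo hi T T') {y : V}
    (huy : ¬ ReflTransGen E u y) : T' y ≤ T y :=
  h.dual.le_apply_of_not_ancestor (mt reflTransGen_swap.1 huy)

theorem Exchanges.apply_eq_of_unrelated (h : Exchanges E u v lo hi T T') {z : V}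
    (huz : ¬ ReflTransGen E u z) (hzv : ¬ ReflTransGen E z v) : T' z = T z :=
  (h.apply_le_of_not_descendant huz).antisymm (h.le_apply_of_not_ancestor hzv)

theorem Exchanges.apply_eq_of_notMem (h : Exchanges E u v lo hi T T') {z : V}
    (hz : T z ∉ Set.Icc lo hi) : T' z = T z := by
  induction h with
  | refl => rfl
  | tail _ h ih =>
    obtain ⟨x, y, -, -, hlo, hxy, hhi, -, -, rfl⟩ := h
    rw [← ih] at hz ⊢
    rw [swap_trans_apply, if_neg, if_neg]
    · exact fun hzy => hz (hzy ▸ ⟨hlo.trans hxy.le, hhi⟩)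
    · exact fun hzx => hz (hzx ▸ ⟨hlo, hxy.le.trans hhi⟩)

theorem Exchanges.apply_mem (h : Exchanges E u v lo hi T T') {z : V} (hz : T z ∈ Set.Icc lo hi) :
    T' z ∈ Set.Icc lo hi := by
  induction h with
  | refl => exact hz
  | tail _ h ih =>
    obtain ⟨x, y, -, -, hlo, hxy, hhi, -, -, rfl⟩ := h
    rw [swap_trans_apply]
    split_ifs
    · exact ⟨hlo.trans hxy.le, hhi⟩
    · exact ⟨hlo, hxy.le.trans hhi⟩
    · exact ih

theorem Exchanges.source_mem_or_target_mem (h : Exchanges E u v lo hi T T')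
    (hT : IsTopological E T) (huv : ¬ ReflTransGen E u v) {s : Set P} (hs : IsUpperSet s)
    (hout : ∀ w, E u w → T w ∈ s) (hv : T v ∈ s) : T' u ∈ s ∨ T' v ∈ s := by
  induction h with
  | refl => exact .inr hv
  | @tail T₁ T₂ h₁ h₂ ih =>
    rcases ih with hu₁ | hv₁
    · exact .inl (hs (Exchanges.le_apply_of_not_ancestor (.single h₂) huv) hu₁)
    obtain ⟨x, y, hx, -, -, -, -, -, -, rfl⟩ := h₂
    rw [swap_trans_apply, swap_trans_apply]
    have hvx : v ≠ x := fun hvx => huv (hvx ▸ hx)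
    by_cases hvy : v = y
    · rcases hx.cases_head with hux | ⟨w, huw, hwx⟩
      · exact .inl (by rwa [if_pos hux, ← hvy])
      · have hTwx : T w ≤ T₁ x := (hT.le hwx).trans
          (Exchanges.le_apply_of_not_ancestor h₁ fun hxv => huv (hx.trans hxv))
        exact .inr (by rw [if_neg hvx, if_pos hvy]; exact hs hTwx (hout w huw))
    · exact .inr (by rwa [if_neg hvx, if_neg hvy])

theorem Exchanges.source_mem_of_isUpperSet (h : Exchanges E u v lo hi T T')
    (hT : IsTopological E T) (huv : ¬ ReflTransGen E u v) {s : Set P} (hs : IsUpperSet s)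
    (hout : ∀ w, E u w → T w ∈ s) (hv : T v ∈ s) (hvu : T' v < T' u) : T' u ∈ s :=
  (h.source_mem_or_target_mem hT huv hs hout hv).elim id (hs hvu.le)

theorem Exchanges.target_mem_of_isLowerSet (h : Exchanges E u v lo hi T T')
    (hT : IsTopological E T) (huv : ¬ ReflTransGen E u v) {s : Set P} (hs : IsLowerSet s)
    (hin : ∀ w, E w v → T w ∈ s) (hu : T u ∈ s) (hvu : T' v < T' u) : T' v ∈ s :=
  h.dual.source_mem_of_isUpperSet (s := OrderDual.ofDual ⁻¹' s) (fun _ _ hxy => hT _ _ hxy)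
    (mt reflTransGen_swap.1 huv) hs.toDual hin hu hvu

end Exchanges

section Settled

variable {V P : Type*} {E r : V → V → Prop} {u v : V}

/-- The relation `r` behaves like reachability after adding the edge `v → u` to the edges `E`:
ancestors of `v` are related to descendants of `u`, and what `r` says about the successors of a
descendant of `u` or the predecessors of an ancestor of `v` is reachability by `E`. -/
structure ReachExtension (E r : V → V → Prop) (u v : V) : Prop where
  not_reach : ¬ ReflTransGen E u v
  cross : ∀ x y, ReflTransGen E u x → ReflTransGen E y v → r y x
  reach_of_descendant : ∀ x z, ReflTransGen E u x → r x z → ReflTransGen E x z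
  reach_of_ancestor : ∀ z y, ReflTransGen E y v → r z y → ReflTransGen E z y

theorem ReachExtension.mono {u' v' : V} (h : ReachExtension E r u v)
    (hu : ReflTransGen E u u') (hv : ReflTransGen E v' v) : ReachExtension E r u' v' where
  not_reach h' := h.not_reach ((hu.trans h').trans hv)
  cross x y hx hy := h.cross x y (hu.trans hx) (hy.trans hv)
  reach_of_descendant x z hx := h.reach_of_descendant x z (hu.trans hx)
  reach_of_ancestor z y hy := h.reach_of_ancestor z y (hy.trans hv)

variable [Fintype V] [LinearOrder P] {lo hi : P} {T T' : V ≃ P}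

open Classical in
/-- The pairs related by `r` which `T` puts in the right order. -/
noncomputable def settled (r : V → V → Prop) (T : V ≃ P) : Finset (V × V) :=
  Finset.univ.filter fun p => r p.1 p.2 ∧ T p.1 < T p.2

theorem mem_settled {p : V × V} : p ∈ settled r T ↔ r p.1 p.2 ∧ T p.1 < T p.2 := by
  simp [settled]

theorem card_settled_le_sq (r : V → V → Prop) (T : V ≃ P) :
    (settled r T).card ≤ Fintype.card V ^ 2 :=
  (Finset.card_le_univ _).trans_eq (by rw [Fintype.card_prod, sq])

theorem settled_mono {r' : V → V → Prop} (h : ∀ x y, r x y → r' x y) :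
    settled r T ⊆ settled r' T := fun p hp => by
  rw [mem_settled] at hp ⊢
  exact ⟨h _ _ hp.1, hp.2⟩

variable [DecidableEq V]

theorem Exchange.settled_subset (h : Exchange E u v lo hi T T') (hC : ReachExtension E r u v)
    (hT : IsTopological E T) : settled r T ⊆ settled r T' := by
  obtain ⟨x, y, hx, hy, -, hxy, -, hout, hin, rfl⟩ := h
  rintro ⟨a, b⟩ hab
  rw [mem_settled] at hab ⊢
  obtain ⟨hr, hlt⟩ : r a b ∧ T a < T b := hab
  have after_of_eq_left (hax : a = x) : T y < T b := by
    subst hax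
    rcases (hC.reach_of_descendant a b hx hr).cases_head with rfl | ⟨w, haw, hwb⟩
    · exact absurd hlt (lt_irrefl _)
    · exact (hout w haw).trans_le (hT.le hwb)
  have before_of_eq_right (hby : b = y) : T a < T x := by
    subst hby
    rcases (hC.reach_of_ancestor a b hy hr).cases_tail with rfl | ⟨w, haw, hwb⟩
    · exact absurd hlt (lt_irrefl _)
    · exact (hT.le haw).trans_lt (hin w hwb)
  refine ⟨hr, ?_⟩
  rw [swap_trans_apply, swap_trans_apply]
  grind

theorem Exchange.exists_newly_settled (h : Exchange E u v lo hi T T')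
    (hC : ReachExtension E r u v) :
    ∃ x y, T' = (Equiv.swap x y).trans T ∧ lo ≤ T x ∧ T x < T y ∧ T y ≤ hi ∧
      (y, x) ∉ settled r T ∧ (y, x) ∈ settled r T' := by
  obtain ⟨x, y, hx, hy, hlo, hxy, hhi, -, -, rfl⟩ := h
  refine ⟨x, y, rfl, hlo, hxy, hhi, fun h => (mem_settled.1 h).2.not_gt hxy, mem_settled.2 ?_⟩
  exact ⟨hC.cross x y hx hy, by simpa using hxy⟩

theorem Exchange.card_settled_lt (h : Exchange E u v lo hi T T') (hC : ReachExtension E r u v)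
    (hT : IsTopological E T) : (settled r T).card < (settled r T').card := by
  obtain ⟨x, y, -, -, -, -, hnew, hnew'⟩ := h.exists_newly_settled hC
  exact Finset.card_lt_card ⟨h.settled_subset hC hT, fun hsub => hnew (hsub hnew')⟩

theorem Exchanges.card_settled_le (h : Exchanges E u v lo hi T T') (hC : ReachExtension E r u v)
    (hT : IsTopological E T) : (settled r T).card ≤ (settled r T').card := by
  induction h with
  | refl => exact le_rfl
  | tail h₁ h₂ ih => exact ih.trans (h₂.card_settled_lt hC (Exchanges.isTopological h₁ hT)).le

theorem Exchanges.card_settled_lt (h : Exchanges E u v lo hi T T') (hC : ReachExtension E r u v)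
    (hT : IsTopological E T) (hne : T ≠ T') : (settled r T).card < (settled r T').card := by
  rcases ReflTransGen.cases_head h with heq | ⟨T₁, h₁, h₂⟩
  · exact absurd heq hne
  · exact (h₁.card_settled_lt hC hT).trans_le
      (Exchanges.card_settled_le h₂ hC (h₁.isTopological hT))

end Settled

section Potential

variable {V : Type*} [Fintype V] {n : ℕ} {E r : V → V → Prop} {u v : V} {lo hi : Fin n}
  {S T T' : V ≃ Fin n} {t : ℝ}

open Classical in
/-- The settled pairs whose distance in `S` is at most `n / √t`. -/
noncomputable def nearSettled (r : V → V → Prop) (S : V ≃ Fin n) (t : ℝ) (T : V ≃ Fin n) :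
    Finset (V × V) :=
  (settled r T).filter fun p => (((S p.2 : ℕ) : ℝ) - (S p.1 : ℕ)) * √t ≤ n

/-- The potential that pays for the exchanges over a distance of at most `t`.  Here `S` is a
topological order of the final graph.  An exchange of vertices that are close in `S` is paid by the
new near settled pair, any other one by the increase of the correlation of `T` with `S`. -/
noncomputable def potential (r : V → V → Prop) (S : V ≃ Fin n) (t : ℝ) (T : V ≃ Fin n) : ℝ :=
  t * (nearSettled r S t T).card + √t / n * ∑ x, ((S x : ℕ) : ℝ) * (T x : ℕ)

theorem mem_nearSettled {p : V × V} : p ∈ nearSettled r S t T ↔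
    p ∈ settled r T ∧ (((S p.2 : ℕ) : ℝ) - (S p.1 : ℕ)) * √t ≤ n := by
  rw [nearSettled, Finset.mem_filter]

theorem nearSettled_subset_nearSettled {r' : V → V → Prop} (h : settled r T ⊆ settled r' T') :
    nearSettled r S t T ⊆ nearSettled r' S t T' := fun p hp => by
  rw [mem_nearSettled] at hp ⊢
  exact ⟨h hp.1, hp.2⟩

theorem potential_nonneg (r : V → V → Prop) (S T : V ≃ Fin n) (ht : 0 ≤ t) :
    0 ≤ potential r S t T := by
  unfold potential
  positivity

theorem potential_mono {r' : V → V → Prop} (h : ∀ x y, r x y → r' x y) (ht : 0 ≤ t) :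
    potential r S t T ≤ potential r' S t T := by
  unfold potential
  gcongr
  exact nearSettled_subset_nearSettled (settled_mono h)

theorem card_nearSettled_le (hS : ∀ x y, r x y → S x < S y) (ht : 0 < t) :
    (nearSettled r S t T).card ≤ n * ⌊n / √t⌋₊ := by
  have hs : 0 < √t := Real.sqrt_pos.2 ht
  have hcard : n * ⌊n / √t⌋₊ =
      ((Finset.univ : Finset (Fin n)) ×ˢ Finset.range ⌊n / √t⌋₊).card := by simp
  rw [hcard]
  refine Finset.card_le_card_of_injOn (fun p => (S p.1, (S p.2 : ℕ) - S p.1 - 1)) ?_ ?_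
  · rintro ⟨x, y⟩ hp
    obtain ⟨hsettled, hnear⟩ := mem_nearSettled.1 hp
    have hlt : (S x : ℕ) < S y := hS _ _ (mem_settled.1 hsettled).1
    have hdist : (S y : ℕ) - S x ≤ ⌊n / √t⌋₊ := by
      refine Nat.le_floor ?_
      rwa [le_div_iff₀ hs, Nat.cast_sub hlt.le]
    simp only [Finset.coe_product, Finset.coe_univ, Set.mem_prod, Set.mem_univ, true_and,
      Finset.coe_range, Set.mem_Iio]
    omega
  · rintro ⟨x, y⟩ hp ⟨x', y'⟩ hp' heq
    have hlt : (S x : ℕ) < S y := hS _ _ (mem_settled.1 (mem_nearSettled.1 hp).1).1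
    have hlt' : (S x' : ℕ) < S y' := hS _ _ (mem_settled.1 (mem_nearSettled.1 hp').1).1
    simp only [Prod.mk.injEq, EmbeddingLike.apply_eq_iff_eq] at heq
    obtain ⟨rfl, hsub⟩ := heq
    have hy : S y = S y' := Fin.ext (by omega)
    rw [S.injective hy]

theorem potential_le (hS : ∀ x y, r x y → S x < S y) (ht : 0 ≤ t) :
    potential r S t T ≤ 2 * ((n : ℝ) ^ 2 * √t) := by
  have hpairs : t * (nearSettled r S t T).card ≤ (n : ℝ) ^ 2 * √t := by
    rcases ht.eq_or_lt with rfl | ht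
    · simp
    calc t * ((nearSettled r S t T).card : ℝ)
        ≤ t * (n * ⌊n / √t⌋₊ : ℕ) := by
          gcongr
          exact card_nearSettled_le hS ht
      _ ≤ t * (n * (n / √t)) := by
          push_cast
          gcongr
          exact Nat.floor_le (by positivity)
      _ = (n : ℝ) ^ 2 * (t / √t) := by ring
      _ = (n : ℝ) ^ 2 * √t := by rw [Real.div_sqrt]
  have hcorr : ∑ x, ((S x : ℕ) : ℝ) * (T x : ℕ) ≤ (n : ℝ) ^ 3 := by
    calc ∑ x, ((S x : ℕ) : ℝ) * (T x : ℕ) ≤ ∑ _x : V, (n : ℝ) * n := by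
          gcongr <;> exact Fin.is_le'
      _ = (n : ℝ) ^ 3 := by
          rw [Finset.sum_const, Finset.card_univ, Fintype.card_congr S, Fintype.card_fin,
            nsmul_eq_mul]
          ring
  have hquad : √t / n * ∑ x, ((S x : ℕ) : ℝ) * (T x : ℕ) ≤ (n : ℝ) ^ 2 * √t := by
    rcases n.eq_zero_or_pos with rfl | hn
    · simp
    calc √t / n * ∑ x, ((S x : ℕ) : ℝ) * (T x : ℕ) ≤ √t / n * (n : ℝ) ^ 3 := by gcongr
      _ = (n : ℝ) ^ 2 * √t := by field_simp
  unfold potential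
  linarith

variable [DecidableEq V]

theorem sum_mul_swap {x y : V} (hxy : x ≠ y) (S T : V ≃ Fin n) :
    ∑ z, ((S z : ℕ) : ℝ) * ((Equiv.swap x y).trans T z : ℕ) =
      ∑ z, ((S z : ℕ) : ℝ) * (T z : ℕ) +
        (((S x : ℕ) : ℝ) - (S y : ℕ)) * (((T y : ℕ) : ℝ) - (T x : ℕ)) := by
  rw [← sub_eq_iff_eq_add', ← Finset.sum_sub_distrib,
    ← Finset.sum_subset (Finset.subset_univ {x, y}), Finset.sum_pair hxy]
  · simp only [Equiv.trans_apply, Equiv.swap_apply_left, Equiv.swap_apply_right]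
    ring
  · intro z _ hz
    simp only [Finset.mem_insert, Finset.mem_singleton, not_or] at hz
    rw [swap_trans_apply, if_neg hz.1, if_neg hz.2, sub_self]

theorem potential_swap_sub {x y : V} (hxy : x ≠ y) (r : V → V → Prop) (S T : V ≃ Fin n) (t : ℝ) :
    potential r S t ((Equiv.swap x y).trans T) - potential r S t T =
      t * ((nearSettled r S t ((Equiv.swap x y).trans T)).card - (nearSettled r S t T).card) +
      √t / n * (((S x : ℕ) : ℝ) - (S y : ℕ)) * (((T y : ℕ) : ℝ) - (T x : ℕ)) := by
  unfold potential
  rw [sum_mul_swap hxy]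
  ring

theorem Exchange.potential_le (h : Exchange E u v lo hi T T') (hC : ReachExtension E r u v)
    (hT : IsTopological E T) (hS : ∀ x y, r x y → S x < S y) (ht : 0 ≤ t) :
    potential r S t T ≤ potential r S t T' := by
  have hsub := h.settled_subset hC hT
  obtain ⟨x, y, rfl, -, hxy, -, -, hnew⟩ := h.exists_newly_settled hC
  have hTxy : ((T x : ℕ) : ℝ) ≤ (T y : ℕ) := by exact_mod_cast hxy.le
  have hSyx : ((S y : ℕ) : ℝ) ≤ (S x : ℕ) := by exact_mod_cast (hS _ _ (mem_settled.1 hnew).1).le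
  have hcard : ((nearSettled r S t T).card : ℝ) ≤
      (nearSettled r S t ((Equiv.swap x y).trans T)).card := by
    exact_mod_cast Finset.card_le_card (nearSettled_subset_nearSettled hsub)
  rw [← sub_nonneg, potential_swap_sub (fun hxy' => hxy.ne (congrArg T hxy'))]
  rw [← sub_nonneg] at hTxy hSyx hcard
  positivity

theorem Exchange.abs_sub_le_potential_sub (h : Exchange E u v lo hi T T')
    (hC : ReachExtension E r u v) (hT : IsTopological E T) (hS : ∀ x y, r x y → S x < S y)
    (ht : 0 ≤ t) (hlohi : ((hi : ℕ) : ℝ) - (lo : ℕ) ≤ t) (z : V) :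
    |((T' z : ℕ) : ℝ) - (T z : ℕ)| ≤ potential r S t T' - potential r S t T := by
  have hsub := h.settled_subset hC hT
  obtain ⟨x, y, rfl, hlo, hxy, hhi, hnew, hnew'⟩ := h.exists_newly_settled hC
  set T' := (Equiv.swap x y).trans T with hT'
  have hn : (0 : ℝ) < n := by exact_mod_cast (T x).pos
  have hd : 0 < ((T y : ℕ) : ℝ) - (T x : ℕ) := by
    rw [sub_pos]
    exact_mod_cast hxy
  have hδ : 0 < ((S x : ℕ) : ℝ) - (S y : ℕ) := by
    rw [sub_pos]
    exact_mod_cast hS _ _ (mem_settled.1 hnew').1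
  have hnear : nearSettled r S t T ⊆ nearSettled r S t T' := nearSettled_subset_nearSettled hsub
  have hz : |((T' z : ℕ) : ℝ) - (T z : ℕ)| ≤ ((T y : ℕ) : ℝ) - (T x : ℕ) := by
    rw [hT', swap_trans_apply]
    split_ifs with hzx hzy
    · rw [hzx, abs_of_pos hd]
    · rw [hzy, abs_sub_comm, abs_of_pos hd]
    · simpa using hd.le
  refine hz.trans ?_
  rw [hT', potential_swap_sub (fun hxy' => hxy.ne (congrArg T hxy')), ← hT']
  by_cases hclose : (((S x : ℕ) : ℝ) - (S y : ℕ)) * √t ≤ n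
  · have hcard : (1 : ℝ) ≤ (nearSettled r S t T').card - (nearSettled r S t T).card := by
      rw [le_sub_iff_add_le']
      exact_mod_cast Finset.card_lt_card
        ⟨hnear, fun h => hnew (mem_nearSettled.1 (h (mem_nearSettled.2 ⟨hnew', hclose⟩))).1⟩
    have hle : ((T y : ℕ) : ℝ) - (T x : ℕ) ≤ t :=
      (sub_le_sub (by exact_mod_cast hhi) (by exact_mod_cast hlo)).trans hlohi
    exact hle.trans
      ((le_mul_of_one_le_right ht hcard).trans (le_add_of_nonneg_right (by positivity)))
  · have hfar : 1 ≤ √t / n * (((S x : ℕ) : ℝ) - (S y : ℕ)) := by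
      rw [div_mul_eq_mul_div, le_div_iff₀ hn]
      linarith
    have hcard : (0 : ℝ) ≤ (nearSettled r S t T').card - (nearSettled r S t T).card := by
      rw [sub_nonneg]
      exact_mod_cast Finset.card_le_card hnear
    exact (le_mul_of_one_le_left hd.le hfar).trans (le_add_of_nonneg_left (by positivity))

theorem Exchanges.potential_le (h : Exchanges E u v lo hi T T') (hC : ReachExtension E r u v)
    (hT : IsTopological E T) (hS : ∀ x y, r x y → S x < S y) (ht : 0 ≤ t) :
    potential r S t T ≤ potential r S t T' := by
  induction h with
  | refl => exact le_rfl
  | tail h₁ h₂ ih =>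
    exact ih.trans (h₂.potential_le hC (Exchanges.isTopological h₁ hT) hS ht)

theorem Exchanges.abs_sub_le_potential_sub (h : Exchanges E u v lo hi T T')
    (hC : ReachExtension E r u v) (hT : IsTopological E T) (hS : ∀ x y, r x y → S x < S y)
    (ht : 0 ≤ t) (hlohi : ((hi : ℕ) : ℝ) - (lo : ℕ) ≤ t) (z : V) :
    |((T' z : ℕ) : ℝ) - (T z : ℕ)| ≤ potential r S t T' - potential r S t T := by
  induction h with
  | refl => simp
  | @tail T₁ T₂ h₁ h₂ ih =>
    have hstep := h₂.abs_sub_le_potential_sub hC (Exchanges.isTopological h₁ hT) hS ht hlohi z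
    have htri := abs_sub_le ((T₂ z : ℕ) : ℝ) (T₁ z : ℕ) (T z : ℕ)
    linarith

end Potential

section Programs

variable {n : ℕ}

/-- The program `x`, started in memory `s`, returns `a` and leaves the memory `s'`. -/
def Runs {α : Type} (x : Prog n α) (s : Mem n) (a : α) (s' : Mem n) : Prop :=
  x.run s = some (a, s')

theorem Runs.bind {α β : Type} {x : Prog n α} {f : α → Prog n β} {s s' s'' : Mem n} {a : α} {b : β}
    (h : Runs x s a s') (h' : Runs (f a) s' b s'') : Runs (x >>= f) s b s'' := by
  unfold Runs at *
  rw [StateT.run_bind, h]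
  exact h'

theorem Runs.get (s : Mem n) : Runs (MonadState.get : Prog n (Mem n)) s s s := rfl

theorem Runs.timed {α : Type} (x : Timed α) (s : Mem n) :
    Runs (timed x) s x.ret { s with clock := s.clock + x.time } := rfl

theorem Runs.tick (k : ℕ) (s : Mem n) : Runs (tick k) s () { s with clock := s.clock + k } := rfl

theorem runs_forM {α : Type} (M : List α → Mem n → Prop) (f : α → Prog n Unit)
    (l : List α) (s : Mem n)
    (step : ∀ l₁ a l₂ s, l = l₁ ++ a :: l₂ → M l₁ s → ∃ s', Runs (f a) s () s' ∧ M (l₁ ++ [a]) s')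
    (init : M [] s) : ∃ s', Runs (l.forM f) s () s' ∧ M l s' := by
  suffices H : ∀ (l₂ l₁ : List α) (s : Mem n), l = l₁ ++ l₂ → M l₁ s →
      ∃ s', Runs (l₂.forM f) s () s' ∧ M l s' from H l [] s rfl init
  intro l₂
  induction l₂ with
  | nil => exact fun l₁ s hl hM => ⟨s, rfl, by rwa [hl, List.append_nil]⟩
  | cons a l₂ ih =>
    intro l₁ s hl hM
    obtain ⟨s₁, hrun₁, hM₁⟩ := step l₁ a l₂ s hl hM
    obtain ⟨s₂, hrun₂, hM₂⟩ := ih (l₁ ++ [a]) s₁ (by simp [hl]) hM₁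
    exact ⟨s₂, hrun₁.bind hrun₂, hM₂⟩

theorem runs_forM_time {α : Type} (M : List α → Mem n → Prop) (k : ℕ) (f : α → Prog n Unit)
    (l : List α) (s : Mem n)
    (step : ∀ l₁ a l₂ s, l = l₁ ++ a :: l₂ → M l₁ s →
      ∃ s', Runs (f a) s () s' ∧ M (l₁ ++ [a]) s' ∧ s'.clock ≤ s.clock + k)
    (init : M [] s) :
    ∃ s', Runs (l.forM f) s () s' ∧ M l s' ∧ s'.clock ≤ s.clock + l.length * k := by
  refine runs_forM (fun l s' => M l s' ∧ s'.clock ≤ s.clock + l.length * k) f l s ?_ ⟨init, by simp⟩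
  rintro l₁ a l₂ s₁ hl ⟨hM, hclock⟩
  obtain ⟨s', hrun, hM', hclock'⟩ := step l₁ a l₂ s₁ hl hM
  refine ⟨s', hrun, hM', ?_⟩
  rw [List.length_append, add_mul, List.length_singleton]
  omega

/-- The vertices at the positions `q` with `a ≤ q < b`. -/
def between (T : Fin n ≃ Fin n) (a b : ℕ) : Set (Fin n) := {w | a ≤ (T w : ℕ) ∧ (T w : ℕ) < b}

theorem runs_forPositions {T : Fin n ≃ Fin n} {s : Mem n} {a b k : ℕ} {f : Fin n → Prog n Unit}
    (M : Set (Fin n) → Mem n → Prop) (pos_eq : ∀ W s, M W s → s.pos = T)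
    (setClock : ∀ W s c, M W s → M W { s with clock := c })
    (step : ∀ w W s, M W s → ∃ s', Runs (f w) s () s' ∧ M (W ∪ {w}) s' ∧ s'.clock ≤ s.clock + k)
    (init : M ∅ s) :
    ∃ s', Runs (forPositions a b f) s () s' ∧ M (between T a b) s' ∧
      s'.clock ≤ s.clock + (b - a) * (k + 1) := by
  have stepAt : ∀ l₁ q l₂ s, List.Ico a (min b n) = l₁ ++ q :: l₂ → M {w | (T w : ℕ) ∈ l₁} s →
      ∃ s', Runs (do
          tick 1
          let s ← get
          if h : q < n then f (s.pos.symm ⟨q, h⟩) else pure () : Prog n Unit) s () s' ∧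
        M {w | (T w : ℕ) ∈ l₁ ++ [q]} s' ∧ s'.clock ≤ s.clock + (k + 1) := by
    intro l₁ q l₂ s hl hM
    have hq : q ∈ List.Ico a (min b n) := by simp [hl]
    have hqn : q < n := (List.Ico.mem.1 hq).2.trans_le (min_le_right b n)
    obtain ⟨s', hrun, hM', hclock⟩ := step (T.symm ⟨q, hqn⟩) _ _ (setClock _ _ (s.clock + 1) hM)
    refine ⟨s', (Runs.tick 1 s).bind ((Runs.get _).bind ?_), ?_, ?_⟩
    · simpa only [dif_pos hqn, pos_eq _ _ hM] using hrun
    · convert hM' using 1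
      ext w
      simp [Equiv.eq_symm_apply, Fin.ext_iff, or_comm]
    · dsimp only at hclock
      omega
  obtain ⟨s', hrun, hM, hclock⟩ := runs_forM_time (fun l s => M {w | (T w : ℕ) ∈ l} s) (k + 1)
    _ _ s stepAt (by simpa using init)
  refine ⟨s', hrun, ?_, hclock.trans ?_⟩
  · convert hM using 1
    ext w
    have hlt := (T w).isLt
    simp only [between, Set.mem_ofPred_eq, List.Ico.mem]
    omega
  · rw [List.Ico.length]
    gcongr
    exact min_le_left b n

end Programs

section Pails

variable {n : ℕ}

theorem update_update_apply {ι κ α : Type*} [DecidableEq ι] [DecidableEq κ] (f : ι → κ → α)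
    (u : ι) (i : κ) (a : α) (x : ι) (j : κ) :
    Function.update f u (Function.update (f u) i a) x j = if x = u ∧ j = i then a else f x j := by
  by_cases hx : x = u
  · subst hx
    by_cases hj : j = i <;> simp [hj]
  · simp [hx]

/-- An entry `(x, j, z)` of the pails stands for both `z` in the pail of out-neighbours of `x` and
`x` in the pail of in-neighbours of `z`, on level `j`. -/
abbrev PailEntry (n : ℕ) : Type := Fin n × ℕ × Fin n

/-- The pail entries, on all levels, which come from the edges `E`. -/
def edgeEntries (E : Fin n → Fin n → Prop) : Set (PailEntry n) := {e | E e.1 e.2.2}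

/-- The memory `s` stores the edges `E` and the order `T`, and its pails are balanced search trees
with the entries `O`. -/
structure View (E : Fin n → Fin n → Prop) (O : Set (PailEntry n)) (T : Fin n ≃ Fin n)
    (s : Mem n) : Prop where
  pos_eq : s.pos = T
  outAdj_iff : ∀ x z, s.outAdj x z = true ↔ E x z
  inAdj_iff : ∀ x z, s.inAdj z x = true ↔ E x z
  outPail_isBalanced : ∀ x j, (s.outPail x j).IsBalanced
  inPail_isBalanced : ∀ x j, (s.inPail x j).IsBalanced
  mem_outPail : ∀ x j z, z ∈ (s.outPail x j).toList ↔ (x, j, z) ∈ O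
  mem_inPail : ∀ x j z, x ∈ (s.inPail z j).toList ↔ (x, j, z) ∈ O

variable {E : Fin n → Fin n → Prop} {O : Set (PailEntry n)} {T : Fin n ≃ Fin n} {s : Mem n}

theorem View.setClock (h : View E O T s) (k : ℕ) : View E O T { s with clock := k } :=
  { h with }

theorem View.update (h : View E O T s) {O' : Set (PailEntry n)} {x z : Fin n} {i : ℕ}
    {t t' : SearchTree (Fin n)} (k : ℕ) (ht : t.IsBalanced) (ht' : t'.IsBalanced)
    (hO : ∀ e, e ≠ (x, i, z) → (e ∈ O' ↔ e ∈ O))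
    (hx : ∀ b, b ∈ t.toList ↔ (x, i, b) ∈ O') (hz : ∀ a, a ∈ t'.toList ↔ (a, i, z) ∈ O') :
    View E O' T { s with
      outPail := Function.update s.outPail x (Function.update (s.outPail x) i t)
      inPail := Function.update s.inPail z (Function.update (s.inPail z) i t')
      clock := k } where
  pos_eq := h.pos_eq
  outAdj_iff := h.outAdj_iff
  inAdj_iff := h.inAdj_iff
  outPail_isBalanced a j := by
    simp only [update_update_apply]
    split_ifs
    exacts [ht, h.outPail_isBalanced a j]
  inPail_isBalanced a j := by
    simp only [update_update_apply]
    split_ifs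
    exacts [ht', h.inPail_isBalanced a j]
  mem_outPail a j b := by
    simp only [update_update_apply]
    split_ifs with haj
    · rw [haj.1, haj.2, hx]
    · rw [h.mem_outPail, hO]
      grind
  mem_inPail a j b := by
    simp only [update_update_apply]
    split_ifs with hbj
    · rw [hbj.1, hbj.2, hz]
    · rw [h.mem_inPail, hO]
      grind

theorem View.insert_entry (h : View E O T s) (x z : Fin n) (i k : ℕ) :
    View E (O ∪ {(x, i, z)}) T { s with
      outPail := Function.update s.outPail x (Function.update (s.outPail x) i
        ((s.outPail x i).insert z).ret)
      inPail := Function.update s.inPail z (Function.update (s.inPail z) i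
        ((s.inPail z i).insert x).ret)
      clock := k } := by
  refine h.update k ((h.outPail_isBalanced x i).insert z) ((h.inPail_isBalanced z i).insert x)
    (fun e he => ?_) (fun b => ?_) (fun a => ?_)
  · simp [he]
  · simp [SearchTree.mem_insert, h.mem_outPail, or_comm]
  · simp [SearchTree.mem_insert, h.mem_inPail, or_comm]

theorem View.delete_entry (h : View E O T s) (x z : Fin n) (i k : ℕ) :
    View E (O \ {(x, i, z)}) T { s with
      outPail := Function.update s.outPail x (Function.update (s.outPail x) i
        ((s.outPail x i).delete z).ret)
      inPail := Function.update s.inPail z (Function.update (s.inPail z) i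
        ((s.inPail z i).delete x).ret)
      clock := k } := by
  have hout := h.outPail_isBalanced x i
  have hin := h.inPail_isBalanced z i
  refine h.update k (hout.delete z) (hin.delete x) (fun e he => ?_) (fun b => ?_) (fun a => ?_)
  · simp [he]
  · simp [hout.mem_delete, h.mem_outPail]
  · simp [hin.mem_delete, h.mem_inPail]

/-- A bound for the cost of an operation on the two pails that an entry belongs to. -/
def pairCost (n : ℕ) : ℕ := 2 * (SearchTree.maxHeight n + 1)

theorem View.insertPair_time_le (h : View E O T s) (x z : Fin n) (i : ℕ) :
    ((s.outPail x i).insert z).time + ((s.inPail z i).insert x).time ≤ pairCost n := by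
  have hout := (h.outPail_isBalanced x i).time_insert_le z
  have hin := (h.inPail_isBalanced z i).time_insert_le x
  rw [Fintype.card_fin] at hout hin
  rw [pairCost]
  omega

theorem View.deletePair_time_le (h : View E O T s) (x z : Fin n) (i : ℕ) :
    ((s.outPail x i).delete z).time + ((s.inPail z i).delete x).time ≤ pairCost n := by
  have hout := (h.outPail_isBalanced x i).time_delete_le z
  have hin := (h.inPail_isBalanced z i).time_delete_le x
  rw [Fintype.card_fin] at hout hin
  rw [pairCost]
  omega

theorem View.runs_outPailInsert_inPailInsert (h : View E O T s) (x z : Fin n) (i : ℕ) :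
    ∃ s', Runs (do outPailInsert x i z; inPailInsert z i x : Prog n Unit) s () s' ∧
      View E (O ∪ {(x, i, z)}) T s' ∧ s'.clock ≤ s.clock + pairCost n := by
  refine ⟨_, rfl, h.insert_entry x z i _, ?_⟩
  simpa only [add_assoc] using Nat.add_le_add_left (h.insertPair_time_le x z i) s.clock

theorem View.runs_inPailInsert_outPailInsert (h : View E O T s) (x z : Fin n) (i : ℕ) :
    ∃ s', Runs (do inPailInsert z i x; outPailInsert x i z : Prog n Unit) s () s' ∧
      View E (O ∪ {(x, i, z)}) T s' ∧ s'.clock ≤ s.clock + pairCost n := by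
  refine ⟨_, rfl, h.insert_entry x z i _, ?_⟩
  simpa only [add_right_comm, add_assoc] using
    Nat.add_le_add_left (h.insertPair_time_le x z i) s.clock

theorem View.runs_outPailDelete_inPailDelete (h : View E O T s) (x z : Fin n) (i : ℕ) :
    ∃ s', Runs (do outPailDelete x i z; inPailDelete z i x : Prog n Unit) s () s' ∧
      View E (O \ {(x, i, z)}) T s' ∧ s'.clock ≤ s.clock + pairCost n := by
  refine ⟨_, rfl, h.delete_entry x z i _, ?_⟩
  simpa only [add_assoc] using Nat.add_le_add_left (h.deletePair_time_le x z i) s.clock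

theorem View.runs_inPailDelete_outPailDelete (h : View E O T s) (x z : Fin n) (i : ℕ) :
    ∃ s', Runs (do inPailDelete z i x; outPailDelete x i z : Prog n Unit) s () s' ∧
      View E (O \ {(x, i, z)}) T s' ∧ s'.clock ≤ s.clock + pairCost n := by
  refine ⟨_, rfl, h.delete_entry x z i _, ?_⟩
  simpa only [add_right_comm, add_assoc] using
    Nat.add_le_add_left (h.deletePair_time_le x z i) s.clock

theorem View.runs_deleteLoop (h : View E O T s) (a b : ℕ) {k : ℕ} {f : Fin n → Prog n Unit}
    (e : Fin n → PailEntry n)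
    (hf : ∀ w s O, View E O T s → ∃ s', Runs (f w) s () s' ∧
      View E (O \ {e w}) T s' ∧ s'.clock ≤ s.clock + k) :
    ∃ s', Runs (forPositions a b f) s () s' ∧ View E (O \ e '' between T a b) T s' ∧
      s'.clock ≤ s.clock + (b - a) * (k + 1) := by
  refine runs_forPositions (fun W => View E (O \ e '' W) T) (fun _ _ h => h.pos_eq)
    (fun _ _ c h => h.setClock c) (fun w W s hV => ?_) (by simpa using h)
  rw [Set.image_union, Set.image_singleton, ← Set.sdiff_sdiff]
  exact hf w s _ hV

theorem View.runs_insertLoop (h : View E O T s) (a b : ℕ) {k : ℕ} {f : Fin n → Prog n Unit}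
    (e : Fin n → PailEntry n)
    (hf : ∀ w s O, View E O T s → ∃ s', Runs (f w) s () s' ∧
      View E (O ∪ {e w} ∩ edgeEntries E) T s' ∧ s'.clock ≤ s.clock + k) :
    ∃ s', Runs (forPositions a b f) s () s' ∧
      View E (O ∪ e '' between T a b ∩ edgeEntries E) T s' ∧
      s'.clock ≤ s.clock + (b - a) * (k + 1) := by
  refine runs_forPositions (fun W => View E (O ∪ e '' W ∩ edgeEntries E) T)
    (fun _ _ h => h.pos_eq) (fun _ _ c h => h.setClock c) (fun w W s hV => ?_) (by simpa using h)
  obtain ⟨s', hrun, hV', hclock⟩ := hf w s _ hV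
  refine ⟨s', hrun, ?_, hclock⟩
  rwa [Set.image_union, Set.image_singleton, Set.union_inter_distrib_right, ← Set.union_assoc]

theorem View.runs_insertOutIf (h : View E O T s) {c : Bool} {x z : Fin n} (hc : c = true ↔ E x z)
    (i : ℕ) :
    ∃ s', Runs (if c then do outPailInsert x i z; inPailInsert z i x else pure () : Prog n Unit)
        s () s' ∧
      View E (O ∪ {(x, i, z)} ∩ edgeEntries E) T s' ∧ s'.clock ≤ s.clock + pairCost n := by
  by_cases hE : E x z
  · obtain ⟨s', hrun, hV, hclock⟩ := h.runs_outPailInsert_inPailInsert x z i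
    refine ⟨s', by rwa [if_pos (hc.2 hE)], ?_, hclock⟩
    have he : (x, i, z) ∈ edgeEntries E := hE
    rwa [Set.inter_eq_left.2 (Set.singleton_subset_iff.2 he)]
  · refine ⟨s, by rw [if_neg (mt hc.1 hE)]; rfl, ?_, by omega⟩
    have he : (x, i, z) ∉ edgeEntries E := hE
    rwa [Set.singleton_inter_eq_empty.2 he, Set.union_empty]

theorem View.runs_insertInIf (h : View E O T s) {c : Bool} {x z : Fin n} (hc : c = true ↔ E x z)
    (i : ℕ) :
    ∃ s', Runs (if c then do inPailInsert z i x; outPailInsert x i z else pure () : Prog n Unit)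
        s () s' ∧
      View E (O ∪ {(x, i, z)} ∩ edgeEntries E) T s' ∧ s'.clock ≤ s.clock + pairCost n := by
  by_cases hE : E x z
  · obtain ⟨s', hrun, hV, hclock⟩ := h.runs_inPailInsert_outPailInsert x z i
    refine ⟨s', by rwa [if_pos (hc.2 hE)], ?_, hclock⟩
    have he : (x, i, z) ∈ edgeEntries E := hE
    rwa [Set.inter_eq_left.2 (Set.singleton_subset_iff.2 he)]
  · refine ⟨s, by rw [if_neg (mt hc.1 hE)]; rfl, ?_, by omega⟩
    have he : (x, i, z) ∉ edgeEntries E := hE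
    rwa [Set.singleton_inter_eq_empty.2 he, Set.union_empty]

/-- The pail entries `(x, j, z)` from the edges `x → z` with `d(x, z) ≤ t j`; in a topological order
the distance is `T z - T x`, and the subtraction is avoided. -/
def nearEntries (E : Fin n → Fin n → Prop) (t : ℕ → ℕ) (T : Fin n ≃ Fin n) : Set (PailEntry n) :=
  {e | E e.1 e.2.2 ∧ (T e.2.2 : ℕ) ≤ T e.1 + t e.2.1}

theorem swap_near_iff (hT : IsTopological E T) {u v x z : Fin n} {a b : ℕ} (ha : (T u : ℕ) = a)
    (hb : (T v : ℕ) = b) (hab : a < b) (hout : ClearOut E T u v)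
    (hin : ∀ w, E w v → T w < T u) (k : ℕ) (hxz : E x z) :
    ((((Equiv.swap u v).trans T) z : ℕ) ≤ ((Equiv.swap u v).trans T) x + k) ↔
      ((((T z : ℕ) ≤ T x + k ∧
        ¬ (z = u ∧ x ∈ between T (a - k) (min a (a + (b - a) - k)))) ∧
        ¬ (x = v ∧ z ∈ between T (max (b + k - (b - a)) b + 1) (b + k + 1))) ∨
        (x = u ∧ z ∈ between T (max b (a + k) + 1) (a + k + (b - a) + 1))) ∨
        (z = v ∧ x ∈ between T (b - (b - a) - k) (min a (b + (b - a) - k))) := by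
  have hlt := hT x z hxz
  have hne : u ≠ v := by
    rintro rfl
    omega
  simp only [swap_trans_apply, between, Set.mem_ofPred_eq, Nat.add_one_le_iff, max_lt_iff,
    lt_min_iff]
  rcases eq_or_ne x u with rfl | hxu
  · have hbound := hout z hxz
    have hzv : z ≠ v := by grind
    have hzu : z ≠ x := by grind
    simp only [hzv, hzu, hne, eq_self, if_true, if_false, false_and, true_and, or_false,
      not_false_eq_true, and_true]
    omega
  rcases eq_or_ne x v with rfl | hxv
  · have hzx : z ≠ x := by grind
    have hzu : z ≠ u := by grind
    simp only [hzx, hzu, hxu, eq_self, if_true, if_false, false_and, true_and, or_false,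
      not_false_eq_true, and_true]
    omega
  rcases eq_or_ne z u with rfl | hzu
  · simp only [hxu, hxv, hne, eq_self, if_true, if_false, false_and, true_and, or_false,
      not_false_eq_true, and_true]
    omega
  rcases eq_or_ne z v with rfl | hzv
  · have hbound := hin x hxz
    simp only [hxu, hxv, hzu, eq_self, if_true, if_false, false_and, true_and, or_false,
      not_false_eq_true, and_true]
    omega
  · simp only [hxu, hxv, hzu, hzv, if_false, false_and, or_false, not_false_eq_true, and_true]

theorem mem_image_inEntry {x z u : Fin n} {i j : ℕ} {W : Set (Fin n)} :
    (x, j, z) ∈ (fun w => ((w, i, u) : PailEntry n)) '' W ↔ j = i ∧ z = u ∧ x ∈ W := by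
  grind

theorem mem_image_outEntry {x z u : Fin n} {i j : ℕ} {W : Set (Fin n)} :
    (x, j, z) ∈ (fun w => ((u, i, w) : PailEntry n)) '' W ↔ j = i ∧ x = u ∧ z ∈ W := by
  grind

/-- The number of steps for updating the pails of one level after an exchange over the
distance `d`. -/
def levelCost (n d : ℕ) : ℕ := 5 * d * (pairCost n + 1) + 1

theorem swapRanges_length_le {a b : ℕ} (k : ℕ) (hab : a < b) :
    (min a (a + (b - a) - k) - (a - k)) + (b + k + 1 - (max (b + k - (b - a)) b + 1)) +
      ((a + k + (b - a) + 1 - (max b (a + k) + 1)) +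
        (min a (b + (b - a) - k) - (b - (b - a) - k))) ≤ 5 * (b - a) := by
  have hlen₁ : min a (a + (b - a) - k) - (a - k) ≤ b - a := by omega
  have hlen₂ : b + k + 1 - (max (b + k - (b - a)) b + 1) ≤ b - a := by omega
  have hlen₃ : a + k + (b - a) + 1 - (max b (a + k) + 1) ≤ b - a := by omega
  have hlen₄ : min a (b + (b - a) - k) - (b - (b - a) - k) ≤ 2 * (b - a) := by omega
  linarith

theorem View.runs_swapPails (h : View E O T s) (t : ℕ → ℕ) (i : ℕ) {u v : Fin n}
    (hO : ∀ x z, (x, i, z) ∈ O ↔ (x, i, z) ∈ nearEntries E t T) (hT : IsTopological E T)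
    (huv : T u < T v) (hout : ClearOut E T u v) (hin : ClearIn E T u v) :
    ∃ s', Runs (swapPails t u v i) s () s' ∧
      View E {e | if e.2.1 = i then e ∈ nearEntries E t ((Equiv.swap u v).trans T) else e ∈ O}
        T s' ∧
      s'.clock ≤ s.clock + levelCost n (T v - T u) := by
  obtain rfl := h.pos_eq
  obtain ⟨a, ha⟩ : ∃ a : ℕ, (s.pos u : ℕ) = a := ⟨_, rfl⟩
  obtain ⟨b, hb⟩ : ∃ b : ℕ, (s.pos v : ℕ) = b := ⟨_, rfl⟩
  have hab : a < b := by omega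
  obtain ⟨s₁, hrun₁, hV₁, hclock₁⟩ := (h.setClock (s.clock + 1)).runs_deleteLoop (a - t i)
    (min a (a + (b - a) - t i)) (fun w => (w, i, u))
    fun w s O h => h.runs_inPailDelete_outPailDelete w u i
  obtain ⟨s₂, hrun₂, hV₂, hclock₂⟩ := hV₁.runs_deleteLoop (max (b + t i - (b - a)) b + 1)
    (b + t i + 1) (fun w => (v, i, w)) fun w s O h => h.runs_outPailDelete_inPailDelete v w i
  obtain ⟨s₃, hrun₃, hV₃, hclock₃⟩ := hV₂.runs_insertLoop (max b (a + t i) + 1)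
    (a + t i + (b - a) + 1) (fun w => (u, i, w))
    fun w s' O h' => h'.runs_insertOutIf (h.outAdj_iff u w) i
  obtain ⟨s₄, hrun₄, hV₄, hclock₄⟩ := hV₃.runs_insertLoop (b - (b - a) - t i)
    (min a (b + (b - a) - t i)) (fun w => (w, i, v))
    fun w s' O h' => h'.runs_insertInIf (h.inAdj_iff w v) i
  refine ⟨s₄, (Runs.tick 1 s).bind ((Runs.get _).bind ?_), ?_, ?_⟩
  · simp only [ha, hb]
    exact hrun₁.bind (hrun₂.bind (hrun₃.bind hrun₄))
  · convert hV₄ using 1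
    ext ⟨x, j, z⟩
    have hswap := swap_near_iff hT ha hb hab hout hin (t i) (x := x) (z := z)
    have hnear := hO x z
    simp only [nearEntries, edgeEntries, Set.mem_union, Set.mem_sdiff, Set.mem_inter_iff,
      Set.mem_ofPred_eq, mem_image_inEntry, mem_image_outEntry] at *
    by_cases hj : j = i
    · subst hj
      by_cases hE : E x z <;> simp_all
    · simp [hj]
  · dsimp only at hclock₁
    have hcost := Nat.mul_le_mul_right (pairCost n + 1) (swapRanges_length_le (t i) hab)
    rw [levelCost, ha, hb]
    linarith

end Pails

section Invariant

variable {n : ℕ}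

/-- The memory stores the edges `E`, a topological order of them, and correct pails on the levels
`0, …, p + 1`. -/
structure Inv (p : ℕ) (t : ℕ → ℕ) (E : Fin n → Fin n → Prop) (s : Mem n) : Prop where
  isTopological : IsTopological E s.pos
  view : ∃ O, View E O s.pos s ∧ ∀ e : PailEntry n, e.2.1 ≤ p + 1 →
    (e ∈ O ↔ e ∈ nearEntries E t s.pos)

variable {p : ℕ} {t : ℕ → ℕ} {E : Fin n → Fin n → Prop} {s : Mem n}

theorem Inv.setClock (h : Inv p t E s) (c : ℕ) : Inv p t E { s with clock := c } :=
  ⟨h.isTopological, h.view.imp fun _ hO => ⟨hO.1.setClock c, hO.2⟩⟩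

theorem inv_emptyMem (T : Fin n ≃ Fin n) : Inv p t (fun _ _ => False) (emptyMem T) where
  isTopological _ _ h := h.elim
  view := by
    refine ⟨∅, ⟨rfl, ?_, ?_, fun _ _ => SearchTree.isBalanced_nil,
      fun _ _ => SearchTree.isBalanced_nil, ?_, ?_⟩, ?_⟩ <;>
    simp [emptyMem, nearEntries]

theorem View.runs_levels {O₀ : Set (PailEntry n)} {T : Fin n ≃ Fin n} (O₁ : Set (PailEntry n))
    {k : ℕ} {f : ℕ → Prog n Unit} (h : View E O₀ T s)
    (hf : ∀ i ≤ p + 1, ∀ s O, View E O T s → (∀ x z, (x, i, z) ∈ O ↔ (x, i, z) ∈ O₀) →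
      ∃ s', Runs (f i) s () s' ∧ View E {e | if e.2.1 = i then e ∈ O₁ else e ∈ O} T s' ∧
        s'.clock ≤ s.clock + k) :
    ∃ s', Runs ((List.range (p + 2)).forM f) s () s' ∧
      View E {e | if e.2.1 ≤ p + 1 then e ∈ O₁ else e ∈ O₀} T s' ∧
      s'.clock ≤ s.clock + (p + 2) * k := by
  have step : ∀ l₁ i l₂ s, List.range (p + 2) = l₁ ++ i :: l₂ →
      View E {e | if e.2.1 ∈ l₁ then e ∈ O₁ else e ∈ O₀} T s →
      ∃ s', Runs (f i) s () s' ∧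
        View E {e | if e.2.1 ∈ l₁ ++ [i] then e ∈ O₁ else e ∈ O₀} T s' ∧
        s'.clock ≤ s.clock + k := by
    intro l₁ i l₂ s hl hV
    have hnodup : (l₁ ++ i :: l₂).Nodup := hl ▸ List.nodup_range
    have hi : i ∉ l₁ := fun hmem => (List.nodup_append.1 hnodup).2.2 i hmem i (by simp) rfl
    have hip : i < p + 2 := List.mem_range.1 (by simp [hl])
    obtain ⟨s', hrun, hV', hclock⟩ := hf i (by omega) s _ hV (by simp [hi])
    refine ⟨s', hrun, ?_, hclock⟩
    convert hV' using 2
    grind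
  obtain ⟨s', hrun, hV, hclock⟩ := runs_forM_time
    (fun l s => View E {e | if e.2.1 ∈ l then e ∈ O₁ else e ∈ O₀} T s) k f _ s step
    (by simpa using h)
  refine ⟨s', hrun, ?_, by simpa using hclock⟩
  convert hV using 2
  simp [Nat.lt_succ_iff]

/-- The number of steps for an exchange over the distance `d`. -/
def swapCost (n p d : ℕ) : ℕ := (p + 2) * levelCost n d + 4

theorem Inv.runs_swapVertices (h : Inv p t E s) {u v : Fin n} (huv : s.pos u < s.pos v)
    (hout : ClearOut E s.pos u v) (hin : ClearIn E s.pos u v)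
    (htopo : IsTopological E ((Equiv.swap u v).trans s.pos)) :
    ∃ s', Runs (swapVertices p t u v) s () s' ∧ Inv p t E s' ∧
      s'.pos = (Equiv.swap u v).trans s.pos ∧
      s'.clock ≤ s.clock + swapCost n p (s.pos v - s.pos u) := by
  obtain ⟨O, hV, hO⟩ := h.view
  obtain ⟨s', hrun, hV', hclock⟩ := hV.runs_levels
    (nearEntries E t ((Equiv.swap u v).trans s.pos)) (f := swapPails t u v)
    fun i hi s' O' hV' hO' => hV'.runs_swapPails t i
      (fun x z => (hO' x z).trans (hO (x, i, z) hi)) h.isTopological huv hout hin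
  have hpos : s'.pos = s.pos := hV'.pos_eq
  refine ⟨{ s' with clock := s'.clock + 4, pos := (Equiv.swap u v).trans s'.pos },
    hrun.bind ((Runs.tick 4 s').bind rfl), ⟨?_, _, { hV' with pos_eq := rfl }, ?_⟩, ?_, ?_⟩
  · simpa only [hpos] using htopo
  · simp +contextual [hpos]
  · simp only [hpos]
  · rw [swapCost]
    dsimp only
    omega

/-- The edge relation `E` together with the edge `u → v`. -/
def addEdge (E : Fin n → Fin n → Prop) (u v : Fin n) : Fin n → Fin n → Prop :=
  fun x y => E x y ∨ (x = u ∧ y = v)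

theorem View.setEdge {O : Set (PailEntry n)} {T : Fin n ≃ Fin n} (h : View E O T s)
    (u v : Fin n) (c : ℕ) :
    View (addEdge E u v) O T { s with
      outAdj := Function.update s.outAdj u (Function.update (s.outAdj u) v true)
      inAdj := Function.update s.inAdj v (Function.update (s.inAdj v) u true)
      clock := c } :=
  { h with
    outAdj_iff x z := by
      simp only [update_update_apply, addEdge]
      split_ifs with hxz <;> simp [hxz, h.outAdj_iff]
    inAdj_iff x z := by
      simp only [update_update_apply, addEdge, and_comm (a := x = u)]
      split_ifs with hxz <;> simp [hxz, h.inAdj_iff] }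

/-- The number of steps for updating the data structures for a new edge. -/
def insertCost (n p : ℕ) : ℕ := (p + 2) * (pairCost n + 1) + 2

theorem View.runs_insertEdge_level {O : Set (PailEntry n)} {T : Fin n ≃ Fin n} (h : View E O T s)
    {u v : Fin n} (huv : T u < T v) (i : ℕ) :
    ∃ s', Runs (do
        tick 1
        let s ← get
        let a : ℕ := s.pos u
        let b : ℕ := s.pos v
        if a < b ∧ b - a ≤ t i then
          outPailInsert u i v
          inPailInsert v i u : Prog n Unit) s () s' ∧
      View E (O ∪ {e | e = (u, i, v) ∧ (T v : ℕ) - T u ≤ t i}) T s' ∧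
      s'.clock ≤ s.clock + (pairCost n + 1) := by
  obtain rfl := h.pos_eq
  by_cases hnear : (s.pos v : ℕ) - s.pos u ≤ t i
  · obtain ⟨s', hrun, hV, hclock⟩ :=
      (h.setClock (s.clock + 1)).runs_outPailInsert_inPailInsert u v i
    refine ⟨s', (Runs.tick 1 s).bind ((Runs.get _).bind ?_), by simpa [hnear] using hV, ?_⟩
    · simpa only [if_pos (And.intro (Fin.lt_def.1 huv) hnear)] using hrun
    · dsimp only at hclock
      omega
  · refine ⟨_, (Runs.tick 1 s).bind ((Runs.get _).bind ?_),
      by simpa [hnear] using h.setClock (s.clock + 1), by dsimp only; omega⟩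
    simp only [hnear, and_false, if_false]
    rfl

theorem nearEntries_addEdge {T : Fin n ≃ Fin n} {u v : Fin n} (huv : T u < T v) :
    nearEntries (addEdge E u v) t T =
      nearEntries E t T ∪ {e | e = (u, e.2.1, v) ∧ (T v : ℕ) - T u ≤ t e.2.1} := by
  ext ⟨x, j, z⟩
  simp only [nearEntries, addEdge, Set.mem_union, Set.mem_ofPred_eq, Prod.mk.injEq, true_and]
  grind

theorem Inv.runs_insertEdge (h : Inv p t E s) {u v : Fin n} (huv : s.pos u < s.pos v) :
    ∃ s', Runs (insertEdge p t u v) s () s' ∧ Inv p t (addEdge E u v) s' ∧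
      s'.pos = s.pos ∧ s'.clock ≤ s.clock + insertCost n p := by
  obtain ⟨O, hV, hO⟩ := h.view
  obtain ⟨s', hrun, hV', hclock⟩ := (hV.setEdge u v (s.clock + 2)).runs_levels (p := p)
    (O ∪ {e | e = (u, e.2.1, v) ∧ (s.pos v : ℕ) - s.pos u ≤ t e.2.1})
    fun i _ s₁ O₁ hV₁ hO₁ => by
      obtain ⟨s₂, hrun, hV₂, hclock⟩ := hV₁.runs_insertEdge_level (t := t) huv i
      refine ⟨s₂, hrun, ?_, hclock⟩
      convert hV₂ using 1
      ext ⟨x, j, z⟩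
      simp only [Set.mem_ofPred_eq, Set.mem_union, Prod.mk.injEq, true_and]
      rcases eq_or_ne j i with rfl | hj
      · simp [hO₁]
      · simp [hj]
  have hpos : s'.pos = s.pos := hV'.pos_eq
  refine ⟨s', (Runs.tick 2 s).bind (Runs.bind (a := ()) rfl hrun),
    ⟨?_, _, hpos ▸ hV', fun e he => ?_⟩, hpos, ?_⟩
  · rw [hpos]
    rintro x y (hxy | ⟨rfl, rfl⟩)
    · exact h.isTopological x y hxy
    · exact huv
  · rw [hpos, nearEntries_addEdge huv]
    simp only [Set.mem_ofPred_eq, he, if_true, Set.mem_union, hO e he]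
  · rw [insertCost]
    dsimp only at hclock
    omega

end Invariant

section NearSets

variable {n p : ℕ} {t : ℕ → ℕ} {E : Fin n → Fin n → Prop} {s : Mem n}

theorem decreasing_countingSort {T : Fin n ≃ Fin n} {m : ℕ} {key : Fin n → ℕ} {ws : List (Fin n)}
    (hws : ws.Nodup) (hkey : ∀ x ∈ ws, ∀ y ∈ ws, key x < key y ↔ T y < T x) :
    Decreasing T (countingSort m key ws).ret := by
  have hmem : ∀ {w}, w ∈ (countingSort m key ws).ret → w ∈ ws := fun hw =>
    List.mem_of_mem_filter ((countingSort_perm m key ws).mem_iff.1 hw)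
  refine (pairwise_countingSort m hws fun x hx y hy hxy => T.injective ?_).imp_of_mem
    fun {x y} hx hy hxy => (hkey x (hmem hx) y (hmem hy)).1 hxy
  have h₁ := hkey x hx y hy
  have h₂ := hkey y hy x hx
  exact le_antisymm (not_lt.1 fun h => by have hle := h₁.2 h; omega)
    (not_lt.1 fun h => by have hle := h₂.2 h; omega)

theorem length_le_card_of_pos_mem {T : Fin n ≃ Fin n} {l : List (Fin n)} (hl : l.Nodup)
    {I : Finset ℕ} (hI : ∀ w ∈ l, (T w : ℕ) ∈ I) : l.length ≤ I.card := by
  rw [← List.toFinset_card_of_nodup hl]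
  exact Finset.card_le_card_of_injOn (fun w => (T w : ℕ)) (fun w hw => hI w (by simpa using hw))
    fun x _ y _ hxy => T.injective (Fin.ext hxy)

theorem Inv.nodup_outPail (h : Inv p t E s) (u : Fin n) (i : ℕ) :
    (s.outPail u i).toList.Nodup :=
  let ⟨_, hV, _⟩ := h.view
  (hV.outPail_isBalanced u i).nodup

theorem Inv.nodup_inPail (h : Inv p t E s) (v : Fin n) (i : ℕ) :
    (s.inPail v i).toList.Nodup :=
  let ⟨_, hV, _⟩ := h.view
  (hV.inPail_isBalanced v i).nodup

theorem Inv.mem_outPail (h : Inv p t E s) {i : ℕ} (hi : i ≤ p + 1) {u w : Fin n} :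
    w ∈ (s.outPail u i).toList ↔ E u w ∧ (s.pos w : ℕ) ≤ s.pos u + t i := by
  obtain ⟨O, hV, hO⟩ := h.view
  rw [hV.mem_outPail, hO (u, i, w) hi]
  rfl

theorem Inv.mem_inPail (h : Inv p t E s) {i : ℕ} (hi : i ≤ p + 1) {v w : Fin n} :
    w ∈ (s.inPail v i).toList ↔ E w v ∧ (s.pos v : ℕ) ≤ s.pos w + t i := by
  obtain ⟨O, hV, hO⟩ := h.view
  rw [hV.mem_inPail, hO (w, i, v) hi]
  rfl

theorem Inv.length_outPail_le (h : Inv p t E s) {i : ℕ} (hi : i ≤ p + 1) (u : Fin n) :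
    (s.outPail u i).toList.length ≤ t i := by
  refine (length_le_card_of_pos_mem (h.nodup_outPail u i) (T := s.pos)
    (I := Finset.Ioc (s.pos u : ℕ) (s.pos u + t i)) fun w hw => ?_).trans (by simp)
  obtain ⟨hE, hnear⟩ := (h.mem_outPail hi).1 hw
  exact Finset.mem_Ioc.2 ⟨h.isTopological _ _ hE, hnear⟩

theorem Inv.length_inPail_le (h : Inv p t E s) {i : ℕ} (hi : i ≤ p + 1) (v : Fin n) :
    (s.inPail v i).toList.length ≤ t i := by
  refine (length_le_card_of_pos_mem (h.nodup_inPail v i) (T := s.pos)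
    (I := Finset.Ico ((s.pos v : ℕ) - t i) (s.pos v)) fun w hw => ?_).trans
    (by rw [Nat.card_Ico]; omega)
  obtain ⟨hE, hnear⟩ := (h.mem_inPail hi).1 hw
  exact Finset.mem_Ico.2 ⟨by omega, h.isTopological _ _ hE⟩

theorem Inv.runs_outNearCount (h : Inv p t E s) {i : ℕ} (hi : i ≤ p + 1) (u v : Fin n) :
    ∃ A c, Runs (outNearCount t i u v) s A { s with clock := s.clock + c } ∧
      Decreasing s.pos A ∧
      (∀ w, w ∈ A ↔ (E u w ∧ (s.pos w : ℕ) ≤ s.pos u + t i) ∧ s.pos w < s.pos v) ∧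
      c ≤ 7 * t i + 3 := by
  set ws := (s.outPail u i).toList.reverse with hws
  have hmem : ∀ w ∈ ws, s.pos u < s.pos w ∧ (s.pos w : ℕ) ≤ s.pos u + t i := fun w hw =>
    ((h.mem_outPail hi).1 (List.mem_reverse.1 hw)).imp_left (h.isTopological _ _)
  set sorted := countingSort (t i) (fun w => (s.pos u : ℕ) + t i - s.pos w) ws with hsorted
  have hrun : Runs (outNearCount t i u v) s (sorted.ret.filter fun w => s.pos w < s.pos v)
      { s with clock := s.clock + (2 * (s.outPail u i).toList.length + 1) + sorted.time +
        sorted.ret.length } :=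
    (Runs.get s).bind ((Runs.timed _ s).bind <| by
      rw [SearchTree.collectAll_eq]
      exact (Runs.timed sorted _).bind ((Runs.tick _ _).bind rfl))
  refine ⟨_, _ + _ + _, by simpa only [add_assoc] using hrun, ?_, fun w => ?_, ?_⟩
  · refine List.Pairwise.filter _ (decreasing_countingSort
      (List.nodup_reverse.2 (h.nodup_outPail u i)) fun x hx y hy => ?_)
    have hx := hmem x hx
    have hy := hmem y hy
    rw [Fin.lt_def]
    omega
  · rw [List.mem_filter, (countingSort_perm _ _ _).mem_iff, List.mem_filter, List.mem_reverse,
      h.mem_outPail hi, decide_eq_true_eq, decide_eq_true_eq]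
    refine and_congr_left' (and_iff_left_of_imp fun hw => ?_)
    have hlt := h.isTopological _ _ hw.1
    omega
  · have htime := time_countingSort_le (t i) (fun w => (s.pos u : ℕ) + t i - s.pos w) ws
    have hlen := length_countingSort_le (t i) (fun w => (s.pos u : ℕ) + t i - s.pos w) ws
    have hpail := h.length_outPail_le hi u
    rw [← hsorted] at htime hlen
    rw [hws, List.length_reverse] at htime hlen
    omega

theorem Inv.runs_inNearCount (h : Inv p t E s) {i : ℕ} (hi : i ≤ p + 1) (u v : Fin n) :
    ∃ B c, Runs (inNearCount t i u v) s B { s with clock := s.clock + c } ∧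
      Decreasing s.pos B ∧
      (∀ w, w ∈ B ↔ (E w v ∧ (s.pos v : ℕ) ≤ s.pos w + t i) ∧ s.pos u < s.pos w) ∧
      c ≤ 7 * t i + 3 := by
  set ws := (s.inPail v i).toList.reverse with hws
  have hmem : ∀ w ∈ ws, s.pos w < s.pos v ∧ (s.pos v : ℕ) ≤ s.pos w + t i := fun w hw =>
    ((h.mem_inPail hi).1 (List.mem_reverse.1 hw)).imp_left (h.isTopological _ _)
  set sorted := countingSort (t i) (fun w => (s.pos v : ℕ) - s.pos w) ws with hsorted
  have hrun : Runs (inNearCount t i u v) s (sorted.ret.filter fun w => s.pos u < s.pos w)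
      { s with clock := s.clock + (2 * (s.inPail v i).toList.length + 1) + sorted.time +
        sorted.ret.length } :=
    (Runs.get s).bind ((Runs.timed _ s).bind <| by
      rw [SearchTree.collectAll_eq]
      exact (Runs.timed sorted _).bind ((Runs.tick _ _).bind rfl))
  refine ⟨_, _ + _ + _, by simpa only [add_assoc] using hrun, ?_, fun w => ?_, ?_⟩
  · refine List.Pairwise.filter _ (decreasing_countingSort
      (List.nodup_reverse.2 (h.nodup_inPail v i)) fun x hx y hy => ?_)
    have hx := hmem x hx
    have hy := hmem y hy
    rw [Fin.lt_def]
    omega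
  · rw [List.mem_filter, (countingSort_perm _ _ _).mem_iff, List.mem_filter, List.mem_reverse,
      h.mem_inPail hi, decide_eq_true_eq, decide_eq_true_eq]
    refine and_congr_left' (and_iff_left_of_imp fun hw => ?_)
    omega
  · have htime := time_countingSort_le (t i) (fun w => (s.pos v : ℕ) - s.pos w) ws
    have hlen := length_countingSort_le (t i) (fun w => (s.pos v : ℕ) - s.pos w) ws
    have hpail := h.length_inPail_le hi v
    rw [← hsorted] at htime hlen
    rw [hws, List.length_reverse] at htime hlen
    omega

theorem readOut_cost_le {T : Fin n ≃ Fin n} {ws : List (Fin n)} (hws : ws.Nodup)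
    {q : Fin n → Bool} (hq : ∀ w ∈ ws, q w = true) :
    2 * ws.length + 1 + (treeSort T ws).time + (treeSort T ws).ret.length ≤
      ((treeSort T ws).ret.filter q).length * (SearchTree.maxHeight n + 8) + 2 := by
  have htime := time_treeSort_le T ws
  have hlen := length_treeSort_le T ws
  have hkept : ws.length ≤ ((treeSort T ws).ret.filter q).length :=
    (hws.subperm fun w hw =>
      List.mem_filter.2 ⟨(mem_treeSort T ws w).2 hw, hq w hw⟩).length_le
  refine le_trans ?_ (Nat.add_le_add_right (Nat.mul_le_mul_right _ hkept) 2)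
  rw [mul_add] at htime ⊢
  omega

theorem Inv.runs_outNearTree (h : Inv p t E s) {i : ℕ} (hi : i ≤ p + 1) {u v : Fin n}
    (huv : (s.pos u : ℕ) + t i < s.pos v) :
    ∃ A c, Runs (outNearTree i u v) s A { s with clock := s.clock + c } ∧
      Decreasing s.pos A ∧
      (∀ w, w ∈ A ↔ (E u w ∧ (s.pos w : ℕ) ≤ s.pos u + t i) ∧ s.pos w < s.pos v) ∧
      c ≤ A.length * (SearchTree.maxHeight n + 8) + 2 := by
  set ws := (s.outPail u i).toList.reverse with hws
  have hmem : ∀ w, w ∈ ws ↔ E u w ∧ (s.pos w : ℕ) ≤ s.pos u + t i := fun w =>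
    List.mem_reverse.trans (h.mem_outPail hi)
  have hrun : Runs (outNearTree i u v) s
      ((treeSort s.pos ws).ret.filter fun w => s.pos w < s.pos v)
      { s with clock := s.clock + (2 * (s.outPail u i).toList.length + 1) +
        (treeSort s.pos ws).time + (treeSort s.pos ws).ret.length } :=
    (Runs.get s).bind ((Runs.timed _ s).bind <| by
      rw [SearchTree.collectAll_eq]
      exact (Runs.timed _ _).bind ((Runs.tick _ _).bind rfl))
  refine ⟨_, _ + _ + _, by simpa only [add_assoc] using hrun,
    List.Pairwise.filter _ (decreasing_treeSort _ _), fun w => ?_, ?_⟩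
  · rw [List.mem_filter, mem_treeSort, hmem, decide_eq_true_eq]
  · rw [← List.length_reverse, ← hws]
    refine (add_assoc _ _ _).symm.trans_le (readOut_cost_le
      (List.nodup_reverse.2 (h.nodup_outPail u i)) fun w hw => ?_)
    rw [decide_eq_true_eq, Fin.lt_def]
    exact ((hmem w).1 hw).2.trans_lt huv

theorem Inv.runs_inNearTree (h : Inv p t E s) {i : ℕ} (hi : i ≤ p + 1) {u v : Fin n}
    (huv : (s.pos u : ℕ) + t i < s.pos v) :
    ∃ B c, Runs (inNearTree i u v) s B { s with clock := s.clock + c } ∧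
      Decreasing s.pos B ∧
      (∀ w, w ∈ B ↔ (E w v ∧ (s.pos v : ℕ) ≤ s.pos w + t i) ∧ s.pos u < s.pos w) ∧
      c ≤ B.length * (SearchTree.maxHeight n + 8) + 2 := by
  set ws := (s.inPail v i).toList.reverse with hws
  have hmem : ∀ w, w ∈ ws ↔ E w v ∧ (s.pos v : ℕ) ≤ s.pos w + t i := fun w =>
    List.mem_reverse.trans (h.mem_inPail hi)
  have hrun : Runs (inNearTree i u v) s
      ((treeSort s.pos ws).ret.filter fun w => s.pos u < s.pos w)
      { s with clock := s.clock + (2 * (s.inPail v i).toList.length + 1) +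
        (treeSort s.pos ws).time + (treeSort s.pos ws).ret.length } :=
    (Runs.get s).bind ((Runs.timed _ s).bind <| by
      rw [SearchTree.collectAll_eq]
      exact (Runs.timed _ _).bind ((Runs.tick _ _).bind rfl))
  refine ⟨_, _ + _ + _, by simpa only [add_assoc] using hrun,
    List.Pairwise.filter _ (decreasing_treeSort _ _), fun w => ?_, ?_⟩
  · rw [List.mem_filter, mem_treeSort, hmem, decide_eq_true_eq]
  · rw [← List.length_reverse, ← hws]
    refine (add_assoc _ _ _).symm.trans_le (readOut_cost_le
      (List.nodup_reverse.2 (h.nodup_inPail v i)) fun w hw => ?_)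
    have hnear := ((hmem w).1 hw).2
    rw [decide_eq_true_eq, Fin.lt_def]
    omega

theorem time_findLevel_le (t : ℕ → ℕ) (d k m : ℕ) : (findLevel t d k m).time ≤ m + 1 := by
  induction m generalizing k with
  | zero => exact le_rfl
  | succ m ih =>
    have hrest := ih (k + 1)
    simp only [findLevel, Timed.time_bind, Timed.time_tick]
    split_ifs
    · simp
    · omega

theorem ret_findLevel_le (t : ℕ → ℕ) (d k m : ℕ) : (findLevel t d k m).ret ≤ k + m := by
  induction m generalizing k with
  | zero => exact le_rfl
  | succ m ih =>
    have hrest := ih (k + 1)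
    simp only [findLevel, Timed.ret_bind]
    split_ifs
    · simp
    · omega

theorem le_threshold_findLevel {t : ℕ → ℕ} {d k m : ℕ} (hd : d ≤ t (k + m)) :
    d ≤ t (findLevel t d k m).ret := by
  induction m generalizing k with
  | zero => exact hd
  | succ m ih =>
    simp only [findLevel, Timed.ret_bind]
    split_ifs with hk
    · exact hk
    · exact ih (by rwa [add_assoc, add_comm 1])

theorem threshold_lt_of_lt_findLevel {t : ℕ → ℕ} {d k m j : ℕ} (hkj : k ≤ j)
    (hj : j < (findLevel t d k m).ret) : t j < d := by
  induction m generalizing k with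
  | zero => exact absurd hj (not_lt.2 hkj)
  | succ m ih =>
    simp only [findLevel, Timed.ret_bind] at hj
    split_ifs at hj with hk
    · exact absurd hj (not_lt.2 hkj)
    · obtain rfl | hlt := hkj.eq_or_lt
      · exact not_le.1 hk
      · exact ih hlt hj

/-- `A` can be the set `A` of a call of `reorder` for `u`, `v` with the flag `f`, where `c` is
paid for a counting sort at a level above `0`.  Such a sort is needed only if the pail one level
below is empty, and then `A` has all the out-neighbours of `u` before `v`. -/
structure IsOutSet (p : ℕ) (t : ℕ → ℕ) (E : Fin n → Fin n → Prop) (T : Fin n ≃ Fin n)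
    (u v : Fin n) (f : Bool) (A : List (Fin n)) (c : ℕ) : Prop where
  decreasing : Decreasing T A
  adj : ∀ w ∈ A, E u w ∧ T w < T v
  clearOut : A = [] → ClearOut E T u v
  cost : c = 0 ∨ (f = false ∧ (∀ w, E u w → T w < T v → w ∈ A) ∧
    ∃ i ≤ p, (T u : ℕ) + t i < T v ∧ (T v : ℕ) ≤ T u + t (i + 1) ∧
      (∀ w, E u w → (T u : ℕ) + t i < T w) ∧ c ≤ 7 * t (i + 1) + 3)

/-- The mirror image of `IsOutSet` for the set `B` of a call of `reorder`. -/
structure IsInSet (p : ℕ) (t : ℕ → ℕ) (E : Fin n → Fin n → Prop) (T : Fin n ≃ Fin n)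
    (u v : Fin n) (f : Bool) (B : List (Fin n)) (c : ℕ) : Prop where
  decreasing : Decreasing T B
  adj : ∀ w ∈ B, E w v ∧ T u < T w
  clearIn : B = [] → ClearIn E T u v
  cost : c = 0 ∨ (f = false ∧ (∀ w, E w v → T u < T w → w ∈ B) ∧
    ∃ i ≤ p, (T u : ℕ) + t i < T v ∧ (T v : ℕ) ≤ T u + t (i + 1) ∧
      (∀ w, E w v → (T w : ℕ) + t i < T v) ∧ c ≤ 7 * t (i + 1) + 3)

theorem clearOut_of_forall_mem_nil {T : Fin n ≃ Fin n} {u v : Fin n} (hE : ¬ E u v)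
    (hA : ∀ w, E u w → T w < T v → w ∈ ([] : List (Fin n))) : ClearOut E T u v := fun w hw =>
  lt_of_le_of_ne (not_lt.1 fun hlt => List.not_mem_nil (hA w hw hlt))
    fun heq => hE (T.injective heq ▸ hw)

theorem clearIn_of_forall_mem_nil {T : Fin n ≃ Fin n} {u v : Fin n} (hE : ¬ E u v)
    (hB : ∀ w, E w v → T u < T w → w ∈ ([] : List (Fin n))) : ClearIn E T u v := fun w hw =>
  lt_of_le_of_ne (not_lt.1 fun hlt => List.not_mem_nil (hB w hw hlt))
    fun heq => hE (T.injective heq ▸ hw)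

theorem Inv.runs_outNearCount_of_le (h : Inv p t E s) {i : ℕ} (hi : i ≤ p + 1) {u v : Fin n}
    (hE : ¬ E u v) (huv : (s.pos v : ℕ) ≤ s.pos u + t i) (f : Bool) :
    ∃ A c, Runs (outNearCount t i u v) s A { s with clock := s.clock + c } ∧
      IsOutSet p t E s.pos u v f A 0 ∧ (∀ w, E u w → s.pos w < s.pos v → w ∈ A) ∧
      c ≤ 7 * t i + 3 := by
  obtain ⟨A, c, hrun, hdec, hmem, hc⟩ := h.runs_outNearCount hi u v
  have hall : ∀ w, E u w → s.pos w < s.pos v → w ∈ A := fun w hw hlt =>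
    (hmem w).2 ⟨⟨hw, by omega⟩, hlt⟩
  exact ⟨A, c, hrun, ⟨hdec, fun w hw => ((hmem w).1 hw).imp_left And.left,
    fun hnil => clearOut_of_forall_mem_nil hE (hnil ▸ hall), Or.inl rfl⟩, hall, hc⟩

theorem Inv.runs_inNearCount_of_le (h : Inv p t E s) {i : ℕ} (hi : i ≤ p + 1) {u v : Fin n}
    (hE : ¬ E u v) (huv : (s.pos v : ℕ) ≤ s.pos u + t i) (f : Bool) :
    ∃ B c, Runs (inNearCount t i u v) s B { s with clock := s.clock + c } ∧
      IsInSet p t E s.pos u v f B 0 ∧ (∀ w, E w v → s.pos u < s.pos w → w ∈ B) ∧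
      c ≤ 7 * t i + 3 := by
  obtain ⟨B, c, hrun, hdec, hmem, hc⟩ := h.runs_inNearCount hi u v
  have hall : ∀ w, E w v → s.pos u < s.pos w → w ∈ B := fun w hw hlt =>
    (hmem w).2 ⟨⟨hw, by omega⟩, hlt⟩
  exact ⟨B, c, hrun, ⟨hdec, fun w hw => ((hmem w).1 hw).imp_left And.left,
    fun hnil => clearIn_of_forall_mem_nil hE (hnil ▸ hall), Or.inl rfl⟩, hall, hc⟩

theorem Inv.runs_chooseOut (h : Inv p t E s) {u v : Fin n} (hE : ¬ E u v) {f : Bool}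
    (hf : f = true → ClearOut E s.pos u v) {i : ℕ} (hi : i ≤ p)
    (hlow : (s.pos u : ℕ) + t i < s.pos v) (hhigh : (s.pos v : ℕ) ≤ s.pos u + t (i + 1))
    {A₀ : List (Fin n)} (hdec : Decreasing s.pos A₀)
    (hmem : ∀ w, w ∈ A₀ ↔ (E u w ∧ (s.pos w : ℕ) ≤ s.pos u + t i) ∧ s.pos w < s.pos v) :
    ∃ A c, Runs (if A₀ ≠ [] ∨ f = true then pure A₀ else outNearCount t (i + 1) u v) s A
        { s with clock := s.clock + c } ∧
      IsOutSet p t E s.pos u v f A c ∧ A₀.length ≤ A.length := by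
  split_ifs with hkeep
  · exact ⟨A₀, 0, rfl, ⟨hdec, fun w hw => ((hmem w).1 hw).imp_left And.left,
      fun hnil => hf (hkeep.resolve_left (not_not_intro hnil)), Or.inl rfl⟩, le_rfl⟩
  · obtain ⟨rfl, hfalse⟩ : A₀ = [] ∧ f = false := by simpa using hkeep
    obtain ⟨A, c, hrun, hA, hall, hc⟩ := h.runs_outNearCount_of_le (by omega) hE hhigh f
    refine ⟨A, c, hrun, { hA with cost := Or.inr ⟨hfalse, hall, i, hi, hlow, hhigh,
      fun w hw => not_le.1 fun hle => List.not_mem_nil ((hmem w).2 ⟨⟨hw, hle⟩, ?_⟩), hc⟩ },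
      Nat.zero_le _⟩
    exact Fin.lt_def.2 (hle.trans_lt hlow)

theorem Inv.runs_chooseIn (h : Inv p t E s) {u v : Fin n} (hE : ¬ E u v) {f : Bool}
    (hf : f = true → ClearIn E s.pos u v) {i : ℕ} (hi : i ≤ p)
    (hlow : (s.pos u : ℕ) + t i < s.pos v) (hhigh : (s.pos v : ℕ) ≤ s.pos u + t (i + 1))
    {B₀ : List (Fin n)} (hdec : Decreasing s.pos B₀)
    (hmem : ∀ w, w ∈ B₀ ↔ (E w v ∧ (s.pos v : ℕ) ≤ s.pos w + t i) ∧ s.pos u < s.pos w) :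
    ∃ B c, Runs (if B₀ ≠ [] ∨ f = true then pure B₀ else inNearCount t (i + 1) u v) s B
        { s with clock := s.clock + c } ∧
      IsInSet p t E s.pos u v f B c ∧ B₀.length ≤ B.length := by
  split_ifs with hkeep
  · exact ⟨B₀, 0, rfl, ⟨hdec, fun w hw => ((hmem w).1 hw).imp_left And.left,
      fun hnil => hf (hkeep.resolve_left (not_not_intro hnil)), Or.inl rfl⟩, le_rfl⟩
  · obtain ⟨rfl, hfalse⟩ : B₀ = [] ∧ f = false := by simpa using hkeep
    obtain ⟨B, c, hrun, hB, hall, hc⟩ := h.runs_inNearCount_of_le (by omega) hE hhigh f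
    refine ⟨B, c, hrun, { hB with cost := Or.inr ⟨hfalse, hall, i, hi, hlow, hhigh,
      fun w hw => not_le.1 fun hle => List.not_mem_nil ((hmem w).2 ⟨⟨hw, hle⟩, ?_⟩), hc⟩ },
      Nat.zero_le _⟩
    rw [Fin.lt_def]
    omega

theorem Runs.ite_bind {α β : Type} {P : Prop} [Decidable P] {x y : Prog n α} {f : α → Prog n β}
    {s₁ s₂ s₃ : Mem n} {a : α} {b : β} (hx : Runs (if P then x else y) s₁ a s₂)
    (hf : Runs (f a) s₂ b s₃) : Runs (if P then x >>= f else y >>= f) s₁ b s₃ := by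
  split_ifs at hx ⊢ <;> exact hx.bind hf

theorem Inv.runs_nearSets_zero (h : Inv p t E s) {u v : Fin n} (hE : ¬ E u v)
    (huv : (s.pos v : ℕ) ≤ s.pos u + t 0) (f₁ f₂ : Bool) :
    ∃ A B c, Runs (do
        let A ← outNearCount t 0 u v
        let B ← inNearCount t 0 u v
        return (A, B)) s (A, B) { s with clock := s.clock + c } ∧
      IsOutSet p t E s.pos u v f₁ A 0 ∧ IsInSet p t E s.pos u v f₂ B 0 ∧ c ≤ 14 * t 0 + 6 := by
  obtain ⟨A, c₁, hrunA, hA, -, hc₁⟩ := h.runs_outNearCount_of_le (Nat.zero_le _) hE huv f₁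
  obtain ⟨B, c₂, hrunB, hB, -, hc₂⟩ :=
    (h.setClock (s.clock + c₁)).runs_inNearCount_of_le (Nat.zero_le _) hE huv f₂
  exact ⟨A, B, c₁ + c₂, hrunA.bind (hrunB.bind (by rw [← add_assoc]; rfl)), hA, hB, by omega⟩

theorem Inv.runs_nearSets_succ (h : Inv p t E s) {u v : Fin n} (hE : ¬ E u v) {f₁ f₂ : Bool}
    (hf₁ : f₁ = true → ClearOut E s.pos u v) (hf₂ : f₂ = true → ClearIn E s.pos u v) {i : ℕ}
    (hi : i ≤ p) (hlow : (s.pos u : ℕ) + t i < s.pos v)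
    (hhigh : (s.pos v : ℕ) ≤ s.pos u + t (i + 1)) :
    ∃ A B c cA cB, Runs (do
        let A₀ ← outNearTree i u v
        let B₀ ← inNearTree i u v
        let A ← if A₀ ≠ [] ∨ f₁ = true then pure A₀ else outNearCount t (i + 1) u v
        let B ← if B₀ ≠ [] ∨ f₂ = true then pure B₀ else inNearCount t (i + 1) u v
        return (A, B)) s (A, B) { s with clock := s.clock + c } ∧
      IsOutSet p t E s.pos u v f₁ A cA ∧ IsInSet p t E s.pos u v f₂ B cB ∧
      c ≤ (A.length + B.length) * (SearchTree.maxHeight n + 8) + cA + cB + 4 := by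
  obtain ⟨A₀, c₁, hrunA₀, hdecA, hmemA, hc₁⟩ := h.runs_outNearTree (by omega) hlow
  obtain ⟨B₀, c₂, hrunB₀, hdecB, hmemB, hc₂⟩ :=
    (h.setClock (s.clock + c₁)).runs_inNearTree (by omega) hlow
  obtain ⟨A, cA, hrunA, hA, hlenA⟩ := (h.setClock (s.clock + c₁ + c₂)).runs_chooseOut hE hf₁ hi
    hlow hhigh hdecA hmemA
  obtain ⟨B, cB, hrunB, hB, hlenB⟩ := (h.setClock (s.clock + c₁ + c₂ + cA)).runs_chooseIn hE hf₂
    hi hlow hhigh hdecB hmemB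
  refine ⟨A, B, c₁ + c₂ + cA + cB, cA, cB, hrunA₀.bind (hrunB₀.bind (hrunA.ite_bind
    (hrunB.ite_bind (by simp only [← add_assoc]; rfl)))), hA, hB, ?_⟩
  have hcostA := Nat.mul_le_mul_right (SearchTree.maxHeight n + 8) hlenA
  have hcostB := Nat.mul_le_mul_right (SearchTree.maxHeight n + 8) hlenB
  rw [add_mul]
  omega

theorem Inv.runs_nearSets (h : Inv p t E s) {u v : Fin n} (hE : ¬ E u v)
    (ht : n ≤ t (p + 1)) {f₁ f₂ : Bool}
    (hf₁ : f₁ = true → ClearOut E s.pos u v) (hf₂ : f₂ = true → ClearIn E s.pos u v) :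
    ∃ A B c cA cB, Runs (nearSets p t u v f₁ f₂) s (A, B) { s with clock := s.clock + c } ∧
      IsOutSet p t E s.pos u v f₁ A cA ∧ IsInSet p t E s.pos u v f₂ B cB ∧
      c ≤ p + 14 * t 0 + 12 + (A.length + B.length) * (SearchTree.maxHeight n + 8) +
        cA + cB := by
  set level := findLevel t ((s.pos v : ℕ) - s.pos u) 0 (p + 1)
  have htime : level.time ≤ p + 1 + 1 := time_findLevel_le _ _ _ _
  have hle : level.ret ≤ 0 + (p + 1) := ret_findLevel_le _ _ _ _
  have hhigh : (s.pos v : ℕ) - s.pos u ≤ t level.ret := le_threshold_findLevel (by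
    rw [zero_add]
    omega)
  have hlow : ∀ i < level.ret, t i < (s.pos v : ℕ) - s.pos u := fun i =>
    threshold_lt_of_lt_findLevel (Nat.zero_le i)
  have h' := h.setClock (s.clock + level.time)
  rcases hlevel : level.ret with _ | i
  · rw [hlevel] at hhigh
    obtain ⟨A, B, c, hrun, hA, hB, hc⟩ := h'.runs_nearSets_zero hE (by dsimp only; omega) f₁ f₂
    refine ⟨A, B, level.time + c, 0, 0, (Runs.get s).bind ((Runs.timed level s).bind ?_),
      hA, hB, by omega⟩
    rw [hlevel, ← add_assoc]
    exact hrun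
  · rw [hlevel] at hhigh hle hlow
    have hi := hlow i (Nat.lt_succ_self i)
    obtain ⟨A, B, c, cA, cB, hrun, hA, hB, hc⟩ := h'.runs_nearSets_succ hE hf₁ hf₂
      (i := i) (by omega) (by dsimp only; omega) (by dsimp only; omega)
    refine ⟨A, B, level.time + c, cA, cB, (Runs.get s).bind ((Runs.timed level s).bind ?_),
      hA, hB, by omega⟩
    rw [hlevel, ← add_assoc]
    exact hrun

end NearSets

section Schedule

variable {V P : Type*} [LinearOrder P]

/-- The order in which the recursive calls are made: by decreasing first component, then by
increasing second component. -/
def Before (T : V ≃ P) (c c' : V × V) : Prop := T c'.1 < T c.1 ∨ (c.1 = c'.1 ∧ T c.2 < T c'.2)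

theorem Before.asymm {T : V ≃ P} {c c' : V × V} (h : Before T c c') : ¬ Before T c' c := by
  rintro (hlt' | ⟨heq', hlt'⟩) <;> rcases h with hlt | ⟨heq, hlt⟩
  · exact hlt.asymm hlt'
  · exact hlt'.ne (congrArg T heq)
  · exact hlt.ne (congrArg T heq')
  · exact hlt.asymm hlt'

/-- The list `cs` contains the recursive calls for the first components `us` and the second
components `vs`, in the order in which they are made. -/
structure IsSchedule (T : V ≃ P) (us vs : List V) (cs : List (V × V)) : Prop where
  mem : ∀ x y, (x, y) ∈ cs ↔ x ∈ us ∧ y ∈ vs ∧ T x < T y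
  before : cs.Pairwise (Before T)

section IsSchedule

variable {T : V ≃ P} {us vs : List V} {cs l₁ l₂ : List (V × V)} {c c' : V × V}

theorem IsSchedule.nodup (h : IsSchedule T us vs cs) : cs.Nodup :=
  h.before.imp fun {c c'} hbefore heq => by
    subst heq
    exact hbefore.asymm hbefore

theorem IsSchedule.mem_of_before (h : IsSchedule T us vs (l₁ ++ c :: l₂))
    (hc' : c' ∈ l₁ ++ c :: l₂) (hbefore : Before T c' c) : c' ∈ l₁ := by
  have hpairwise := h.before
  rw [List.pairwise_append, List.pairwise_cons] at hpairwise
  rcases List.mem_append.1 hc' with hmem | hmem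
  · exact hmem
  rcases List.mem_cons.1 hmem with rfl | hmem
  · exact absurd hbefore hbefore.asymm
  · exact absurd hbefore (hpairwise.2.1.1 _ hmem).asymm

theorem IsSchedule.before_of_notMem (h : IsSchedule T us vs (l₁ ++ c :: l₂))
    (hc' : c' ∈ l₁ ++ c :: l₂) (hnot : c' ∉ l₁ ++ [c]) : Before T c c' := by
  have hpairwise := h.before
  rw [List.pairwise_append, List.pairwise_cons] at hpairwise
  simp only [List.mem_append, List.mem_cons, List.not_mem_nil, or_false] at hc' hnot
  exact hpairwise.2.1.1 _ (by tauto)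

theorem IsSchedule.length_add_length_le {A B : List V} {u v : V}
    (h : IsSchedule T (A ++ [u]) (v :: B) cs) (hA : (A ++ [u]).Nodup) (hB : (v :: B).Nodup)
    (huv : T u < T v) (hAv : ∀ w ∈ A, T w < T v) (hBu : ∀ w ∈ B, T u < T w) :
    A.length + B.length + 1 ≤ cs.length := by
  obtain ⟨hAnodup, -, huA⟩ := List.nodup_append.1 hA
  have hnodup : (A.map (·, v) ++ (v :: B).map (u, ·)).Nodup := by
    refine List.nodup_append.2 ⟨hAnodup.map fun _ _ heq => (Prod.mk.inj heq).1,
      hB.map fun _ _ heq => (Prod.mk.inj heq).2, fun c hc c' hc' heq => ?_⟩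
    obtain ⟨w, hw, rfl⟩ := List.mem_map.1 hc
    obtain ⟨w', -, rfl⟩ := List.mem_map.1 hc'
    exact huA w hw u (List.mem_singleton_self u) (Prod.mk.inj heq).1
  have hsubset : A.map (·, v) ++ (v :: B).map (u, ·) ⊆ cs := by
    intro c hc
    rcases List.mem_append.1 hc with hc | hc <;> obtain ⟨w, hw, rfl⟩ := List.mem_map.1 hc
    · exact (h.mem _ _).2 ⟨by simp [hw], by simp, hAv w hw⟩
    · refine (h.mem _ _).2 ⟨by simp, hw, ?_⟩
      rcases List.mem_cons.1 hw with rfl | hw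
      exacts [huv, hBu w hw]
  have hlength := (hnodup.subperm hsubset).length_le
  simp only [List.length_append, List.length_map, List.length_cons] at hlength
  omega

end IsSchedule

section Program

variable {n : ℕ} {T : Fin n ≃ Fin n} {us vs : List (Fin n)}

theorem filter_lt_cons_of_le {v' u' : Fin n} (hvs : Decreasing T (v' :: vs)) (hle : T v' ≤ T u') :
    (v' :: vs).filter (fun w => T u' < T w) = [] := by
  refine List.filter_eq_nil_iff.2 fun w hw => ?_
  rcases List.mem_cons.1 hw with rfl | hw
  · simpa using hle
  · simpa using ((List.pairwise_cons.1 hvs).1 w hw).le.trans hle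

theorem ret_callsFrom (u' : Fin n) (hvs : Decreasing T vs) (acc : List (Fin n × Fin n)) :
    (callsFrom T u' vs acc).ret =
      ((vs.filter fun v' => T u' < T v').reverse.map fun v' => (u', v')) ++ acc := by
  induction vs generalizing acc with
  | nil => simp [callsFrom]
  | cons v' vs ih =>
    simp only [callsFrom, Timed.ret_bind]
    split_ifs with hlt
    · rw [List.filter_cons_of_pos (by simpa using hlt), ih (List.pairwise_cons.1 hvs).2]
      simp
    · rw [filter_lt_cons_of_le hvs (not_lt.1 hlt)]
      simp

theorem time_callsFrom_le (u' : Fin n) (hvs : Decreasing T vs) (acc : List (Fin n × Fin n)) :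
    (callsFrom T u' vs acc).time ≤ (vs.filter fun v' => T u' < T v').length + 1 := by
  induction vs generalizing acc with
  | nil => simp [callsFrom]
  | cons v' vs ih =>
    simp only [callsFrom, Timed.time_bind, Timed.time_tick]
    split_ifs with hlt
    · have hrest := ih (List.pairwise_cons.1 hvs).2 ((u', v') :: acc)
      rw [List.filter_cons_of_pos (by simpa using hlt), List.length_cons]
      omega
    · simp

theorem ret_schedule (hvs : Decreasing T vs) :
    (schedule T vs us).ret = us.flatMap fun u' =>
      (vs.filter fun v' => T u' < T v').reverse.map fun v' => (u', v') := by
  induction us with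
  | nil => rfl
  | cons u' us ih =>
    simp only [schedule, Timed.ret_bind, Timed.ret_pure, List.flatMap_cons, ih,
      ret_callsFrom u' hvs, List.append_nil]

theorem time_schedule_le (hvs : Decreasing T vs) :
    (schedule T vs us).time ≤ 2 * us.length + (schedule T vs us).ret.length := by
  induction us with
  | nil => simp [schedule]
  | cons u' us ih =>
    have hcalls := time_callsFrom_le u' hvs []
    simp only [schedule, Timed.ret_bind, Timed.time_bind, Timed.time_tick, Timed.ret_pure,
      Timed.time_pure, List.length_append, List.length_cons, ret_callsFrom u' hvs,
      List.length_map, List.length_reverse, List.append_nil]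
    omega

theorem isSchedule_schedule (hus : Decreasing T us) (hvs : Decreasing T vs) :
    IsSchedule T us vs (schedule T vs us).ret := by
  rw [ret_schedule hvs]
  constructor
  · intro x y
    simp only [List.mem_flatMap, List.mem_map, List.mem_reverse, List.mem_filter,
      decide_eq_true_eq, Prod.mk.injEq]
    constructor
    · rintro ⟨a, ha, b, ⟨hb, hlt⟩, rfl, rfl⟩
      exact ⟨ha, hb, hlt⟩
    · rintro ⟨ha, hb, hlt⟩
      exact ⟨x, ha, y, ⟨hb, hlt⟩, rfl, rfl⟩
  · refine List.pairwise_flatMap.2 ⟨fun x _ => ?_, hus.imp fun {a b} hab c hc c' hc' => ?_⟩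
    · rw [List.pairwise_map, List.pairwise_reverse]
      exact (List.Pairwise.filter _ hvs).imp fun hlt => .inr ⟨rfl, hlt⟩
    · obtain ⟨_, -, rfl⟩ := List.mem_map.1 hc
      obtain ⟨_, -, rfl⟩ := List.mem_map.1 hc'
      exact .inl hab

end Program

end Schedule

section Progress

variable {V P : Type*} [LinearOrder P]

/-- The situation in which the call `reorder u v` makes its recursive calls `cs`: the order at its
start is `T`, and `us` and `vs` stand for `A ∪ {u}` and `B ∪ {v}`. -/
structure CallFrame (E : V → V → Prop) (u v : V) (T : V ≃ P) (us vs : List V)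
    (cs : List (V × V)) : Prop where
  isTopological : IsTopological E T
  not_reach : ¬ ReflTransGen E u v
  reach_us : ∀ x ∈ us, ReflTransGen E u x
  reach_vs : ∀ y ∈ vs, ReflTransGen E y v
  schedule : IsSchedule T us vs cs

/-- The invariant of the loop over the recursive calls `cs`: after the calls in `done`, the order
is `T₁`. -/
structure Progress [DecidableEq V] (E : V → V → Prop) (u v : V) (T : V ≃ P) (us vs : List V)
    (cs done : List (V × V)) (T₁ : V ≃ P) : Prop where
  exchanges : Exchanges E u v (T u) (T v) T T₁
  lt_of_mem_done : ∀ c ∈ done, T₁ c.2 < T₁ c.1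
  lt_of_notMem_done : ∀ c ∈ cs, c ∉ done → T₁ c.1 < T₁ c.2
  strictMonoOn_us : ∀ x ∈ us, ∀ y ∈ us, T x < T y → T₁ x < T₁ y
  strictMonoOn_vs : ∀ x ∈ vs, ∀ y ∈ vs, T x < T y → T₁ x < T₁ y

variable {E : V → V → Prop} {u v : V} {T T₁ T₂ : V ≃ P} {us vs : List V} {cs l₁ l₂ : List (V × V)}
  {c : V × V}

theorem CallFrame.not_reach_of_mem (hF : CallFrame E u v T us vs cs) {x y : V} (hx : x ∈ us)
    (hy : y ∈ vs) : ¬ ReflTransGen E x y := fun hxy =>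
  hF.not_reach (((hF.reach_us x hx).trans hxy).trans (hF.reach_vs y hy))

theorem CallFrame.not_reach_target (hF : CallFrame E u v T us vs cs) {x : V} (hx : x ∈ us) :
    ¬ ReflTransGen E x v := fun hxv => hF.not_reach ((hF.reach_us x hx).trans hxv)

theorem CallFrame.not_source_reach (hF : CallFrame E u v T us vs cs) {y : V} (hy : y ∈ vs) :
    ¬ ReflTransGen E u y := fun huy => hF.not_reach (huy.trans (hF.reach_vs y hy))

variable [DecidableEq V]

theorem CallFrame.progress_nil (hF : CallFrame E u v T us vs cs) :
    Progress E u v T us vs cs [] T where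
  exchanges := .refl
  lt_of_mem_done := by simp
  lt_of_notMem_done c hc _ := ((hF.schedule.mem c.1 c.2).1 hc).2.2
  strictMonoOn_us _ _ _ _ hxy := hxy
  strictMonoOn_vs _ _ _ _ hxy := hxy

theorem Progress.bounds (h : Progress E u v T us vs cs l₁ T₁) (hF : CallFrame E u v T us vs cs)
    (hc : c ∈ cs) : T u ≤ T₁ c.1 ∧ T₁ c.2 ≤ T v := by
  obtain ⟨hcu, hcv, -⟩ := (hF.schedule.mem c.1 c.2).1 hc
  exact ⟨(hF.isTopological.le (hF.reach_us _ hcu)).trans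
      (h.exchanges.le_apply_of_not_ancestor (hF.not_reach_target hcu)),
    (h.exchanges.apply_le_of_not_descendant (hF.not_source_reach hcv)).trans
      (hF.isTopological.le (hF.reach_vs _ hcv))⟩

theorem Progress.lt_of_lt_fst (h : Progress E u v T us vs (l₁ ++ c :: l₂) l₁ T₁)
    (hF : CallFrame E u v T us vs (l₁ ++ c :: l₂)) {x : V} (hx : x ∈ us) (hlt : T c.1 < T x) :
    T₁ c.2 < T₁ x := by
  obtain ⟨-, hcv, -⟩ := (hF.schedule.mem c.1 c.2).1 (by simp)
  rcases lt_trichotomy (T c.2) (T x) with hcx | hcx | hxc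
  · exact (h.exchanges.apply_le_of_not_descendant (hF.not_source_reach hcv)).trans_lt
      (hcx.trans_le (h.exchanges.le_apply_of_not_ancestor (hF.not_reach_target hx)))
  · exact absurd (T.injective hcx ▸ .refl) (hF.not_reach_of_mem hx hcv)
  · exact h.lt_of_mem_done (x, c.2) (hF.schedule.mem_of_before
      ((hF.schedule.mem _ _).2 ⟨hx, hcv, hxc⟩) (.inl hlt))

theorem Progress.lt_of_lt_snd (h : Progress E u v T us vs (l₁ ++ c :: l₂) l₁ T₁)
    (hF : CallFrame E u v T us vs (l₁ ++ c :: l₂)) {y : V} (hy : y ∈ vs) (hlt : T y < T c.2) :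
    T₁ y < T₁ c.1 := by
  obtain ⟨hcu, -, -⟩ := (hF.schedule.mem c.1 c.2).1 (by simp)
  rcases lt_trichotomy (T y) (T c.1) with hyc | hyc | hcy
  · exact (h.exchanges.apply_le_of_not_descendant (hF.not_source_reach hy)).trans_lt
      (hyc.trans_le (h.exchanges.le_apply_of_not_ancestor (hF.not_reach_target hcu)))
  · exact absurd (T.injective hyc ▸ .refl) (hF.not_reach_of_mem hcu hy)
  · exact h.lt_of_mem_done (c.1, y) (hF.schedule.mem_of_before
      ((hF.schedule.mem _ _).2 ⟨hcu, hy, hcy⟩) (.inr ⟨rfl, hlt⟩))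

theorem Progress.lt_next (h : Progress E u v T us vs (l₁ ++ c :: l₂) l₁ T₁)
    (hF : CallFrame E u v T us vs (l₁ ++ c :: l₂)) : T₁ c.1 < T₁ c.2 :=
  h.lt_of_notMem_done c (by simp) fun hc =>
    (List.nodup_append.1 hF.schedule.nodup).2.2 c hc c (by simp) rfl

theorem Progress.strictMonoOn_us_next (h : Progress E u v T us vs (l₁ ++ c :: l₂) l₁ T₁)
    (hF : CallFrame E u v T us vs (l₁ ++ c :: l₂))
    (hs : Exchanges E c.1 c.2 (T₁ c.1) (T₁ c.2) T₁ T₂) :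
    ∀ x ∈ us, ∀ y ∈ us, T x < T y → T₂ x < T₂ y := by
  obtain ⟨-, hcv, -⟩ := (hF.schedule.mem c.1 c.2).1 (by simp)
  intro x hx y hy hxy
  have hxy₁ := h.strictMonoOn_us x hx y hy hxy
  refine lt_of_lt_of_le ?_ (hs.le_apply_of_not_ancestor (hF.not_reach_of_mem hy hcv))
  by_cases hcx : ReflTransGen E c.1 x
  · have hcy : T₁ c.2 < T₁ y := h.lt_of_lt_fst hF hy ((hF.isTopological.le hcx).trans_lt hxy)
    by_cases hmem : T₁ x ∈ Set.Icc (T₁ c.1) (T₁ c.2)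
    · exact (hs.apply_mem hmem).2.trans_lt hcy
    · exact (hs.apply_eq_of_notMem hmem).trans_lt hxy₁
  · exact (hs.apply_le_of_not_descendant hcx).trans_lt hxy₁

theorem Progress.strictMonoOn_vs_next (h : Progress E u v T us vs (l₁ ++ c :: l₂) l₁ T₁)
    (hF : CallFrame E u v T us vs (l₁ ++ c :: l₂))
    (hs : Exchanges E c.1 c.2 (T₁ c.1) (T₁ c.2) T₁ T₂) :
    ∀ x ∈ vs, ∀ y ∈ vs, T x < T y → T₂ x < T₂ y := by
  obtain ⟨hcu, -, -⟩ := (hF.schedule.mem c.1 c.2).1 (by simp)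
  intro x hx y hy hxy
  have hxy₁ := h.strictMonoOn_vs x hx y hy hxy
  refine (hs.apply_le_of_not_descendant (hF.not_reach_of_mem hcu hx)).trans_lt ?_
  by_cases hyc : ReflTransGen E y c.2
  · have hxc : T₁ x < T₁ c.1 := h.lt_of_lt_snd hF hx (hxy.trans_le (hF.isTopological.le hyc))
    by_cases hmem : T₁ y ∈ Set.Icc (T₁ c.1) (T₁ c.2)
    · exact hxc.trans_le (hs.apply_mem hmem).1
    · exact hxy₁.trans_eq (hs.apply_eq_of_notMem hmem).symm
  · exact hxy₁.trans_le (hs.le_apply_of_not_ancestor hyc)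

theorem Progress.lt_of_notMem_next (h : Progress E u v T us vs (l₁ ++ c :: l₂) l₁ T₁)
    (hF : CallFrame E u v T us vs (l₁ ++ c :: l₂))
    (hs : Exchanges E c.1 c.2 (T₁ c.1) (T₁ c.2) T₁ T₂) :
    ∀ c' ∈ l₁ ++ c :: l₂, c' ∉ l₁ ++ [c] → T₂ c'.1 < T₂ c'.2 := by
  obtain ⟨hcu, hcv, -⟩ := (hF.schedule.mem c.1 c.2).1 (by simp)
  intro c' hc' hnot
  obtain ⟨hcu', hcv', -⟩ := (hF.schedule.mem c'.1 c'.2).1 hc'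
  have hlt' := h.lt_of_notMem_done c' hc' fun hdone => hnot (by simp [hdone])
  rcases hF.schedule.before_of_notMem hc' hnot with hfst | ⟨hfst, hsnd⟩
  · have hfst₁ := h.strictMonoOn_us _ hcu' _ hcu hfst
    rw [hs.apply_eq_of_notMem fun hmem => hmem.1.not_gt hfst₁]
    by_cases hmem : T₁ c'.2 ∈ Set.Icc (T₁ c.1) (T₁ c.2)
    · exact hfst₁.trans_le (hs.apply_mem hmem).1
    · exact hlt'.trans_eq (hs.apply_eq_of_notMem hmem).symm
  · have hsnd₁ := h.strictMonoOn_vs _ hcv _ hcv' hsnd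
    rw [hs.apply_eq_of_notMem (z := c'.2) fun hmem => hmem.2.not_gt hsnd₁, ← hfst]
    exact (hs.apply_mem ⟨le_rfl, (h.lt_next hF).le⟩).2.trans_lt hsnd₁

theorem Progress.next (h : Progress E u v T us vs (l₁ ++ c :: l₂) l₁ T₁)
    (hF : CallFrame E u v T us vs (l₁ ++ c :: l₂))
    (hs : Exchanges E c.1 c.2 (T₁ c.1) (T₁ c.2) T₁ T₂) (hflip : T₂ c.2 < T₂ c.1) :
    Progress E u v T us vs (l₁ ++ c :: l₂) (l₁ ++ [c]) T₂ where
  exchanges := by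
    obtain ⟨hcu, hcv, -⟩ := (hF.schedule.mem c.1 c.2).1 (by simp)
    obtain ⟨hlo, hhi⟩ := h.bounds hF (c := c) (by simp)
    exact ReflTransGen.trans h.exchanges
      (hs.mono (hF.reach_us _ hcu) (hF.reach_vs _ hcv) hlo hhi)
  lt_of_mem_done := by
    obtain ⟨hcu, hcv, -⟩ := (hF.schedule.mem c.1 c.2).1 (by simp)
    intro c' hc'
    rcases List.mem_append.1 hc' with hc' | hc'
    · obtain ⟨hcu', hcv', -⟩ := (hF.schedule.mem c'.1 c'.2).1 (by simp [hc'])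
      exact (hs.apply_le_of_not_descendant (hF.not_reach_of_mem hcu hcv')).trans_lt
        ((h.lt_of_mem_done c' hc').trans_le
          (hs.le_apply_of_not_ancestor (hF.not_reach_of_mem hcu' hcv)))
    · exact List.mem_singleton.1 hc' ▸ hflip
  lt_of_notMem_done := h.lt_of_notMem_next hF hs
  strictMonoOn_us := h.strictMonoOn_us_next hF hs
  strictMonoOn_vs := h.strictMonoOn_vs_next hF hs

theorem Progress.clearOut (h : Progress E u v T us vs cs l₁ T₁) (hF : CallFrame E u v T us vs cs)
    (hc : c ∈ cs) (hout : ClearOut E T u v) : ClearOut E T₁ u c.2 := by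
  intro w hw
  rw [h.exchanges.apply_eq_of_notMem fun hmem => hmem.2.not_gt (hout w hw)]
  exact (h.bounds hF hc).2.trans_lt (hout w hw)

theorem Progress.clearIn (h : Progress E u v T us vs cs l₁ T₁) (hF : CallFrame E u v T us vs cs)
    (hc : c ∈ cs) (hin : ClearIn E T u v) : ClearIn E T₁ c.1 v := by
  intro w hw
  rw [h.exchanges.apply_eq_of_notMem fun hmem => hmem.1.not_gt (hin w hw)]
  exact (hin w hw).trans_le (h.bounds hF hc).1

theorem Progress.clearOut_of_complete (h : Progress E u v T us vs (l₁ ++ c :: l₂) l₁ T₁)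
    (hF : CallFrame E u v T us vs (l₁ ++ c :: l₂)) (hc : c.1 = u)
    (hA : ∀ w, E u w → T w < T v → w ∈ us) : ClearOut E T₁ u c.2 := by
  intro w hw
  rcases lt_trichotomy (T w) (T v) with hwv | hwv | hvw
  · exact h.lt_of_lt_fst hF (hA w hw hwv) (hc ▸ hF.isTopological _ _ hw)
  · exact absurd (.single (T.injective hwv ▸ hw)) hF.not_reach
  · rw [h.exchanges.apply_eq_of_notMem fun hmem => hmem.2.not_gt hvw]
    exact (h.bounds hF (by simp)).2.trans_lt hvw

theorem Progress.clearIn_of_complete (h : Progress E u v T us vs (l₁ ++ c :: l₂) l₁ T₁)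
    (hF : CallFrame E u v T us vs (l₁ ++ c :: l₂)) (hc : c.2 = v)
    (hB : ∀ w, E w v → T u < T w → w ∈ vs) : ClearIn E T₁ c.1 v := by
  intro w hw
  rcases lt_trichotomy (T u) (T w) with huw | huw | hwu
  · exact h.lt_of_lt_snd hF (hB w hw huw) (hc ▸ hF.isTopological _ _ hw)
  · exact absurd (.single (T.injective huw ▸ hw)) hF.not_reach
  · rw [h.exchanges.apply_eq_of_notMem fun hmem => hmem.1.not_gt hwu]
    exact hwu.trans_le (h.bounds hF (by simp)).1

end Progress

section SortShare

open Classical in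
/-- The multiple of the growth of the potential that a call of `reorder` may use up for counting
sorts on one side.  It is none if the flag `f` forbids them; otherwise it is `1` if `P` holds, where
`P` says that the set on this side is empty, and `2` if not. -/
noncomputable def sortShare (f : Bool) (P : Prop) : ℝ := if f = true then 0 else if P then 1 else 2

theorem sortShare_true (P : Prop) : sortShare true P = 0 := by simp [sortShare]

theorem sortShare_false_of {P : Prop} (hP : P) : sortShare false P = 1 := by simp [sortShare, hP]

theorem sortShare_false_of_not {P : Prop} (hP : ¬ P) : sortShare false P = 2 := by
  simp [sortShare, hP]

theorem one_le_sortShare_false (P : Prop) : 1 ≤ sortShare false P := by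
  rw [sortShare, if_neg Bool.false_ne_true]
  split_ifs <;> norm_num

theorem sortShare_nonneg (f : Bool) (P : Prop) : 0 ≤ sortShare f P := by
  unfold sortShare
  split_ifs <;> norm_num

theorem sortShare_le_two (f : Bool) (P : Prop) : sortShare f P ≤ 2 := by
  unfold sortShare
  split_ifs <;> norm_num

theorem le_sortShare_mul {f : Bool} {Δ δ : ℝ} (P : Prop) (hΔ : 0 ≤ Δ) (hδ : δ ≤ Δ)
    (hf : f = true → δ = 0) : δ ≤ sortShare f P * Δ := by
  cases f
  · exact hδ.trans (le_mul_of_one_le_left hΔ (one_le_sortShare_false P))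
  · rw [hf rfl]
    exact mul_nonneg (sortShare_nonneg _ P) hΔ

/-- One recursive call with growth `Δ` and displacement charge `δ`, where `l` is the set on the side
under consideration, and `active` says that the call has the same end point on this side as the
calling one. -/
theorem sortShare_mul_add_le {α : Type*} {f : Bool} {P P' active : Prop}
    [Decidable active] {l : List α} {Δ δ : ℝ} (hΔ : 0 ≤ Δ) (hδ : δ ≤ Δ) (hf : f = true → δ = 0)
    (hnil : l = [] → active) (hne : l ≠ [] → f = false ∧ ¬ P) (hpassive : ¬ active → δ = 0)
    (hactive : active → δ = 0 ∨ P') :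
    sortShare (decide (active ∧ l = [])) P' * Δ + δ ≤ sortShare f P * Δ := by
  by_cases hl : l = []
  · rw [decide_eq_true ⟨hnil hl, hl⟩, sortShare_true, zero_mul, zero_add]
    exact le_sortShare_mul P hΔ hδ hf
  · obtain ⟨rfl, hP⟩ := hne hl
    rw [decide_eq_false fun h => hl h.2, sortShare_false_of_not hP]
    have htwo := mul_le_mul_of_nonneg_right (sortShare_le_two false P') hΔ
    by_cases ha : active
    · rcases hactive ha with hzero | hP'
      · linarith
      · rw [sortShare_false_of hP']
        linarith
    · linarith [hpassive ha]

end SortShare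

section Budget

variable {n : ℕ}

/-- Potentials that pay for the program: `G` for the exchanges and for `q` steps per recursive
call, and `X` for the counting sorts at the levels above `0`, where `rate i` is the growth of `X`
per unit of displacement in a call at level `i + 1`. -/
structure Budget (p : ℕ) (t : ℕ → ℕ) (E r : Fin n → Fin n → Prop) (q : ℕ)
    (G X : (Fin n ≃ Fin n) → ℝ) (rate : ℕ → ℝ) : Prop where
  le_threshold : n ≤ t (p + 1)
  rate_nonneg : ∀ i ≤ p, 0 ≤ rate i
  rate_mul_abs_sub_le : ∀ {u v lo hi : Fin n} {T T' : Fin n ≃ Fin n} {i : ℕ}, i ≤ p →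
    ReachExtension E r u v → IsTopological E T → Exchanges E u v lo hi T T' →
    (hi : ℕ) ≤ lo + t (i + 1) → ∀ z, rate i * |((T' z : ℕ) : ℝ) - (T z : ℕ)| ≤ X T' - X T
  sort_cost_le : ∀ i ≤ p, ((7 * t (i + 1) + 3 : ℕ) : ℝ) ≤ rate i * ((t i : ℝ) + 1)
  swap_cost_le : ∀ {x y : Fin n} {T : Fin n ≃ Fin n}, ReachExtension E r x y → IsTopological E T →
    T x < T y → ClearOut E T x y → ClearIn E T x y →
    3 * (q : ℝ) + swapCost n p (T y - T x) ≤ G ((Equiv.swap x y).trans T) - G T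
  call_cost_le : p + 14 * t 0 + SearchTree.maxHeight n + 28 ≤ q

variable {p q : ℕ} {t : ℕ → ℕ} {E r : Fin n → Fin n → Prop} {G X : (Fin n ≃ Fin n) → ℝ}
  {rate : ℕ → ℝ} {u v : Fin n} {T T₁ T₂ : Fin n ≃ Fin n}

theorem Budget.sub_nonneg (hB : Budget p t E r q G X rate) (hC : ReachExtension E r u v)
    (hT : IsTopological E T) {lo hi : Fin n} (h : Exchanges E u v lo hi T T₁) :
    0 ≤ X T₁ - X T := by
  have hthreshold := hB.le_threshold
  exact (mul_nonneg (hB.rate_nonneg p le_rfl) (abs_nonneg _)).trans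
    (hB.rate_mul_abs_sub_le le_rfl hC hT h (by omega) u)

/-- The displacement of the vertex `z` during the call `reorder u v`, multiplied by `ρ`, pays for
the counting sort of cost `c` on the side of `z`; `complete` says that the sorted set contains all
neighbours of `z` between `u` and `v`. -/
structure SortRate (E r : Fin n → Fin n → Prop) (X : (Fin n ≃ Fin n) → ℝ) (T : Fin n ≃ Fin n)
    (u v z : Fin n) (f : Bool) (complete : Prop) (c : ℕ) (ρ : ℝ) : Prop where
  nonneg : 0 ≤ ρ
  eq_zero_or : ρ = 0 ∨ (f = false ∧ complete)
  mul_abs_sub_le : ∀ {x y lo hi : Fin n} {T₁ T₂ : Fin n ≃ Fin n}, ReachExtension E r x y →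
    IsTopological E T₁ → Exchanges E x y lo hi T₁ T₂ → T u ≤ lo → hi ≤ T v →
    ρ * |((T₂ z : ℕ) : ℝ) - (T₁ z : ℕ)| ≤ X T₂ - X T₁
  cost_le : ∀ {T' : Fin n ≃ Fin n}, Exchanges E u v (T u) (T v) T T' → T' v < T' u →
    (c : ℝ) ≤ ρ * |((T' z : ℕ) : ℝ) - (T z : ℕ)|

theorem Budget.sortRate_zero (hB : Budget p t E r q G X rate) (T : Fin n ≃ Fin n) (u v z : Fin n)
    (f : Bool) (complete : Prop) : SortRate E r X T u v z f complete 0 0 where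
  nonneg := le_rfl
  eq_zero_or := .inl rfl
  mul_abs_sub_le hC hT₁ h _ _ := by
    rw [zero_mul]
    exact hB.sub_nonneg hC hT₁ h
  cost_le _ _ := by simp

theorem Budget.sortRate_rate (hB : Budget p t E r q G X rate) {z : Fin n} {f : Bool}
    {complete : Prop} {c i : ℕ} (hf : f = false) (hcomplete : complete) (hi : i ≤ p)
    (hfar : (T v : ℕ) ≤ T u + t (i + 1)) (hc : c ≤ 7 * t (i + 1) + 3)
    (hmove : ∀ {T' : Fin n ≃ Fin n}, Exchanges E u v (T u) (T v) T T' → T' v < T' u →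
      (t i : ℝ) + 1 ≤ |((T' z : ℕ) : ℝ) - (T z : ℕ)|) :
    SortRate E r X T u v z f complete c (rate i) where
  nonneg := hB.rate_nonneg i hi
  eq_zero_or := .inr ⟨hf, hcomplete⟩
  mul_abs_sub_le hC hT₁ h hlo hhi := hB.rate_mul_abs_sub_le hi hC hT₁ h (by omega) z
  cost_le h hflip :=
    calc (c : ℝ) ≤ ((7 * t (i + 1) + 3 : ℕ) : ℝ) := by exact_mod_cast hc
      _ ≤ rate i * ((t i : ℝ) + 1) := hB.sort_cost_le i hi
      _ ≤ _ := mul_le_mul_of_nonneg_left (hmove h hflip) (hB.rate_nonneg i hi)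

theorem IsOutSet.exists_sortRate {A : List (Fin n)} {f : Bool} {c : ℕ}
    (hA : IsOutSet p t E T u v f A c) (hB : Budget p t E r q G X rate) (hT : IsTopological E T)
    (hreach : ¬ ReflTransGen E u v) :
    ∃ ρ, SortRate E r X T u v u f (∀ w, E u w → T w < T v → w ∈ A) c ρ := by
  rcases hA.cost with rfl | ⟨hf, hall, i, hi, hnear, hfar, hout, hc⟩
  · exact ⟨0, hB.sortRate_zero T u v u f _⟩
  refine ⟨rate i, hB.sortRate_rate hf hall hi hfar hc fun {T'} h hflip => ?_⟩
  have hmove : (T u : ℕ) + t i < T' u := h.source_mem_of_isUpperSet hT hreach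
    (s := {q : Fin n | (T u : ℕ) + t i < q})
    (fun _ _ hle hlt => lt_of_lt_of_le (α := ℕ) hlt hle) hout hnear hflip
  refine le_trans ?_ (le_abs_self _)
  rw [le_sub_iff_add_le', ← add_assoc]
  exact_mod_cast hmove

theorem IsInSet.exists_sortRate {B : List (Fin n)} {f : Bool} {c : ℕ}
    (hI : IsInSet p t E T u v f B c) (hB : Budget p t E r q G X rate) (hT : IsTopological E T)
    (hreach : ¬ ReflTransGen E u v) :
    ∃ ρ, SortRate E r X T u v v f (∀ w, E w v → T u < T w → w ∈ B) c ρ := by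
  rcases hI.cost with rfl | ⟨hf, hall, i, hi, hnear, hfar, hin, hc⟩
  · exact ⟨0, hB.sortRate_zero T u v v f _⟩
  refine ⟨rate i, hB.sortRate_rate hf hall hi hfar hc fun {T'} h hflip => ?_⟩
  have hmove : (T' v : ℕ) + t i < T v := h.target_mem_of_isLowerSet hT hreach
    (s := {q : Fin n | (q : ℕ) + t i < T v})
    (fun _ _ hle hlt => (Nat.add_le_add_right hle _).trans_lt hlt) hin hnear hflip
  refine le_trans ?_ (neg_le_abs _)
  rw [neg_sub, le_sub_iff_add_le', ← add_assoc]
  exact_mod_cast hmove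

end Budget

section Call

variable {n p : ℕ} {t : ℕ → ℕ} {E r : Fin n → Fin n → Prop} {X : (Fin n ≃ Fin n) → ℝ}
  {u v : Fin n} {T T₁ T₂ : Fin n ≃ Fin n} {A B : List (Fin n)} {l₁ l₂ : List (Fin n × Fin n)}
  {c : Fin n × Fin n} {f₁ f₂ : Bool} {cA cB : ℕ} {ρ : ℝ}

theorem IsOutSet.decreasing_append (hA : IsOutSet p t E T u v f₁ A cA) (hT : IsTopological E T) :
    Decreasing T (A ++ [u]) :=
  List.pairwise_append.2 ⟨hA.decreasing, List.pairwise_singleton _ _, fun a ha _ hb =>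
    List.mem_singleton.1 hb ▸ hT _ _ (hA.adj a ha).1⟩

theorem IsInSet.decreasing_cons (hB : IsInSet p t E T u v f₂ B cB) (hT : IsTopological E T) :
    Decreasing T (v :: B) :=
  List.pairwise_cons.2 ⟨fun b hb => hT _ _ (hB.adj b hb).1, hB.decreasing⟩

theorem callFrame_schedule (hT : IsTopological E T) (hreach : ¬ ReflTransGen E u v)
    (hA : IsOutSet p t E T u v f₁ A cA) (hB : IsInSet p t E T u v f₂ B cB) :
    CallFrame E u v T (A ++ [u]) (v :: B) (schedule T (v :: B) (A ++ [u])).ret where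
  isTopological := hT
  not_reach := hreach
  reach_us x hx := by
    rcases List.mem_append.1 hx with hx | hx
    · exact .single (hA.adj x hx).1
    · exact List.mem_singleton.1 hx ▸ .refl
  reach_vs y hy := by
    rcases List.mem_cons.1 hy with rfl | hy
    · exact .refl
    · exact .single (hB.adj y hy).1
  schedule := isSchedule_schedule (hA.decreasing_append hT) (hB.decreasing_cons hT)

theorem Progress.sortShare_out (hP : Progress E u v T (A ++ [u]) (v :: B) (l₁ ++ c :: l₂) l₁ T₁)
    (hF : CallFrame E u v T (A ++ [u]) (v :: B) (l₁ ++ c :: l₂)) (hX : 0 ≤ X T₂ - X T₁)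
    (hC : ReachExtension E r c.1 c.2) (hs : Exchanges E c.1 c.2 (T₁ c.1) (T₁ c.2) T₁ T₂)
    (hA : IsOutSet p t E T u v f₁ A cA) (hf : f₁ = true → ClearOut E T u v)
    (hρ : SortRate E r X T u v u f₁ (∀ w, E u w → T w < T v → w ∈ A) cA ρ) :
    sortShare (decide (c.1 = u ∧ A = [])) (ClearOut E T₁ c.1 c.2) * (X T₂ - X T₁) +
        ρ * |((T₂ u : ℕ) : ℝ) - (T₁ u : ℕ)| ≤
      sortShare f₁ (ClearOut E T u v) * (X T₂ - X T₁) := by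
  obtain ⟨hcu, hcv, -⟩ := (hF.schedule.mem c.1 c.2).1 (by simp)
  obtain ⟨hlo, hhi⟩ := hP.bounds hF (c := c) (by simp)
  refine sortShare_mul_add_le hX
    (hρ.mul_abs_sub_le hC (hP.exchanges.isTopological hF.isTopological) hs hlo hhi)
    (fun hf => ?_) (fun hnil => ?_) (fun hne => ?_) (fun hpassive => ?_) (fun hactive => ?_)
  · simp [hρ.eq_zero_or.resolve_right fun h => by simp [hf] at h]
  · simpa [hnil] using hcu
  · obtain ⟨w, hw⟩ := List.exists_mem_of_ne_nil A hne
    have hnot : ¬ ClearOut E T u v := fun hout => (hout w (hA.adj w hw).1).not_gt (hA.adj w hw).2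
    exact ⟨Bool.eq_false_iff.2 fun hf₁ => hnot (hf hf₁), hnot⟩
  · have hreach : ¬ ReflTransGen E c.1 u := fun hcu' => hpassive (T.injective
      ((hF.isTopological.le hcu').antisymm (hF.isTopological.le (hF.reach_us _ hcu))))
    simp [hs.apply_eq_of_unrelated hreach (hF.not_source_reach hcv)]
  · refine hρ.eq_zero_or.imp (fun hzero => by simp [hzero]) fun hcomplete => ?_
    rw [hactive]
    exact hP.clearOut_of_complete hF hactive fun w hw hlt => by simp [hcomplete.2 w hw hlt]

theorem Progress.sortShare_in (hP : Progress E u v T (A ++ [u]) (v :: B) (l₁ ++ c :: l₂) l₁ T₁)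
    (hF : CallFrame E u v T (A ++ [u]) (v :: B) (l₁ ++ c :: l₂)) (hX : 0 ≤ X T₂ - X T₁)
    (hC : ReachExtension E r c.1 c.2) (hs : Exchanges E c.1 c.2 (T₁ c.1) (T₁ c.2) T₁ T₂)
    (hB : IsInSet p t E T u v f₂ B cB) (hf : f₂ = true → ClearIn E T u v)
    (hρ : SortRate E r X T u v v f₂ (∀ w, E w v → T u < T w → w ∈ B) cB ρ) :
    sortShare (decide (c.2 = v ∧ B = [])) (ClearIn E T₁ c.1 c.2) * (X T₂ - X T₁) +
        ρ * |((T₂ v : ℕ) : ℝ) - (T₁ v : ℕ)| ≤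
      sortShare f₂ (ClearIn E T u v) * (X T₂ - X T₁) := by
  obtain ⟨hcu, hcv, -⟩ := (hF.schedule.mem c.1 c.2).1 (by simp)
  obtain ⟨hlo, hhi⟩ := hP.bounds hF (c := c) (by simp)
  refine sortShare_mul_add_le hX
    (hρ.mul_abs_sub_le hC (hP.exchanges.isTopological hF.isTopological) hs hlo hhi)
    (fun hf => ?_) (fun hnil => ?_) (fun hne => ?_) (fun hpassive => ?_) (fun hactive => ?_)
  · simp [hρ.eq_zero_or.resolve_right fun h => by simp [hf] at h]
  · simpa [hnil] using hcv
  · obtain ⟨w, hw⟩ := List.exists_mem_of_ne_nil B hne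
    have hnot : ¬ ClearIn E T u v := fun hin => (hin w (hB.adj w hw).1).not_gt (hB.adj w hw).2
    exact ⟨Bool.eq_false_iff.2 fun hf₂ => hnot (hf hf₂), hnot⟩
  · have hreach : ¬ ReflTransGen E v c.2 := fun hvc => hpassive (T.injective
      ((hF.isTopological.le (hF.reach_vs _ hcv)).antisymm (hF.isTopological.le hvc)))
    simp [hs.apply_eq_of_unrelated (hF.not_reach_target hcu) hreach]
  · refine hρ.eq_zero_or.imp (fun hzero => by simp [hzero]) fun hcomplete => ?_
    rw [hactive]
    exact hP.clearIn_of_complete hF hactive fun w hw hlt => by simp [hcomplete.2 w hw hlt]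

end Call

section Depth

variable {n p : ℕ} {t : ℕ → ℕ} {E r : Fin n → Fin n → Prop} {u v : Fin n} {T T₁ : Fin n ≃ Fin n}
  {A B : List (Fin n)} {l₁ l₂ : List (Fin n × Fin n)} {c : Fin n × Fin n} {f₁ f₂ : Bool}
  {cA cB : ℕ}

/-- A measure that decreases along the recursion: a recursive call has a smaller distance, unless
it comes after an exchange, which settles a pair. -/
noncomputable def depth (r : Fin n → Fin n → Prop) (T : Fin n ≃ Fin n) (u v : Fin n) : ℕ :=
  (n ^ 2 - (settled r T).card) * (n + 1) + ((T v : ℕ) - T u)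

theorem depth_lt_of_card_settled_lt (h : (settled r T).card < (settled r T₁).card)
    (x y u v : Fin n) : depth r T₁ x y < depth r T u v := by
  have hsq := card_settled_le_sq r T₁
  rw [Fintype.card_fin] at hsq
  have hmul := Nat.mul_le_mul_right (n + 1)
    (show n ^ 2 - (settled r T₁).card + 1 ≤ n ^ 2 - (settled r T).card by omega)
  rw [add_mul] at hmul
  unfold depth
  omega

theorem depth_lt_of_sub_lt (h : (settled r T).card ≤ (settled r T₁).card) {x y : Fin n}
    (hlt : (T₁ y : ℕ) - T₁ x < T v - T u) : depth r T₁ x y < depth r T u v :=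
  add_lt_add_of_le_of_lt (Nat.mul_le_mul_right _ (Nat.sub_le_sub_left h _)) hlt

theorem Progress.ne_of_next_eq
    (hP : Progress E u v T (A ++ [u]) (v :: B) (l₁ ++ (u, v) :: l₂) l₁ T₁)
    (hF : CallFrame E u v T (A ++ [u]) (v :: B) (l₁ ++ (u, v) :: l₂))
    (hA : IsOutSet p t E T u v f₁ A cA) (hB : IsInSet p t E T u v f₂ B cB)
    (hAB : ¬ (A = [] ∧ B = [])) : T ≠ T₁ := by
  rintro rfl
  obtain ⟨c, hdone, hlt⟩ : ∃ c ∈ l₁, T c.1 < T c.2 := by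
    rcases not_and_or.1 hAB with hne | hne
    · obtain ⟨w, hw⟩ := List.exists_mem_of_ne_nil A hne
      obtain ⟨huw, hwv⟩ := hA.adj w hw
      exact ⟨(w, v), hF.schedule.mem_of_before ((hF.schedule.mem _ _).2 ⟨by simp [hw], by simp,
        hwv⟩) (.inl (hF.isTopological _ _ huw)), hwv⟩
    · obtain ⟨w, hw⟩ := List.exists_mem_of_ne_nil B hne
      obtain ⟨hwv, huw⟩ := hB.adj w hw
      exact ⟨(u, w), hF.schedule.mem_of_before ((hF.schedule.mem _ _).2 ⟨by simp, by simp [hw],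
        huw⟩) (.inr ⟨rfl, hF.isTopological _ _ hwv⟩), huw⟩
  exact (hP.lt_of_mem_done c hdone).not_gt hlt

theorem Progress.depth_lt (hP : Progress E u v T (A ++ [u]) (v :: B) (l₁ ++ c :: l₂) l₁ T₁)
    (hF : CallFrame E u v T (A ++ [u]) (v :: B) (l₁ ++ c :: l₂)) (hC : ReachExtension E r u v)
    (hA : IsOutSet p t E T u v f₁ A cA) (hB : IsInSet p t E T u v f₂ B cB)
    (hAB : ¬ (A = [] ∧ B = [])) : depth r T₁ c.1 c.2 < depth r T u v := by
  by_cases hne : T ≠ T₁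
  · exact depth_lt_of_card_settled_lt
      (hP.exchanges.card_settled_lt hC hF.isTopological hne) _ _ _ _
  obtain rfl := not_not.1 hne
  have hcuv : c ≠ (u, v) := by
    rintro rfl
    exact hne (hP.ne_of_next_eq hF hA hB hAB)
  obtain ⟨hlo, hhi⟩ := hP.bounds hF (c := c) (by simp)
  have hlt := hP.lt_next hF
  have hstrict : T u < T c.1 ∨ T c.2 < T v := by
    by_contra! hge
    exact hcuv (Prod.ext (T.injective (hge.1.antisymm hlo)) (T.injective (hhi.antisymm hge.2)))
  refine depth_lt_of_sub_lt le_rfl ?_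
  omega

end Depth

section Reorder

variable {n p q fuel : ℕ} {t : ℕ → ℕ} {E r : Fin n → Fin n → Prop} {G X : (Fin n ≃ Fin n) → ℝ}
  {rate : ℕ → ℝ} {u v : Fin n} {T : Fin n ≃ Fin n} {A B : List (Fin n)} {f₁ f₂ : Bool}
  {c cA cB : ℕ} {ρA ρB : ℝ} {s : Mem n}

/-- The conditions under which `reorder p t fuel u v f₁ f₂` is called in the memory `s`, in a
session whose final reachability relation is `r`. -/
structure ReorderPre (p : ℕ) (t : ℕ → ℕ) (E r : Fin n → Fin n → Prop) (fuel : ℕ) (u v : Fin n)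
    (f₁ f₂ : Bool) (s : Mem n) : Prop where
  inv : Inv p t E s
  reach : ReachExtension E r u v
  lt : s.pos u < s.pos v
  clearOut : f₁ = true → ClearOut E s.pos u v
  clearIn : f₂ = true → ClearIn E s.pos u v
  depth_lt : depth r s.pos u v < fuel

/-- The effect and the cost of a call `reorder u v f₁ f₂` that turns the memory `s` into `s'`.  The
growth of `G` exceeds the cost by `2 * q`, out of which the calling procedure pays `q`. -/
structure ReorderPost (p : ℕ) (t : ℕ → ℕ) (E : Fin n → Fin n → Prop) (q : ℕ)
    (G X : (Fin n ≃ Fin n) → ℝ) (u v : Fin n) (f₁ f₂ : Bool) (s s' : Mem n) : Prop where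
  inv : Inv p t E s'
  exchanges : Exchanges E u v (s.pos u) (s.pos v) s.pos s'.pos
  lt : s'.pos v < s'.pos u
  clock_le : (s'.clock : ℝ) ≤ s.clock + (G s'.pos - G s.pos) - 2 * q +
    sortShare f₁ (ClearOut E s.pos u v) * (X s'.pos - X s.pos) +
    sortShare f₂ (ClearIn E s.pos u v) * (X s'.pos - X s.pos)

theorem ReorderPre.not_adj (h : ReorderPre p t E r fuel u v f₁ f₂ s) : ¬ E u v :=
  fun huv => h.reach.not_reach (.single huv)

theorem SortRate.cost_le_sortShare_mul {z : Fin n} {f : Bool} {complete : Prop} {ρ : ℝ}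
    {T' : Fin n ≃ Fin n} (hρ : SortRate E r X T u v z f complete c ρ)
    (hb : Budget p t E r q G X rate) (hC : ReachExtension E r u v) (hT : IsTopological E T)
    (h : Exchanges E u v (T u) (T v) T T') (hflip : T' v < T' u) (P : Prop) :
    (c : ℝ) ≤ sortShare f P * (X T' - X T) := by
  refine (hρ.cost_le h hflip).trans (le_sortShare_mul P (hb.sub_nonneg hC hT h)
    (hρ.mul_abs_sub_le hC hT h le_rfl le_rfl) fun hf => ?_)
  rw [hρ.eq_zero_or.resolve_right fun hfalse => by simp [hf] at hfalse, zero_mul]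

theorem ReorderPre.runs_exchange (h : ReorderPre p t E r fuel u v f₁ f₂ s)
    (hb : Budget p t E r q G X rate) (hA : IsOutSet p t E s.pos u v f₁ [] cA)
    (hB : IsInSet p t E s.pos u v f₂ [] cB) (hc : c ≤ p + 14 * t 0 + 12 + cA + cB) :
    ∃ s', Runs (swapVertices p t u v) { s with clock := s.clock + 1 + c } () s' ∧
      ReorderPost p t E q G X u v f₁ f₂ s s' := by
  have hT := h.inv.isTopological
  have hout := hA.clearOut rfl
  have hin := hB.clearIn rfl
  have hexchange : Exchange E u v (s.pos u) (s.pos v) s.pos ((Equiv.swap u v).trans s.pos) :=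
    ⟨u, v, .refl, .refl, le_rfl, h.lt, le_rfl, hout, hin, rfl⟩
  obtain ⟨s', hrun, hinv, hpos, hclock⟩ := (h.inv.setClock (s.clock + 1 + c)).runs_swapVertices
    h.lt hout hin (hexchange.isTopological hT)
  have hflip : s'.pos v < s'.pos u := by simpa [hpos] using h.lt
  have hexchanges : Exchanges E u v (s.pos u) (s.pos v) s.pos s'.pos :=
    .single (hpos ▸ hexchange)
  refine ⟨s', hrun, hinv, hexchanges, hflip, ?_⟩
  obtain ⟨ρA, hρA⟩ := hA.exists_sortRate hb hT h.reach.not_reach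
  obtain ⟨ρB, hρB⟩ := hB.exists_sortRate hb hT h.reach.not_reach
  have hswap := hb.swap_cost_le h.reach hT h.lt hout hin
  rw [← hpos] at hswap
  have hcA := hρA.cost_le_sortShare_mul hb h.reach hT hexchanges hflip (ClearOut E s.pos u v)
  have hcB := hρB.cost_le_sortShare_mul hb h.reach hT hexchanges hflip (ClearIn E s.pos u v)
  have htotal : s'.clock ≤ s.clock + q + cA + cB + swapCost n p (s.pos v - s.pos u) := by
    have hq := hb.call_cost_le
    dsimp only at hclock
    omega
  have htotal' : (s'.clock : ℝ) ≤ s.clock + q + cA + cB + swapCost n p (s.pos v - s.pos u) := by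
    exact_mod_cast htotal
  linarith

/-- The state of the loop over the list `cs` in a call of `reorder` that started with the order `T`,
after the calls in the list `done`, where the loop started at time `c₀`.  The displacements of `u`
and `v` are reserved for the counting sorts of the call itself. -/
structure ReorderLoop (p : ℕ) (t : ℕ → ℕ) (E : Fin n → Fin n → Prop) (q : ℕ)
    (G X : (Fin n ≃ Fin n) → ℝ) (u v : Fin n) (f₁ f₂ : Bool) (A B : List (Fin n)) (ρA ρB : ℝ)
    (T : Fin n ≃ Fin n) (c₀ : ℕ) (cs done : List (Fin n × Fin n)) (s' : Mem n) : Prop where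
  inv : Inv p t E s'
  progress : Progress E u v T (A ++ [u]) (v :: B) cs done s'.pos
  clock_le : (s'.clock : ℝ) ≤ c₀ + (G s'.pos - G T) - 2 * q * done.length +
    (sortShare f₁ (ClearOut E T u v) * (X s'.pos - X T) -
      ρA * |((s'.pos u : ℕ) : ℝ) - (T u : ℕ)|) +
    (sortShare f₂ (ClearIn E T u v) * (X s'.pos - X T) -
      ρB * |((s'.pos v : ℕ) : ℝ) - (T v : ℕ)|)

theorem ReorderLoop.reorderPre {c₀ : ℕ} {l₁ l₂ : List (Fin n × Fin n)} {c : Fin n × Fin n}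
    {s₁ : Mem n} (h : ReorderLoop p t E q G X u v f₁ f₂ A B ρA ρB s.pos c₀ (l₁ ++ c :: l₂) l₁ s₁)
    (hpre : ReorderPre p t E r (fuel + 1) u v f₁ f₂ s)
    (hF : CallFrame E u v s.pos (A ++ [u]) (v :: B) (l₁ ++ c :: l₂))
    (hA : IsOutSet p t E s.pos u v f₁ A cA) (hB : IsInSet p t E s.pos u v f₂ B cB)
    (hAB : ¬ (A = [] ∧ B = [])) :
    ReorderPre p t E r fuel c.1 c.2 (decide (c.1 = u ∧ A = [])) (decide (c.2 = v ∧ B = [])) s₁ := by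
  have hc : c ∈ l₁ ++ c :: l₂ := by simp
  obtain ⟨hcu, hcv, -⟩ := (hF.schedule.mem c.1 c.2).1 hc
  refine ⟨h.inv, hpre.reach.mono (hF.reach_us _ hcu) (hF.reach_vs _ hcv), h.progress.lt_next hF,
    fun hnil => ?_, fun hnil => ?_, ?_⟩
  · obtain ⟨heq, hnil⟩ := of_decide_eq_true hnil
    exact heq ▸ h.progress.clearOut hF hc (hA.clearOut hnil)
  · obtain ⟨heq, hnil⟩ := of_decide_eq_true hnil
    exact heq ▸ h.progress.clearIn hF hc (hB.clearIn hnil)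
  · exact (h.progress.depth_lt hF hpre.reach hA hB hAB).trans_le (Nat.le_of_lt_succ hpre.depth_lt)

theorem ReorderLoop.next {c₀ : ℕ} {l₁ l₂ : List (Fin n × Fin n)} {c : Fin n × Fin n}
    {s₁ s₂ : Mem n}
    (h : ReorderLoop p t E q G X u v f₁ f₂ A B ρA ρB s.pos c₀ (l₁ ++ c :: l₂) l₁ s₁)
    (hpre : ReorderPre p t E r (fuel + 1) u v f₁ f₂ s)
    (hF : CallFrame E u v s.pos (A ++ [u]) (v :: B) (l₁ ++ c :: l₂))
    (hb : Budget p t E r q G X rate)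
    (hA : IsOutSet p t E s.pos u v f₁ A cA) (hB : IsInSet p t E s.pos u v f₂ B cB)
    (hρA : SortRate E r X s.pos u v u f₁ (∀ w, E u w → s.pos w < s.pos v → w ∈ A) cA ρA)
    (hρB : SortRate E r X s.pos u v v f₂ (∀ w, E w v → s.pos u < s.pos w → w ∈ B) cB ρB)
    (hpost : ReorderPost p t E q G X c.1 c.2 (decide (c.1 = u ∧ A = []))
      (decide (c.2 = v ∧ B = [])) s₁ s₂) :
    ReorderLoop p t E q G X u v f₁ f₂ A B ρA ρB s.pos c₀ (l₁ ++ c :: l₂) (l₁ ++ [c]) s₂ := by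
  refine ⟨hpost.inv, h.progress.next hF hpost.exchanges hpost.lt, ?_⟩
  obtain ⟨hcu, hcv, -⟩ := (hF.schedule.mem c.1 c.2).1 (by simp)
  have hC := hpre.reach.mono (hF.reach_us _ hcu) (hF.reach_vs _ hcv)
  have hX := hb.sub_nonneg hC h.inv.isTopological hpost.exchanges
  have hout := h.progress.sortShare_out hF hX hC hpost.exchanges hA hpre.clearOut hρA
  have hin := h.progress.sortShare_in hF hX hC hpost.exchanges hB hpre.clearIn hρB
  have hu := mul_le_mul_of_nonneg_left (abs_sub_le ((s₂.pos u : ℕ) : ℝ) (s₁.pos u : ℕ)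
    (s.pos u : ℕ)) hρA.nonneg
  have hv := mul_le_mul_of_nonneg_left (abs_sub_le ((s₂.pos v : ℕ) : ℝ) (s₁.pos v : ℕ)
    (s.pos v : ℕ)) hρB.nonneg
  rw [List.length_append, List.length_singleton]
  push_cast
  linarith [h.clock_le, hpost.clock_le]

/-- The specification of `reorder` with the given bound on the recursion depth. -/
def ReorderCorrect (p : ℕ) (t : ℕ → ℕ) (E r : Fin n → Fin n → Prop) (q : ℕ)
    (G X : (Fin n ≃ Fin n) → ℝ) (fuel : ℕ) : Prop :=
  ∀ u v f₁ f₂ s, ReorderPre p t E r fuel u v f₁ f₂ s →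
    ∃ s', Runs (reorder p t fuel u v f₁ f₂) s () s' ∧ ReorderPost p t E q G X u v f₁ f₂ s s'

theorem loop_cost_le {a b k m q₀ q ct x cA cB : ℕ} (hlen : a + b + 1 ≤ k)
    (hq : q₀ + m + 28 ≤ q) (hx : x ≤ q₀ + 12 + (a + b) * (m + 8) + cA + cB)
    (hct : ct ≤ 2 * (a + 1) + k) : 1 + x + ct + (a + k) ≤ q * k + cA + cB := by
  obtain ⟨j, rfl⟩ := Nat.exists_eq_add_of_le hlen
  nlinarith [Nat.mul_le_mul_right (a + b + 1 + j) hq]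

theorem ReorderPre.runs_calls (h : ReorderPre p t E r (fuel + 1) u v f₁ f₂ s)
    (hcorrect : ReorderCorrect p t E r q G X fuel) (hb : Budget p t E r q G X rate)
    (hA : IsOutSet p t E s.pos u v f₁ A cA) (hB : IsInSet p t E s.pos u v f₂ B cB)
    (hAB : ¬ (A = [] ∧ B = []))
    (hc : c ≤ p + 14 * t 0 + 12 + (A.length + B.length) * (SearchTree.maxHeight n + 8) + cA + cB) :
    ∃ s', Runs (do
        let cs ← timed (schedule s.pos (v :: B) (A ++ [u]))
        tick (A.length + cs.length)
        cs.forM fun c =>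
          reorder p t fuel c.1 c.2 (decide (c.1 = u ∧ A = [])) (decide (c.2 = v ∧ B = [])))
        { s with clock := s.clock + 1 + c } () s' ∧
      ReorderPost p t E q G X u v f₁ f₂ s s' := by
  have hT := h.inv.isTopological
  have hF := callFrame_schedule hT h.reach.not_reach hA hB
  have hdecA := hA.decreasing_append hT
  have hdecB := hB.decreasing_cons hT
  have htime := time_schedule_le (us := A ++ [u]) hdecB
  have hlen := hF.schedule.length_add_length_le hdecA.nodup hdecB.nodup h.lt
    (fun w hw => (hA.adj w hw).2) fun w hw => (hB.adj w hw).2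
  set cs := (schedule s.pos (v :: B) (A ++ [u])).ret
  set ct := (schedule s.pos (v :: B) (A ++ [u])).time
  obtain ⟨ρA, hρA⟩ := hA.exists_sortRate hb hT h.reach.not_reach
  obtain ⟨ρB, hρB⟩ := hB.exists_sortRate hb hT h.reach.not_reach
  let c₀ := s.clock + 1 + c + ct + (A.length + cs.length)
  obtain ⟨s', hrun, hloop⟩ := runs_forM
    (ReorderLoop p t E q G X u v f₁ f₂ A B ρA ρB s.pos c₀ cs) _ cs { s with clock := c₀ }
    (fun l₁ c l₂ s₁ hl hloop => by
      rw [hl] at hF hloop ⊢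
      obtain ⟨s₂, hrun₂, hpost⟩ := hcorrect _ _ _ _ _ (hloop.reorderPre h hF hA hB hAB)
      exact ⟨s₂, hrun₂, hloop.next h hF hb hA hB hρA hρB hpost⟩)
    ⟨h.inv.setClock c₀, hF.progress_nil, by simp⟩
  have hflip := hloop.progress.lt_of_mem_done (u, v)
    ((hF.schedule.mem u v).2 ⟨by simp, by simp, h.lt⟩)
  refine ⟨s', (Runs.timed _ _).bind ((Runs.tick _ _).bind hrun), hloop.inv,
    hloop.progress.exchanges, hflip, ?_⟩
  have hcA := hρA.cost_le hloop.progress.exchanges hflip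
  have hcB := hρB.cost_le hloop.progress.exchanges hflip
  have hcost : 1 + c + ct + (A.length + cs.length) ≤ q * cs.length + cA + cB :=
    loop_cost_le hlen hb.call_cost_le hc (by simpa using htime)
  have hcs_two : 2 ≤ cs.length := by
    have hne : A.length + B.length ≠ 0 := by simpa using hAB
    omega
  have hc₀ : (c₀ : ℝ) ≤ s.clock + (q * cs.length + cA + cB) := by
    exact_mod_cast (show c₀ ≤ s.clock + (q * cs.length + cA + cB) by omega)
  have hq : (q : ℝ) * 2 ≤ q * cs.length :=
    mul_le_mul_of_nonneg_left (by exact_mod_cast hcs_two) q.cast_nonneg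
  linarith [hloop.clock_le]

theorem runs_reorder (hb : Budget p t E r q G X rate) (fuel : ℕ) :
    ReorderCorrect p t E r q G X fuel := by
  induction fuel with
  | zero => exact fun u v f₁ f₂ s h => absurd h.depth_lt (Nat.not_lt_zero _)
  | succ fuel ih =>
    intro u v f₁ f₂ s h
    obtain ⟨A, B, c, cA, cB, hrun, hA, hB, hc⟩ := (h.inv.setClock (s.clock + 1)).runs_nearSets
      h.not_adj hb.le_threshold h.clearOut h.clearIn
    have hbody : ∃ s', Runs (if A = [] ∧ B = [] then swapVertices p t u v else do
        let cs ← timed (schedule s.pos (v :: B) (A ++ [u]))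
        tick (A.length + cs.length)
        cs.forM fun c =>
          reorder p t fuel c.1 c.2 (decide (c.1 = u ∧ A = [])) (decide (c.2 = v ∧ B = [])))
        { s with clock := s.clock + 1 + c } () s' ∧ ReorderPost p t E q G X u v f₁ f₂ s s' := by
      split_ifs with hAB
      · obtain ⟨rfl, rfl⟩ := hAB
        exact h.runs_exchange hb hA hB (by simpa using hc)
      · exact h.runs_calls ih hb hA hB hAB hc
    obtain ⟨s', hrun', hpost⟩ := hbody
    refine ⟨s', (Runs.tick 1 s).bind ((Runs.get _).bind ?_), hpost⟩
    rw [if_neg h.lt.not_ge]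
    exact hrun.bind hrun'

end Reorder

section Order

variable {V : Type*} {E : V → V → Prop} {n : ℕ}

theorem exists_isTopological [Fintype V] (hn : Fintype.card V = n)
    (hE : ∀ x, ¬ TransGen E x x) : ∃ S : V ≃ Fin n, IsTopological E S := by
  have hirrefl : Std.Irrefl (TransGen E) := ⟨hE⟩
  have hstrict : IsStrictOrder V (TransGen E) := {}
  let _ : PartialOrder V := partialOrderOfSO (TransGen E)
  let _ : Fintype (LinearExtension V) := ‹Fintype V›
  let e : Fin n ≃o LinearExtension V := Fintype.orderIsoFinOfCardEq _ hn
  refine ⟨e.symm.toEquiv, fun x y hxy => e.symm.strictMono (lt_of_le_of_ne ?_ ?_)⟩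
  · exact toLinearExtension.monotone (le_of_lt (show TransGen E x y from .single hxy))
  · rintro rfl
    exact hE _ (.single hxy)

theorem IsTopological.transGen {P : Type*} [LinearOrder P] {T : V ≃ P} (hT : IsTopological E T) :
    IsTopological (TransGen E) T := fun _ _ hxy => by
  induction hxy with
  | single h => exact hT _ _ h
  | tail _ h ih => exact ih.trans (hT _ _ h)

end Order

section AddEdge

variable {n : ℕ} {E : Fin n → Fin n → Prop} {a b x y : Fin n}

theorem addEdge_of_ne_left (h : addEdge E a b x y) (hx : x ≠ a) : E x y :=
  h.resolve_right fun hxy => hx hxy.1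

theorem addEdge_of_ne_right (h : addEdge E a b x y) (hy : y ≠ b) : E x y :=
  h.resolve_right fun hxy => hy hxy.2

theorem reflTransGen_of_addEdge_of_not_reach_left (hxy : ReflTransGen (addEdge E a b) x y)
    (hx : ¬ ReflTransGen E x a) : ReflTransGen E x y := by
  induction hxy with
  | refl => exact .refl
  | tail _ hstep ih => exact ih.tail (addEdge_of_ne_left hstep fun h => hx (h ▸ ih))

theorem reflTransGen_of_addEdge_of_not_reach_right (hxy : ReflTransGen (addEdge E a b) x y)
    (hy : ¬ ReflTransGen E b y) : ReflTransGen E x y := by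
  induction hxy using ReflTransGen.head_induction_on with
  | refl => exact .refl
  | head hstep _ ih => exact .head (addEdge_of_ne_right hstep fun h => hy (h ▸ ih)) ih

theorem reachExtension_addEdge (hacyclic : ∀ x, ¬ TransGen (addEdge E a b) x x) :
    ReachExtension E (TransGen (addEdge E a b)) b a := by
  have hmono {x y : Fin n} : ReflTransGen E x y → ReflTransGen (addEdge E a b) x y :=
    ReflTransGen.mono (fun _ _ h => Or.inl h : E ≤ addEdge E a b) x y
  have hab : addEdge E a b a b := Or.inr ⟨rfl, rfl⟩
  have hba : ¬ ReflTransGen E b a := fun h => hacyclic a (.head' hab (hmono h))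
  exact
    { not_reach := hba
      cross := fun x y hx hy => (TransGen.tail' (hmono hy) hab).trans_left (hmono hx)
      reach_of_descendant := fun x z hx hxz =>
        reflTransGen_of_addEdge_of_not_reach_left hxz.to_reflTransGen fun h => hba (hx.trans h)
      reach_of_ancestor := fun z y hy hzy =>
        reflTransGen_of_addEdge_of_not_reach_right hzy.to_reflTransGen fun h => hba (h.trans hy) }

end AddEdge

section Potentials

variable {n p q : ℕ} {t : ℕ → ℝ} {S T T' : Fin n ≃ Fin n} {E r r' : Fin n → Fin n → Prop}
  {u v lo hi : Fin n}

/-- The potential that pays for the exchanges and for `q` steps per recursive call. -/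
noncomputable def swapPotential (p q : ℕ) (S : Fin n ≃ Fin n) (r : Fin n → Fin n → Prop)
    (T : Fin n ≃ Fin n) : ℝ :=
  3 * q * (settled r T).card + swapCost n p 1 * potential r S n T

/-- The growth of the sort potential per unit of displacement in a call at level `i + 1`: the cost
`O(t (i + 1))` of a counting sort, spread over the displacement of more than `t i` that pays for
it. -/
noncomputable def sortRate (t : ℕ → ℝ) (i : ℕ) : ℝ := 10 * t (i + 1) / t i

/-- The potential that pays for the counting sorts at the levels above `0`. -/
noncomputable def sortPotential (p : ℕ) (t : ℕ → ℝ) (S : Fin n ≃ Fin n)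
    (r : Fin n → Fin n → Prop) (T : Fin n ≃ Fin n) : ℝ :=
  ∑ i ∈ Finset.range (p + 1), sortRate t i * potential r S (t (i + 1)) T

theorem swapPotential_nonneg (p q : ℕ) (S : Fin n ≃ Fin n) (r : Fin n → Fin n → Prop)
    (T : Fin n ≃ Fin n) : 0 ≤ swapPotential p q S r T := by
  have hpotential := potential_nonneg r S T (Nat.cast_nonneg n)
  unfold swapPotential
  positivity

theorem swapPotential_mono (h : ∀ x y, r x y → r' x y) (T : Fin n ≃ Fin n) :
    swapPotential p q S r T ≤ swapPotential p q S r' T := by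
  have hpotential : potential r S n T ≤ potential r' S n T := potential_mono h (Nat.cast_nonneg n)
  unfold swapPotential
  gcongr
  exact settled_mono h

theorem swapPotential_le (hS : IsTopological r S) (T : Fin n ≃ Fin n) :
    swapPotential p q S r T ≤ 3 * q * (n : ℝ) ^ 2 + 2 * swapCost n p 1 * ((n : ℝ) ^ 2 * √n) := by
  have hcard : ((settled r T).card : ℝ) ≤ (n : ℝ) ^ 2 := by
    simpa using Nat.cast_le (α := ℝ).2 (card_settled_le_sq r T)
  have hpotential := potential_le (T := T) hS (Nat.cast_nonneg n)
  calc swapPotential p q S r T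
      ≤ 3 * q * (n : ℝ) ^ 2 + swapCost n p 1 * (2 * ((n : ℝ) ^ 2 * √n)) := by
        unfold swapPotential
        gcongr
    _ = _ := by ring

theorem swapCost_le (n p : ℕ) {d : ℕ} (hd : 1 ≤ d) : swapCost n p d ≤ swapCost n p 1 * d := by
  obtain ⟨k, rfl⟩ := Nat.exists_eq_add_of_le hd
  unfold swapCost levelCost
  nlinarith [Nat.zero_le ((p + 2) * k), Nat.zero_le k]

theorem Exchange.cost_le_swapPotential_sub (h : Exchange E u v (T u) (T v) T T')
    (hC : ReachExtension E r u v) (hT : IsTopological E T) (hS : IsTopological r S)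
    (hT' : T' u = T v) (huv : T u < T v) :
    3 * (q : ℝ) + swapCost n p (T v - T u) ≤
      swapPotential p q S r T' - swapPotential p q S r T := by
  have hcard : ((settled r T).card : ℝ) + 1 ≤ (settled r T').card := by
    exact_mod_cast h.card_settled_lt hC hT
  have hrange : ((T v : ℕ) : ℝ) - (T u : ℕ) ≤ n :=
    (sub_le_self _ (Nat.cast_nonneg _)).trans (by exact_mod_cast (T v).2.le)
  have hmove : ((T v : ℕ) : ℝ) - (T u : ℕ) ≤ potential r S n T' - potential r S n T := by
    simpa only [hT'] using (le_abs_self _).trans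
      (h.abs_sub_le_potential_sub hC hT hS (Nat.cast_nonneg n) hrange u)
  have hcost : (swapCost n p (T v - T u) : ℝ) ≤
      swapCost n p 1 * (((T v : ℕ) : ℝ) - (T u : ℕ)) := by
    rw [← Nat.cast_sub (Fin.lt_def.1 huv).le]
    exact_mod_cast swapCost_le n p (Nat.sub_pos_of_lt (Fin.lt_def.1 huv))
  have hpairs := mul_le_mul_of_nonneg_left hcard (by positivity : (0 : ℝ) ≤ 3 * (q : ℝ))
  have hpotential := mul_le_mul_of_nonneg_left hmove (Nat.cast_nonneg (swapCost n p 1))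
  unfold swapPotential
  linarith

theorem sortRate_nonneg (ht : ∀ i ≤ p + 1, 0 ≤ t i) {i : ℕ} (hi : i ≤ p) : 0 ≤ sortRate t i :=
  div_nonneg (mul_nonneg (by norm_num) (ht (i + 1) (by omega))) (ht i (by omega))

theorem sortPotential_nonneg (ht : ∀ i ≤ p + 1, 0 ≤ t i) (S : Fin n ≃ Fin n)
    (r : Fin n → Fin n → Prop) (T : Fin n ≃ Fin n) : 0 ≤ sortPotential p t S r T :=
  Finset.sum_nonneg fun i hi => by
    rw [Finset.mem_range] at hi
    exact mul_nonneg (sortRate_nonneg ht (by omega)) (potential_nonneg r S T (ht _ (by omega)))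

theorem sortPotential_mono (ht : ∀ i ≤ p + 1, 0 ≤ t i) (h : ∀ x y, r x y → r' x y)
    (T : Fin n ≃ Fin n) : sortPotential p t S r T ≤ sortPotential p t S r' T :=
  Finset.sum_le_sum fun i hi => by
    rw [Finset.mem_range] at hi
    exact mul_le_mul_of_nonneg_left (potential_mono h (ht _ (by omega)))
      (sortRate_nonneg ht (by omega))

theorem rpow_three_halves {x : ℝ} (hx : 0 ≤ x) : x ^ (3 / 2 : ℝ) = x * √x := by
  rw [Real.sqrt_eq_rpow, ← Real.rpow_one_add' hx (by norm_num)]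
  norm_num

theorem sortPotential_le (ht : ∀ i ≤ p + 1, 0 ≤ t i) (hS : IsTopological r S)
    (T : Fin n ≃ Fin n) :
    sortPotential p t S r T ≤
      20 * ∑ i ∈ Finset.Icc 1 (p + 1), (n : ℝ) ^ 2 * t i ^ (3 / 2 : ℝ) / t (i - 1) := by
  have hreindex : ∑ i ∈ Finset.Icc 1 (p + 1), (n : ℝ) ^ 2 * t i ^ (3 / 2 : ℝ) / t (i - 1) =
      ∑ i ∈ Finset.range (p + 1), (n : ℝ) ^ 2 * t (i + 1) ^ (3 / 2 : ℝ) / t i := by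
    rw [Finset.range_eq_Ico, ← Finset.Ico_add_one_right_eq_Icc, ← Finset.sum_Ico_add' _ 0 (p + 1) 1]
    simp only [Nat.add_sub_cancel]
  rw [hreindex, Finset.mul_sum]
  refine Finset.sum_le_sum fun i hi => ?_
  rw [Finset.mem_range] at hi
  have hti := ht (i + 1) (by omega)
  calc sortRate t i * potential r S (t (i + 1)) T
      ≤ sortRate t i * (2 * ((n : ℝ) ^ 2 * √(t (i + 1)))) :=
        mul_le_mul_of_nonneg_left (potential_le hS hti) (sortRate_nonneg ht (by omega))
    _ = 20 * ((n : ℝ) ^ 2 * t (i + 1) ^ (3 / 2 : ℝ) / t i) := by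
        rw [rpow_three_halves hti, sortRate]
        ring

theorem Exchanges.sortRate_mul_le (h : Exchanges E u v lo hi T T') (hC : ReachExtension E r u v)
    (hT : IsTopological E T) (hS : IsTopological r S) (ht : ∀ i ≤ p + 1, 0 ≤ t i) {i : ℕ}
    (hi : i ≤ p) {δ : ℝ} (hδ : δ ≤ potential r S (t (i + 1)) T' - potential r S (t (i + 1)) T) :
    sortRate t i * δ ≤ sortPotential p t S r T' - sortPotential p t S r T := by
  have hterm : ∀ j ∈ Finset.range (p + 1), 0 ≤
      sortRate t j * (potential r S (t (j + 1)) T' - potential r S (t (j + 1)) T) := by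
    intro j hj
    rw [Finset.mem_range] at hj
    exact mul_nonneg (sortRate_nonneg ht (by omega))
      (sub_nonneg.2 (h.potential_le hC hT hS (ht _ (by omega))))
  calc sortRate t i * δ
      ≤ sortRate t i * (potential r S (t (i + 1)) T' - potential r S (t (i + 1)) T) :=
        mul_le_mul_of_nonneg_left hδ (sortRate_nonneg ht hi)
    _ ≤ ∑ j ∈ Finset.range (p + 1),
          sortRate t j * (potential r S (t (j + 1)) T' - potential r S (t (j + 1)) T) :=
        Finset.single_le_sum hterm (Finset.mem_range.2 (by omega))
    _ = sortPotential p t S r T' - sortPotential p t S r T := by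
        simp only [sortPotential, mul_sub, Finset.sum_sub_distrib]

theorem sort_cost_le_sortRate_mul {i : ℕ} (hi : 0 < t i) (hi' : 1 ≤ t (i + 1)) :
    ((7 * ⌊t (i + 1)⌋₊ + 3 : ℕ) : ℝ) ≤ sortRate t i * ((⌊t i⌋₊ : ℝ) + 1) := by
  have hfloor := Nat.floor_le (zero_le_one.trans hi')
  push_cast
  calc 7 * (⌊t (i + 1)⌋₊ : ℝ) + 3 ≤ 10 * t (i + 1) := by linarith
    _ = sortRate t i * t i := by rw [sortRate, div_mul_cancel₀ _ hi.ne']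
    _ ≤ sortRate t i * ((⌊t i⌋₊ : ℝ) + 1) := by
        unfold sortRate
        gcongr
        exact (Nat.lt_floor_add_one _).le

theorem budget_potentials (ht : ∀ i ≤ p + 1, 1 ≤ t i) (htn : (n : ℝ) ≤ t (p + 1))
    (hS : IsTopological r S) (hq : p + 14 * ⌊t 0⌋₊ + SearchTree.maxHeight n + 28 ≤ q) :
    Budget p (fun i => ⌊t i⌋₊) E r q (swapPotential p q S r) (sortPotential p t S r)
      (sortRate t) := by
  have ht₀ : ∀ i ≤ p + 1, 0 ≤ t i := fun i hi => zero_le_one.trans (ht i hi)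
  exact
    { le_threshold := Nat.le_floor htn
      rate_nonneg := fun i hi => sortRate_nonneg ht₀ hi
      rate_mul_abs_sub_le := fun hi hC hT h hwidth z => by
        have hwidth' := (Nat.cast_le (α := ℝ)).2 hwidth
        push_cast at hwidth'
        have hti := ht₀ _ (Nat.succ_le_succ hi)
        exact h.sortRate_mul_le hC hT hS ht₀ hi (h.abs_sub_le_potential_sub hC hT hS hti
          (by linarith [Nat.floor_le hti]) z)
      sort_cost_le := fun i hi => sort_cost_le_sortRate_mul
        (one_pos.trans_le (ht i (by omega))) (ht (i + 1) (by omega))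
      swap_cost_le := fun {x y T} hC hT hxy hout hin =>
        Exchange.cost_le_swapPotential_sub
          ⟨x, y, .refl, .refl, le_rfl, hxy, le_rfl, hout, hin, rfl⟩ hC hT hS (by simp) hxy
      call_cost_le := hq }

end Potentials

section Insert

variable {n p q fuel : ℕ} {t : ℕ → ℕ} {E : Fin n → Fin n → Prop} {G X : (Fin n ≃ Fin n) → ℝ}
  {rate : ℕ → ℝ} {s : Mem n} {a b : Fin n}

/-- A number which exceeds the recursion depth of every call of `reorder`. -/
def sufficientFuel (n : ℕ) : ℕ := n ^ 2 * (n + 1) + n + 1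

theorem depth_lt_sufficientFuel (r : Fin n → Fin n → Prop) (T : Fin n ≃ Fin n) (u v : Fin n) :
    depth r T u v < sufficientFuel n := by
  have hpairs : (n ^ 2 - (settled r T).card) * (n + 1) ≤ n ^ 2 * (n + 1) :=
    Nat.mul_le_mul_right _ (Nat.sub_le _ _)
  unfold depth sufficientFuel
  omega

theorem Inv.runs_insert_of_lt (h : Inv p t E s) (hlt : s.pos a < s.pos b) (fuel : ℕ) :
    ∃ s', Runs (insert p t fuel a b) s () s' ∧ Inv p t (addEdge E a b) s' ∧
      s'.pos = s.pos ∧ s'.clock ≤ s.clock + (insertCost n p + 1) := by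
  obtain ⟨s', hrun, hinv, hpos, hclock⟩ := (h.setClock (s.clock + 1)).runs_insertEdge hlt
  refine ⟨s', (Runs.tick 1 s).bind ((Runs.get _).bind ?_), hinv, hpos, ?_⟩
  · rw [if_neg (not_le.2 hlt)]
    exact hrun
  · dsimp only at hclock
    omega

theorem Inv.runs_insert_of_gt (h : Inv p t E s) (hlt : s.pos b < s.pos a)
    (hb : Budget p t E (TransGen (addEdge E a b)) q G X rate)
    (hacyclic : ∀ x, ¬ TransGen (addEdge E a b) x x) :
    ∃ s', Runs (insert p t (sufficientFuel n) a b) s () s' ∧ Inv p t (addEdge E a b) s' ∧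
      (s'.clock : ℝ) ≤ s.clock + (insertCost n p + 1) + (G s'.pos - G s.pos) +
        4 * (X s'.pos - X s.pos) := by
  have hC := reachExtension_addEdge hacyclic
  obtain ⟨s₁, hrun₁, h₁⟩ := runs_reorder hb (sufficientFuel n) b a false false
    { s with clock := s.clock + 1 } ⟨h.setClock _, hC, hlt, by simp, by simp,
      depth_lt_sufficientFuel _ _ _ _⟩
  obtain ⟨s₂, hrun₂, hinv, hpos, hclock₂⟩ := h₁.inv.runs_insertEdge h₁.lt
  refine ⟨s₂, (Runs.tick 1 s).bind ((Runs.get _).bind ?_), hinv, ?_⟩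
  · rw [if_pos hlt.le]
    exact hrun₁.bind hrun₂
  have hX : 0 ≤ X s₁.pos - X s.pos := hb.sub_nonneg hC h.isTopological h₁.exchanges
  have hout := mul_le_mul_of_nonneg_right (sortShare_le_two false (ClearOut E s.pos b a)) hX
  have hin := mul_le_mul_of_nonneg_right (sortShare_le_two false (ClearIn E s.pos b a)) hX
  have hclock₁ := h₁.clock_le
  have hclock₂' : (s₂.clock : ℝ) ≤ s₁.clock + insertCost n p := by exact_mod_cast hclock₂
  dsimp only at hclock₁
  push_cast at hclock₁
  rw [hpos]
  linarith [Nat.cast_nonneg (α := ℝ) q]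

theorem Inv.runs_insert (h : Inv p t E s)
    (hb : Budget p t E (TransGen (addEdge E a b)) q G X rate)
    (hacyclic : ∀ x, ¬ TransGen (addEdge E a b) x x) :
    ∃ s', Runs (insert p t (sufficientFuel n) a b) s () s' ∧ Inv p t (addEdge E a b) s' ∧
      (s'.clock : ℝ) ≤ s.clock + (insertCost n p + 1) + (G s'.pos - G s.pos) +
        4 * (X s'.pos - X s.pos) := by
  rcases lt_trichotomy (s.pos a) (s.pos b) with hlt | heq | hgt
  · obtain ⟨s', hrun, hinv, hpos, hclock⟩ := h.runs_insert_of_lt hlt (sufficientFuel n)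
    refine ⟨s', hrun, hinv, ?_⟩
    simpa [hpos] using (Nat.cast_le (α := ℝ)).2 hclock
  · exact absurd (.single (Or.inr ⟨rfl, s.pos.injective heq⟩)) (hacyclic a)
  · exact h.runs_insert_of_gt hgt hb hacyclic

end Insert

section Session

variable {n p q : ℕ} {t : ℕ → ℝ} {S T₀ : Fin n ≃ Fin n} {E₀ es l l₁ l₂ : List (Fin n × Fin n)}
  {s : Mem n} {a b : Fin n}

/-- The graph whose edges are the elements of a list, as in the statement of `IsAcyclic`. -/
abbrev graphOf (l : List (Fin n × Fin n)) : Fin n → Fin n → Prop := fun x y => (x, y) ∈ l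

theorem graphOf_nil : graphOf ([] : List (Fin n × Fin n)) = fun _ _ => False := by
  ext x y
  simp

theorem addEdge_graphOf (l : List (Fin n × Fin n)) (a b : Fin n) :
    addEdge (graphOf l) a b = graphOf (l ++ [(a, b)]) := by
  ext x y
  simp [addEdge]

theorem transGen_graphOf_mono (h : l₁ ⊆ l₂) (x y : Fin n) (hxy : TransGen (graphOf l₁) x y) :
    TransGen (graphOf l₂) x y :=
  TransGen.mono (fun _ _ hl => h hl : graphOf l₁ ≤ graphOf l₂) x y hxy

theorem runs_forM_insertEdge (t : ℕ → ℕ) (h : IsTopologicalOrder E₀ T₀) :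
    ∃ s, Runs (E₀.forM fun e => insertEdge p t e.1 e.2) (emptyMem T₀) () s ∧
      Inv p t (graphOf E₀) s := by
  obtain ⟨s, hrun, hinv, -⟩ := runs_forM (fun l s => Inv p t (graphOf l) s ∧ s.pos = T₀)
    (fun e => insertEdge p t e.1 e.2) E₀ (emptyMem T₀)
    (by
      rintro l₁ ⟨a, b⟩ l₂ s rfl ⟨hinv, rfl⟩
      obtain ⟨s', hrun, hinv', hpos, -⟩ := hinv.runs_insertEdge (h (a, b) (by simp))
      exact ⟨s', hrun, addEdge_graphOf l₁ a b ▸ hinv', hpos⟩)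
    ⟨graphOf_nil (n := n) ▸ inv_emptyMem T₀, rfl⟩
  exact ⟨s, hrun, hinv⟩

/-- The bound on the time of the insertions up to the edges `l` which the induction over the
insertions preserves. -/
noncomputable def paidTime (p q : ℕ) (t : ℕ → ℝ) (S : Fin n ≃ Fin n)
    (E₀ l : List (Fin n × Fin n)) (T : Fin n ≃ Fin n) : ℝ :=
  l.length * (insertCost n p + 1) + swapPotential p q S (TransGen (graphOf (E₀ ++ l))) T +
    4 * sortPotential p t S (TransGen (graphOf (E₀ ++ l))) T

theorem Inv.runs_insert_paid (h : Inv p (fun i => ⌊t i⌋₊) (graphOf (E₀ ++ l)) s)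
    (hpaid : s.clock ≤ paidTime p q t S E₀ l s.pos) (ht : ∀ i ≤ p + 1, 1 ≤ t i)
    (htn : (n : ℝ) ≤ t (p + 1)) (hq : p + 14 * ⌊t 0⌋₊ + SearchTree.maxHeight n + 28 ≤ q)
    (hS : IsTopological (graphOf (E₀ ++ (l ++ [(a, b)]))) S) :
    ∃ s', Runs (insert p (fun i => ⌊t i⌋₊) (sufficientFuel n) a b) s () s' ∧
      Inv p (fun i => ⌊t i⌋₊) (graphOf (E₀ ++ (l ++ [(a, b)]))) s' ∧
      s'.clock ≤ paidTime p q t S E₀ (l ++ [(a, b)]) s'.pos := by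
  have hadd : addEdge (graphOf (E₀ ++ l)) a b = graphOf (E₀ ++ (l ++ [(a, b)])) := by
    rw [addEdge_graphOf, List.append_assoc]
  have hacyclic : ∀ x, ¬ TransGen (addEdge (graphOf (E₀ ++ l)) a b) x x := fun x hx =>
    (hS.transGen x x (hadd ▸ hx)).false
  obtain ⟨s', hrun, hinv, hclock⟩ := h.runs_insert
    (budget_potentials ht htn (hadd ▸ hS.transGen) hq) hacyclic
  rw [hadd] at hinv hclock
  refine ⟨s', hrun, hinv, ?_⟩
  have hsub : E₀ ++ l ⊆ E₀ ++ (l ++ [(a, b)]) := by simp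
  have hswap := swapPotential_mono (p := p) (q := q) (S := S) (transGen_graphOf_mono hsub) s.pos
  have hsort := sortPotential_mono (S := S) (fun i hi => zero_le_one.trans (ht i hi))
    (transGen_graphOf_mono hsub) s.pos
  unfold paidTime at hpaid ⊢
  rw [List.length_append, List.length_singleton]
  push_cast
  linarith

theorem exists_runs_session (ht : ∀ i ≤ p + 1, 1 ≤ t i) (htn : (n : ℝ) ≤ t (p + 1))
    (hq : p + 14 * ⌊t 0⌋₊ + SearchTree.maxHeight n + 28 ≤ q) (hT₀ : IsTopologicalOrder E₀ T₀)
    (hS : IsTopological (graphOf (E₀ ++ es)) S) :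
    ∃ s, Runs (session p (fun i => ⌊t i⌋₊) (sufficientFuel n) E₀ es) (emptyMem T₀) () s ∧
      s.clock ≤ paidTime p q t S E₀ es s.pos := by
  obtain ⟨s₀, hrun₀, hinv₀⟩ := runs_forM_insertEdge (p := p) (fun i => ⌊t i⌋₊) hT₀
  have hinit : 0 ≤ paidTime p q t S E₀ [] s₀.pos := by
    have hswap := swapPotential_nonneg p q S (TransGen (graphOf (E₀ ++ []))) s₀.pos
    have hsort := sortPotential_nonneg (fun i hi => zero_le_one.trans (ht i hi)) S
      (TransGen (graphOf (E₀ ++ []))) s₀.pos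
    unfold paidTime
    simp only [List.length_nil, Nat.cast_zero]
    linarith
  obtain ⟨s, hrun, -, hpaid⟩ := runs_forM
    (fun l s => Inv p (fun i => ⌊t i⌋₊) (graphOf (E₀ ++ l)) s ∧
      s.clock ≤ paidTime p q t S E₀ l s.pos)
    (fun e => insert p (fun i => ⌊t i⌋₊) (sufficientFuel n) e.1 e.2) es { s₀ with clock := 0 }
    (by
      rintro l ⟨a, b⟩ l' s rfl ⟨hinv, hpaid⟩
      refine hinv.runs_insert_paid hpaid ht htn hq fun x y hxy => hS x y ?_
      simp only [List.mem_append, List.mem_cons] at hxy ⊢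
      tauto)
    ⟨by simpa using hinv₀.setClock 0, by simpa using hinit⟩
  exact ⟨s, hrun₀.bind (Runs.bind (a := ()) rfl hrun), hpaid⟩

/-- The factor by which the time of a session exceeds the expression in the theorem. -/
def overhead (n p : ℕ) : ℕ :=
  insertCost n p + 1 + 3 * (p + SearchTree.maxHeight n + 42) + 2 * swapCost n p 1

theorem log_succ_le_three_mul_log (hn : 2 ≤ n) :
    (Nat.log 2 (n + 1) : ℝ) ≤ 3 * Real.log n := by
  have hn' : (2 : ℝ) ≤ n := by exact_mod_cast hn
  have hpow : (2 : ℝ) ^ Nat.log 2 (n + 1) ≤ (n : ℝ) ^ 2 := by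
    have hlog : (2 : ℝ) ^ Nat.log 2 (n + 1) ≤ n + 1 := by
      exact_mod_cast Nat.pow_log_le_self 2 n.succ_ne_zero
    nlinarith
  have hlog := Real.log_le_log (by positivity) hpow
  rw [Real.log_pow, Real.log_pow] at hlog
  push_cast at hlog
  nlinarith [Real.log_two_gt_d9, Nat.cast_nonneg (α := ℝ) (Nat.log 2 (n + 1))]

theorem two_thirds_le_log (hn : 2 ≤ n) : 2 / 3 ≤ Real.log n :=
  (by linarith [Real.log_two_gt_d9] : (2 / 3 : ℝ) ≤ Real.log 2).trans
    (Real.log_le_log two_pos (by exact_mod_cast hn))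

theorem overhead_le (hn : 2 ≤ n) (p : ℕ) :
    (overhead n p : ℝ) ≤ 1000 * ((p + 1) * Real.log n) := by
  have hlog := two_thirds_le_log hn
  have hheight : (SearchTree.maxHeight n : ℝ) ≤ 8 * Real.log n := by
    unfold SearchTree.maxHeight
    push_cast
    linarith [log_succ_le_three_mul_log hn]
  have hlevels : ((p : ℝ) + 2) * (22 * SearchTree.maxHeight n + 35) ≤
      (2 * (p + 1)) * (229 * Real.log n) := by
    gcongr <;> linarith [Nat.cast_nonneg (α := ℝ) p]
  have hp : (p : ℝ) * (2 / 3) ≤ p * Real.log n := by gcongr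
  unfold overhead insertCost swapCost levelCost pairCost
  push_cast
  linarith

theorem length_le_sq (hes : es.Nodup) : (es.length : ℝ) ≤ (n : ℝ) ^ 2 := by
  have hcard := hes.length_le_card
  rw [Fintype.card_prod, Fintype.card_fin, ← sq] at hcard
  exact_mod_cast hcard

theorem levelSum_nonneg (n : ℕ) (ht : ∀ i ≤ p + 1, 0 ≤ t i) :
    0 ≤ ∑ i ∈ Finset.Icc 1 (p + 1), (n : ℝ) ^ 2 * t i ^ (3 / 2 : ℝ) / t (i - 1) :=
  Finset.sum_nonneg fun i hi => by
    rw [Finset.mem_Icc] at hi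
    have hti := ht i hi.2
    have hti' := ht (i - 1) (by omega)
    positivity

theorem levelSum_add_nonneg (n : ℕ) (ht : ∀ i ≤ p + 1, 0 ≤ t i) :
    0 ≤ ∑ i ∈ Finset.Icc 1 (p + 1), (n : ℝ) ^ 2 * t i ^ (3 / 2 : ℝ) / t (i - 1) +
      (n : ℝ) ^ 2 * t 0 :=
  add_nonneg (levelSum_nonneg n ht) (mul_nonneg (sq_nonneg _) (ht 0 (Nat.zero_le _)))

theorem paidTime_le (ht₀ : √n ≤ t 0) (ht : ∀ i ≤ p + 1, 1 ≤ t i) (hes : es.Nodup)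
    (hS : IsTopological (graphOf (E₀ ++ es)) S) (T : Fin n ≃ Fin n) :
    paidTime p (p + 14 * ⌊t 0⌋₊ + SearchTree.maxHeight n + 28) t S E₀ es T ≤ overhead n p *
      (∑ i ∈ Finset.Icc 1 (p + 1), (n : ℝ) ^ 2 * t i ^ (3 / 2 : ℝ) / t (i - 1) +
        (n : ℝ) ^ 2 * t 0) := by
  have hnonneg : ∀ i ≤ p + 1, 0 ≤ t i := fun i hi => zero_le_one.trans (ht i hi)
  have hone : 1 ≤ t 0 := ht 0 (Nat.zero_le _)
  have hswap := swapPotential_le (p := p) (q := p + 14 * ⌊t 0⌋₊ + SearchTree.maxHeight n + 28)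
    hS.transGen T
  have hsort := sortPotential_le hnonneg hS.transGen T
  have hsum := levelSum_nonneg n hnonneg
  set W := ∑ i ∈ Finset.Icc 1 (p + 1), (n : ℝ) ^ 2 * t i ^ (3 / 2 : ℝ) / t (i - 1)
  have hinsert : (es.length : ℝ) * (insertCost n p + 1) ≤
      ((n : ℝ) ^ 2 * t 0) * (insertCost n p + 1) := by
    gcongr
    exact (length_le_sq hes).trans (le_mul_of_one_le_right (by positivity) hone)
  have hcall : ((p + 14 * ⌊t 0⌋₊ + SearchTree.maxHeight n + 28 : ℕ) : ℝ) ≤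
      (p + SearchTree.maxHeight n + 42) * t 0 := by
    have hfloor := Nat.floor_le (zero_le_one.trans hone)
    have hrest := le_mul_of_one_le_right
      (by positivity : (0 : ℝ) ≤ p + SearchTree.maxHeight n + 28) hone
    push_cast
    linarith
  have hcalls := mul_le_mul_of_nonneg_right hcall (by positivity : (0 : ℝ) ≤ 3 * (n : ℝ) ^ 2)
  have hexchanges : 2 * (swapCost n p 1 : ℝ) * ((n : ℝ) ^ 2 * √n) ≤
      2 * swapCost n p 1 * ((n : ℝ) ^ 2 * t 0) := by gcongr
  have hoverhead : (80 : ℝ) ≤ overhead n p := by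
    exact_mod_cast (by unfold overhead; omega : 80 ≤ overhead n p)
  have hsorts := mul_le_mul_of_nonneg_right hoverhead hsum
  rw [mul_add, paidTime]
  refine le_trans ?_ (add_le_add_left hsorts _)
  unfold overhead
  push_cast at hcalls hswap ⊢
  linarith

theorem exists_session_clock_le (ht₀ : √n ≤ t 0) (ht : ∀ i ≤ p + 1, 1 ≤ t i)
    (htn : (n : ℝ) ≤ t (p + 1)) (hT₀ : IsTopologicalOrder E₀ T₀) (hes : es.Nodup)
    (hacyclic : IsAcyclic (E₀ ++ es)) :
    ∃ (fuel : ℕ) (s : Mem n),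
      (session p (fun i => ⌊t i⌋₊) fuel E₀ es).run (emptyMem T₀) = some ((), s) ∧
      (s.clock : ℝ) ≤ overhead n p *
        (∑ i ∈ Finset.Icc 1 (p + 1), (n : ℝ) ^ 2 * t i ^ (3 / 2 : ℝ) / t (i - 1) +
          (n : ℝ) ^ 2 * t 0) := by
  obtain ⟨S, hS⟩ := exists_isTopological (Fintype.card_fin n) hacyclic
  obtain ⟨s, hrun, hpaid⟩ := exists_runs_session ht htn le_rfl hT₀ hS
  exact ⟨_, s, hrun, hpaid.trans (paidTime_le ht₀ ht hes hS s.pos)⟩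

end Session

section Parameters

variable {n p : ℕ} {t : ℕ → ℝ} {c : ℝ}

theorem one_lt_of_sqrt_lt_self {x : ℝ} (hx : √x < x) : 1 < x := by
  have hpos : 0 < x := (Real.sqrt_nonneg x).trans_lt hx
  rw [Real.sqrt_lt' hpos] at hx
  nlinarith

theorem lt_of_forall_lt_succ {x : ℝ} (hx : x < t 0) (ht : ∀ i ≤ p, t i < t (i + 1)) :
    ∀ i ≤ p + 1, x < t i
  | 0, _ => hx
  | i + 1, hi => (lt_of_forall_lt_succ hx ht i (by omega)).trans (ht i (by omega))

theorem succ_le_mul_log (hn : 2 ≤ n) (hp : (p : ℝ) ≤ c * Real.log n) :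
    (p : ℝ) + 1 ≤ (c + 2) * Real.log n := by
  linarith [two_thirds_le_log hn]

end Parameters

end OnlineTopo

theorem mainTheorem9_general :
    ∃ C : ℝ, 0 ≤ C ∧ ∀ (n p : ℕ) (t : ℕ → ℝ),
      (∀ i ≤ p + 1, √n < t i) →
      t (p + 1) = n →
      ∀ (E₀ es : List (Fin n × Fin n)) (T₀ : Fin n ≃ Fin n),
        OnlineTopo.IsTopologicalOrder E₀ T₀ →
        es.Nodup →
        OnlineTopo.IsAcyclic (E₀ ++ es) →
        ∃ (fuel : ℕ) (s : OnlineTopo.Mem n),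
          (OnlineTopo.session p (fun i => ⌊t i⌋₊) fuel E₀ es).run (OnlineTopo.emptyMem T₀)
            = some ((), s) ∧
          (s.clock : ℝ) ≤ C * ((p + 1) * Real.log n) *
            (∑ i ∈ Finset.Icc 1 (p + 1),
                (n : ℝ) ^ 2 * t i ^ (3 / 2 : ℝ) / t (i - 1)
              + (n : ℝ) ^ 2 * t 0) := by
  refine ⟨1000, by norm_num, fun n p t ht htn E₀ es T₀ hT₀ hes hacyclic => ?_⟩
  have hn : (1 : ℝ) < n := OnlineTopo.one_lt_of_sqrt_lt_self (htn ▸ ht (p + 1) le_rfl)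
  have hone : ∀ i ≤ p + 1, 1 ≤ t i := fun i hi =>
    (Real.one_le_sqrt.2 hn.le).trans (ht i hi).le
  obtain ⟨fuel, s, hrun, hclock⟩ := OnlineTopo.exists_session_clock_le
    (ht 0 (Nat.zero_le _)).le hone htn.ge hT₀ hes hacyclic
  exact ⟨fuel, s, hrun, hclock.trans (mul_le_mul_of_nonneg_right
    (OnlineTopo.overhead_le (by exact_mod_cast hn) p)
    (OnlineTopo.levelSum_add_nonneg n fun i hi => zero_le_one.trans (hone i hi)))⟩

theorem mainTheorem9 :
    ∃ κ : ℕ, ∀ c : ℝ, ∃ C : ℝ, ∀ (n p : ℕ) (t : ℕ → ℝ),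
      (p : ℝ) ≤ c * Real.log n →
      Real.sqrt n < t 0 →
      (∀ i ≤ p, t i < t (i + 1)) →
      t (p + 1) = n →
      ∀ (E₀ es : List (Fin n × Fin n)) (T₀ : Fin n ≃ Fin n),
        OnlineTopo.IsTopologicalOrder E₀ T₀ →
        (E₀ ++ es).Nodup →
        OnlineTopo.IsAcyclic (E₀ ++ es) →
        ∃ (fuel : ℕ) (s : OnlineTopo.Mem n),
          (OnlineTopo.session p (fun i => ⌊t i⌋₊) fuel E₀ es).run (OnlineTopo.emptyMem T₀)
            = some ((), s) ∧
          (s.clock : ℝ) ≤ C * Real.log n ^ κ *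
            (∑ i ∈ Finset.Icc 1 (p + 1),
                (n : ℝ) ^ 2 * t i ^ (3 / 2 : ℝ) / t (i - 1)
              + (n : ℝ) ^ 2 * t 0) := by
  obtain ⟨C, hC, hbound⟩ := mainTheorem9_general
  refine ⟨2, fun c => ⟨C * (c + 2), fun n p t hp ht₀ ht htn E₀ es T₀ hT₀ hnodup hacyclic => ?_⟩⟩
  have hsqrt := OnlineTopo.lt_of_forall_lt_succ ht₀ ht
  have hn : (1 : ℝ) < n := OnlineTopo.one_lt_of_sqrt_lt_self (htn ▸ hsqrt (p + 1) le_rfl)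
  obtain ⟨fuel, s, hrun, hclock⟩ :=
    hbound n p t hsqrt htn E₀ es T₀ hT₀ hnodup.of_append_right hacyclic
  refine ⟨fuel, s, hrun, hclock.trans (mul_le_mul_of_nonneg_right ?_
    (OnlineTopo.levelSum_add_nonneg n fun i hi => (Real.sqrt_nonneg _).trans (hsqrt i hi).le))⟩
  calc C * ((p + 1) * Real.log n) ≤ C * ((c + 2) * Real.log n * Real.log n) := by
        gcongr
        exact OnlineTopo.succ_le_mul_log (by exact_mod_cast hn) hp
    _ = C * (c + 2) * Real.log n ^ 2 := by ring
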